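/- **Energy (tilt) estimate.** Let $m\ge 1$ and let $\overline M=\mathbb R\times S$ be an $(m+1)$-dimensional globally hyperbolic spacetime, written by means of a splitting time function $\tau$ (the projection onto $\mathbb R$): the metric is $$\bar g=\bar\alpha^2\left(-d\tau^2+\bar\sigma\right),$$ where the metric and the lapse function $\bar\alpha>0$ are smooth, $\bar\sigma$ is a symmetric tensor whose kernel is spanned by $\partial_\tau$ and which is positive definite on each slice $\{\tau=t\}$, and each slice is a Cauchy hypersurface. Let $T=\bar\alpha^{-1}\partial_\tau$ and let $\pi:\overline M\to S$ be the projection. Let $\Sigma\subset\overline M$ be a smooth compact connected spacelike achronal hypersurface with boundary (spacelike up to the boundary) whose Cauchy development $D(\Sigma)=D^+(\Sigma)\cup D^-(\Sigma)$ is precompact, and let $\varphi=\tau|_\Sigma$ be its height function. For $u:\Sigma\to\mathbb R$ let $F_u(x)=(u(x),\pi(x))$ be the graph map, $\sigma_u=F_u^*\bar\sigma$, $g_u=F_u^*\bar g$, and $$\mathscr Y_\tau(\Sigma)=\{u\in \mathrm{Lip}(\Sigma):\ |du|_{\sigma_u}\le 1 \text{ a.e. on } \Sigma,\ u=\varphi\text{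 on }\partial\Sigma\}.$$ If $u$ is smooth and spacelike, i.e. $|du|_{\sigma_u}<1$ on $\Sigma$, let $N_u$ be the future pointing unit normal to its graph, $w_u=-\bar g(T,N_u)$ the tilt function, and $H_u=\operatorname{tr}_{g_u}\mathrm{II}$ the scalar mean curvature, with $\mathrm{II}(V,W)=-\bar g(\overline\nabla_{F_{u*}V}F_{u*}W,N_u)$, where $\overline\nabla$ is the Levi-Civita connection of $\bar g$. Then for each smooth vector field $X$ on $\overline M$ there is a constant $C_X$, depending only on $X$, $\Sigma$, $\tau$ (and $\overline M$), such that for every $\rho\in C^\infty(\Sigma)$ and every spacelike $u\in\mathscr Y_\tau(\Sigma)\cap C^\infty(\Sigma)$ with $$H_u=\rho+\bar g(X,N_u)\qquad\text{in the interior of }\Sigma$$ the function $w_u$ is integrable and $$\int_\Sigma w_u\,dV_{\sigma_u}\le C_X\left(1+\|\rho\|_{L^1(\Sigma)}\right),$$ where $dV_{\sigma_u}$ is the Riemannian volume measure of $\sigma_u$ and the $L^1$ norm is taken with respect to $dV_{\sigma_\varphi}$. -/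

import Mathlib

open Set Filter Topology MeasureTheory
open scoped Manifold ContDiff

noncomputable section

namespace SpacelikePMC

/-! ## Fields of bilinear forms on a manifold: coordinates, Christoffel symbols, volume -/

section Tensor

variable {E H : Type*} [NormedAddCommGroup E] [NormedSpace ℝ E] [TopologicalSpace H]

/-- A `2`-covariant tensor field on `M` (no regularity assumed). -/
abbrev BilinField (I : ModelWithCorners ℝ E H) (M : Type*) [TopologicalSpace M]
    [ChartedSpace H M] : Type _ :=
  (x : M) → TangentSpace I x →L[ℝ] TangentSpace I x →L[ℝ] ℝ

/-- The pullback `(v, w) ↦ B (A v) (A w)` of a bilinear form by a linear map. -/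
def pullForm {V W : Type*} [NormedAddCommGroup V] [NormedSpace ℝ V] [NormedAddCommGroup W]
    [NormedSpace ℝ W] (B : W →L[ℝ] W →L[ℝ] ℝ) (A : V →L[ℝ] W) : V →L[ℝ] V →L[ℝ] ℝ :=
  B.bilinearComp A A

/-- The tensor field `B` read in the preferred chart at `x₀`: at the point `y` of the model space
it is the pullback of `B` by the inverse of the chart, so that for basis vectors `eᵢ` the number
`coordForm I B x₀ y eᵢ eⱼ` is the coefficient `B_{ij}(y)`. -/
def coordForm (I : ModelWithCorners ℝ E H) {M : Type*} [TopologicalSpace M] [ChartedSpace H M]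
    (B : BilinField I M) (x₀ : M) (y : E) : E →L[ℝ] E →L[ℝ] ℝ :=
  pullForm (V := E) (W := E) (B ((extChartAt I x₀).symm y))
    (mfderivWithin 𝓘(ℝ, E) I (extChartAt I x₀).symm (range I) y)

/-- Christoffel symbols of the first kind of the (pseudo-)metric `B` in the preferred chart at
`x₀`, at the point `y`: `B(∇_a b, c) = ½ (∂_a B(b,c) + ∂_b B(a,c) - ∂_c B(a,b))` for constant
coordinate vector fields `a`, `b`, `c`, where `∇` is the Levi-Civita connection of `B`. -/
def christoffelFirst (I : ModelWithCorners ℝ E H) {M : Type*} [TopologicalSpace M]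
    [ChartedSpace H M] (B : BilinField I M) (x₀ : M) (y a b c : E) : ℝ :=
  let dB : E →L[ℝ] E →L[ℝ] E →L[ℝ] ℝ := fderivWithin ℝ (coordForm I B x₀) (range I) y
  (dB a b c + dB b a c - dB c a b) / 2

end Tensor

section Volume

variable {m : ℕ} {H : Type*} [TopologicalSpace H]

/-- The matrix `B(eᵢ, eⱼ)` of a bilinear form in the standard basis. -/
def gram (B : EuclideanSpace ℝ (Fin m) →L[ℝ] EuclideanSpace ℝ (Fin m) →L[ℝ] ℝ) :
    Matrix (Fin m) (Fin m) ℝ :=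
  Matrix.of fun i j => B (EuclideanSpace.single i 1) (EuclideanSpace.single j 1)

/-- The dual norm `|ℓ|_B = sup { |ℓ v| : B(v,v) ≤ 1 }` of a covector, for `B` positive definite. -/
def covectorNorm (B : EuclideanSpace ℝ (Fin m) →L[ℝ] EuclideanSpace ℝ (Fin m) →L[ℝ] ℝ)
    (ℓ : EuclideanSpace ℝ (Fin m) →L[ℝ] ℝ) : ℝ :=
  sSup {r : ℝ | ∃ v, B v v ≤ 1 ∧ r = |ℓ v|}

/-- The measure `√(det B_{ij}) dy¹ ⋯ dyᵐ` of the preferred chart at `x₀`, carried by the domain of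
that chart. -/
def chartVolume (I : ModelWithCorners ℝ (EuclideanSpace ℝ (Fin m)) H) {M : Type*}
    [TopologicalSpace M] [ChartedSpace H M] [MeasurableSpace M] (B : BilinField I M) (x₀ : M) :
    Measure M :=
  ((volume.restrict (extChartAt I x₀).target).withDensity fun y =>
    ENNReal.ofReal (Real.sqrt (gram (coordForm I B x₀ y)).det)).map (extChartAt I x₀).symm

/-- The Riemannian volume measure `dV_B`: the least measure that dominates
`√(det B_{ij}) dy¹ ⋯ dyᵐ` in each chart.  By the change of variables formula the chart measures
agree on the overlaps of the charts, so this is the measure that restricts to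
`√(det B_{ij}) dy¹ ⋯ dyᵐ` on each chart domain. -/
def riemannianVolume (I : ModelWithCorners ℝ (EuclideanSpace ℝ (Fin m)) H) {M : Type*}
    [TopologicalSpace M] [ChartedSpace H M] [MeasurableSpace M] (B : BilinField I M) :
    Measure M :=
  ⨆ x₀ : M, chartVolume I B x₀

end Volume

/-! ## Spacetimes written as `ℝ × S` by a splitting time function -/

/-- The model with corners of `ℝ × S`, for `S` an `m`-manifold without boundary. -/
abbrev ambientModel (m : ℕ) :
    ModelWithCorners ℝ (ℝ × EuclideanSpace ℝ (Fin m)) (ModelProd ℝ (EuclideanSpace ℝ (Fin m))) :=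
  𝓘(ℝ, ℝ).prod (𝓡 m)

/-- The time component `dτ(v)` of a tangent vector of `ℝ × S`. -/
def dτ {m : ℕ} {S : Type*} [TopologicalSpace S] [ChartedSpace (EuclideanSpace ℝ (Fin m)) S]
    {p : ℝ × S} (v : TangentSpace (ambientModel m) p) : ℝ :=
  Prod.fst (α := ℝ) (β := EuclideanSpace ℝ (Fin m)) v

/-- The spatial component `dπ(v)` of a tangent vector of `ℝ × S`, where `π : ℝ × S → S`. -/
def dπ {m : ℕ} {S : Type*} [TopologicalSpace S] [ChartedSpace (EuclideanSpace ℝ (Fin m)) S]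
    {p : ℝ × S} (v : TangentSpace (ambientModel m) p) : TangentSpace (𝓡 m) p.2 :=
  Prod.snd (α := ℝ) (β := EuclideanSpace ℝ (Fin m)) v

/-- A spacetime `ℝ × S` with time function `τ(t, x) = t` and smooth Lorentzian metric
`g = α² (-dτ² + σ)`, where `α > 0` is the lapse function and `σ` is a symmetric tensor with
kernel spanned by `∂_τ` (equivalently by the gradient of `τ`) and positive definite on the
slices `{τ = t}`; so `σ` is a family of Riemannian metrics on `S` that depends on `(t, x)`.
The time orientation is the one for which `∂_τ` is future pointing. -/
structure SplitSpacetime (m : ℕ) (S : Type*) [TopologicalSpace S]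
    [ChartedSpace (EuclideanSpace ℝ (Fin m)) S] [IsManifold (𝓡 m) ∞ S] where
  /-- the Lorentzian metric -/
  g : BilinField (ambientModel m) (ℝ × S)
  /-- the lapse function -/
  lapse : ℝ × S → ℝ
  /-- the spatial tensor, as a form on the tangent spaces of `S` -/
  σ : (p : ℝ × S) → TangentSpace (𝓡 m) p.2 →L[ℝ] TangentSpace (𝓡 m) p.2 →L[ℝ] ℝ
  lapse_pos : ∀ p, 0 < lapse p
  contMDiff_lapse : ContMDiff (ambientModel m) 𝓘(ℝ, ℝ) ∞ lapse
  contMDiff_g : ContMDiff (ambientModel m) ((ambientModel m).prod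
    𝓘(ℝ, (ℝ × EuclideanSpace ℝ (Fin m)) →L[ℝ] (ℝ × EuclideanSpace ℝ (Fin m)) →L[ℝ] ℝ)) ∞
    (fun p => Bundle.TotalSpace.mk'
      ((ℝ × EuclideanSpace ℝ (Fin m)) →L[ℝ] (ℝ × EuclideanSpace ℝ (Fin m)) →L[ℝ] ℝ)
      (E := fun p : ℝ × S =>
        TangentSpace (ambientModel m) p →L[ℝ] TangentSpace (ambientModel m) p →L[ℝ] ℝ)
      p (g p))
  σ_symm : ∀ p v w, σ p v w = σ p w v
  σ_pos : ∀ p v, v ≠ 0 → 0 < σ p v v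
  g_eq : ∀ p v w, g p v w = lapse p ^ 2 * (-(dτ v * dτ w) + σ p (dπ v) (dπ w))

namespace SplitSpacetime

variable {m : ℕ} {S : Type*} [TopologicalSpace S] [ChartedSpace (EuclideanSpace ℝ (Fin m)) S]
  [IsManifold (𝓡 m) ∞ S] (𝓜 : SplitSpacetime m S)

/-- The future pointing unit vector field `T = α⁻¹ ∂_τ`. -/
def T (p : ℝ × S) : TangentSpace (ambientModel m) p :=
  Prod.mk (α := ℝ) (β := EuclideanSpace ℝ (Fin m)) (𝓜.lapse p)⁻¹ 0

/-! ### Causal theory -/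

/-- Future pointing timelike vectors. -/
def FutureTimelike (p : ℝ × S) (v : TangentSpace (ambientModel m) p) : Prop :=
  𝓜.g p v v < 0 ∧ 𝓜.g p (𝓜.T p) v < 0

/-- Future pointing causal vectors (timelike or null, and nonzero). -/
def FutureCausal (p : ℝ × S) (v : TangentSpace (ambientModel m) p) : Prop :=
  𝓜.g p v v ≤ 0 ∧ v ≠ 0 ∧ 𝓜.g p (𝓜.T p) v < 0

/-- Past pointing causal vectors (timelike or null, and nonzero). -/
def PastCausal (p : ℝ × S) (v : TangentSpace (ambientModel m) p) : Prop :=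
  𝓜.g p v v ≤ 0 ∧ v ≠ 0 ∧ 0 < 𝓜.g p (𝓜.T p) v

/-- `γ` is of class `C¹` on `[a, b]`, with velocity in the cone field `K`. -/
def IsC1Piece (K : (p : ℝ × S) → TangentSpace (ambientModel m) p → Prop) (γ : ℝ → ℝ × S)
    (a b : ℝ) : Prop :=
  ContMDiffOn 𝓘(ℝ, ℝ) (ambientModel m) 1 γ (Icc a b) ∧
    ∀ s ∈ Icc a b, K (γ s) (mfderivWithin 𝓘(ℝ, ℝ) (ambientModel m) γ (Icc a b) s (1 : ℝ))

/-- `γ : [0, ∞) → ℝ × S` is a piecewise `C¹` curve with velocity in the cone field `K` that starts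
at `p` and is inextendible, i.e. has no endpoint. -/
def IsInextendibleFrom (K : (p : ℝ × S) → TangentSpace (ambientModel m) p → Prop) (p : ℝ × S)
    (γ : ℝ → ℝ × S) : Prop :=
  γ 0 = p ∧
    (∃ t : ℕ → ℝ, t 0 = 0 ∧ StrictMono t ∧ Tendsto t atTop atTop ∧
      ∀ i, IsC1Piece K γ (t i) (t (i + 1))) ∧
    ¬ ∃ q, Tendsto γ atTop (𝓝 q)

/-- `γ : ℝ → ℝ × S` is an inextendible, future directed, piecewise `C¹` timelike curve: it has no
past and no future endpoint. -/
def IsInextendibleTimelike (γ : ℝ → ℝ × S) : Prop :=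
  (∃ t : ℤ → ℝ, StrictMono t ∧ Tendsto t atTop atTop ∧ Tendsto t atBot atBot ∧
      ∀ i, IsC1Piece 𝓜.FutureTimelike γ (t i) (t (i + 1))) ∧
    (¬ ∃ q, Tendsto γ atTop (𝓝 q)) ∧ ¬ ∃ q, Tendsto γ atBot (𝓝 q)

/-- A set is achronal if each inextendible timelike curve meets it at most once. -/
def Achronal (A : Set (ℝ × S)) : Prop :=
  ∀ γ, 𝓜.IsInextendibleTimelike γ → ∀ s s', γ s ∈ A → γ s' ∈ A → s = s'

/-- A set is a Cauchy hypersurface if each inextendible timelike curve meets it exactly once. -/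
def IsCauchyHypersurface (A : Set (ℝ × S)) : Prop :=
  ∀ γ, 𝓜.IsInextendibleTimelike γ → ∃! s, γ s ∈ A

/-- `τ` is a splitting time function of a globally hyperbolic spacetime: each slice `{τ = t}` is a
Cauchy hypersurface. -/
def IsGloballyHyperbolicSplitting : Prop :=
  ∀ t : ℝ, 𝓜.IsCauchyHypersurface {p | p.1 = t}

/-- The future Cauchy development `D⁺(A)`: all points such that each past pointing inextendible
causal curve from the point meets `A`. -/
def futureDevelopment (A : Set (ℝ × S)) : Set (ℝ × S) :=
  {p | ∀ γ, IsInextendibleFrom 𝓜.PastCausal p γ → ∃ s, 0 ≤ s ∧ γ s ∈ A}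

/-- The past Cauchy development `D⁻(A)`. -/
def pastDevelopment (A : Set (ℝ × S)) : Set (ℝ × S) :=
  {p | ∀ γ, IsInextendibleFrom 𝓜.FutureCausal p γ → ∃ s, 0 ≤ s ∧ γ s ∈ A}

/-- The Cauchy development `D(A) = D⁺(A) ∪ D⁻(A)`. -/
def cauchyDevelopment (A : Set (ℝ × S)) : Set (ℝ × S) :=
  𝓜.futureDevelopment A ∪ 𝓜.pastDevelopment A

/-! ### Graphs over a compact spacelike hypersurface -/

section Graph

variable [NeZero m] {Sig : Type*} [TopologicalSpace Sig]
  [ChartedSpace (EuclideanHalfSpace m) Sig] (ι : Sig → ℝ × S)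

/-- The inclusion `ι : Σ → ℝ × S` of a compact manifold with boundary `Σ` is (the parametrization
of) a smooth spacelike hypersurface with boundary: `ι` is a smooth injective immersion (hence an
embedding), the induced metric is positive definite up to the boundary, and the image is
achronal. -/
structure IsSmoothSpacelikeHypersurface : Prop where
  contMDiff : ContMDiff (𝓡∂ m) (ambientModel m) ∞ ι
  injective : Function.Injective ι
  immersion : ∀ x, Function.Injective (mfderiv (𝓡∂ m) (ambientModel m) ι x)
  spacelike : ∀ (x : Sig) (v : TangentSpace (𝓡∂ m) x), v ≠ 0 →
    0 < 𝓜.g (ι x) (mfderiv (𝓡∂ m) (ambientModel m) ι x v)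
      (mfderiv (𝓡∂ m) (ambientModel m) ι x v)
  achronal : 𝓜.Achronal (range ι)

/-- The height function `φ = τ ∘ ι` of `Σ`. -/
def height (x : Sig) : ℝ := (ι x).1

/-- The graph map `F_u(x) = (u(x), π(x))`. -/
def graphMap (u : Sig → ℝ) (x : Sig) : ℝ × S := (u x, (ι x).2)

/-- The Riemannian metric `σ_u = F_u^* σ` on `Σ`; only the differential of `π ∘ ι` enters, since
`σ` annihilates `∂_τ`. -/
def σPull (u : Sig → ℝ) : BilinField (𝓡∂ m) Sig := fun x =>
  pullForm (V := EuclideanSpace ℝ (Fin m)) (W := EuclideanSpace ℝ (Fin m))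
    (𝓜.σ (graphMap ι u x)) (mfderiv (𝓡∂ m) (𝓡 m) (fun z => (ι z).2) x)

/-- The induced metric `g_u = F_u^* g` on `Σ`. -/
def gPull (u : Sig → ℝ) : BilinField (𝓡∂ m) Sig := fun x =>
  pullForm (V := EuclideanSpace ℝ (Fin m)) (W := ℝ × EuclideanSpace ℝ (Fin m))
    (𝓜.g (graphMap ι u x)) (mfderiv (𝓡∂ m) (ambientModel m) (graphMap ι u) x)

/-- `|du|_{σ_u}` at `x`. -/
def gradNorm (u : Sig → ℝ) (x : Sig) : ℝ :=
  covectorNorm (𝓜.σPull ι u x) (mfderiv (𝓡∂ m) 𝓘(ℝ, ℝ) u x)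

/-- The set `Y_τ(Σ)` of Lipschitz functions with `|du|_{σ_u} ≤ 1` a.e. that agree with the height
of `Σ` on the boundary.  (On a compact manifold a function is Lipschitz for a Riemannian distance
if and only if it is locally Lipschitz in charts; null sets are those of the volume of `σ_φ`.) -/
def Yτ [MeasurableSpace Sig] : Set (Sig → ℝ) :=
  {u | (∀ x : Sig, ∃ K, ∃ s ∈ 𝓝[range (𝓡∂ m)] (extChartAt (𝓡∂ m) x x),
          LipschitzOnWith K (u ∘ (extChartAt (𝓡∂ m) x).symm) s) ∧
    (∀ᵐ x ∂(riemannianVolume (𝓡∂ m) (𝓜.σPull ι (height ι))), 𝓜.gradNorm ι u x ≤ 1) ∧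
    ∀ x ∈ (𝓡∂ m).boundary Sig, u x = height ι x}

/-- `N` is the future pointing unit normal at `F_u(x)` to the graph of `u`. -/
def IsFutureUnitNormal (u : Sig → ℝ) (x : Sig)
    (N : TangentSpace (ambientModel m) (graphMap ι u x)) : Prop :=
  (∀ v : TangentSpace (𝓡∂ m) x,
      𝓜.g _ N (mfderiv (𝓡∂ m) (ambientModel m) (graphMap ι u) x v) = 0) ∧
    𝓜.g _ N N = -1 ∧ 𝓜.g _ (𝓜.T _) N < 0

open Classical in
/-- The future pointing unit normal `N_u` (and `0` where there is none). -/
def normal (u : Sig → ℝ) (x : Sig) : TangentSpace (ambientModel m) (graphMap ι u x) :=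
  if h : ∃ N, 𝓜.IsFutureUnitNormal ι u x N then h.choose else 0

/-- The tilt function `w_u = -g(T, N_u)`. -/
def tilt (u : Sig → ℝ) (x : Sig) : ℝ :=
  -𝓜.g (graphMap ι u x) (𝓜.T _) (𝓜.normal ι u x)

/-- The second fundamental form `II(v, w) = -g(∇_{F_* v} F_* w, N_u)` of the graph of `u` at `x`,
with `∇` the Levi-Civita connection of `g`, computed in the preferred charts at `x` and at
`F_u(x)`:
`II_{ij} = -(g_{ad} ∂_i∂_j F^a + Γ_{bc,d} ∂_i F^b ∂_j F^c) N^d`.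
A tangent vector at a point is, by definition, its coordinate vector in the preferred chart. -/
def secondFundamentalForm (u : Sig → ℝ) (x : Sig) (v w : EuclideanSpace ℝ (Fin m)) : ℝ :=
  let p : ℝ × S := graphMap ι u x
  let F : EuclideanSpace ℝ (Fin m) → ℝ × EuclideanSpace ℝ (Fin m) :=
    writtenInExtChartAt (𝓡∂ m) (ambientModel m) x (graphMap ι u)
  let y : EuclideanSpace ℝ (Fin m) := extChartAt (𝓡∂ m) x x
  let z : ℝ × EuclideanSpace ℝ (Fin m) := extChartAt (ambientModel m) p p
  let dF : EuclideanSpace ℝ (Fin m) →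
      EuclideanSpace ℝ (Fin m) →L[ℝ] ℝ × EuclideanSpace ℝ (Fin m) :=
    fderivWithin ℝ F (range (𝓡∂ m))
  let ddF : EuclideanSpace ℝ (Fin m) →L[ℝ]
      EuclideanSpace ℝ (Fin m) →L[ℝ] ℝ × EuclideanSpace ℝ (Fin m) :=
    fderivWithin ℝ dF (range (𝓡∂ m)) y
  let N : ℝ × EuclideanSpace ℝ (Fin m) := (𝓜.normal ι u x :)
  (-coordForm (ambientModel m) 𝓜.g p z (ddF v w) N -
    christoffelFirst (ambientModel m) 𝓜.g p z (dF y v) (dF y w) N : ℝ)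

/-- The scalar mean curvature `H_u = tr_{g_u} II = g_u^{ij} II_{ij}` of the graph of `u`. -/
def meanCurvature (u : Sig → ℝ) (x : Sig) : ℝ :=
  Matrix.trace ((gram (𝓜.gPull ι u x))⁻¹ *
    Matrix.of fun i j =>
      𝓜.secondFundamentalForm ι u x (EuclideanSpace.single i 1) (EuclideanSpace.single j 1))

end Graph

end SplitSpacetime

end SpacelikePMC

end

/-! Let `W = (1 - |du|²)^{-1/2}`, where norms and gradients of `u` are those of `σ_u`; this is the
tilt. Along the graph of `u` the field `∂_τ` splits into the normal part `αW N` and the tangential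
part `V = -W²∇u`. The `g_u`-divergence of `V` is `Q - αWH`, with `Q = ½ tr_{g_u}(∂_τ g)`
(`divergence_tangential`, `divergence_hatFlux`). Since `dV_{g_u} = α^m W⁻¹ dV_{σ_u}`, multiplying by
a function `ψ` that vanishes on `∂Σ` and integrating gives `∫ α^m W dψ(∇u) dV_{σ_u} = ∫ α^m ψ (Q/W -
αH) dV_{σ_u}`. If `u` takes values in a fixed compact interval, then `|Q| ≤ cW²` (`abs_hatDrift_le`)
and `|g(X,N)| ≤ cW` (`exists_normal_component_bound`). The equation then bounds the right side by `∫
α^m |ψ| (CW + α|ρ|)`.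

The interval exists because every admissible graph lies in `D(Σ)`. Take a point of the graph above
`Σ` and a past causal curve from it that misses `Σ`. Such a curve cannot cross the spacelike graph
upwards, so it stays in the compact region between `Σ` and the graph
(`IsCausalRay.mem_heightRegion`). A causal curve in a compact region has an endpoint
(`IsCausalRay.exists_tendsto`), so an inextendible one must meet `Σ`. Points below are treated
symmetrically, and precompactness of `D(Σ)` gives the bound.

It remains to choose `ψ` so that the left side beats `CW|ψ|`. By compactness `|dφ|_{σ_t} ≤ κ < 1`
when `|t - φ| ≤ η`. There `ψ = u - φ` has `dψ(∇u) = |du|² - dφ(∇u) ≥ (1 - κ) - (1 - |du|²)`, and the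
defect is harmless because `W(1 - |du|²) = 1/W ≤ 1`. Away from `Σ` the slope of `φ` for `σ_u` may be
large, and everywhere `C|ψ|W` has to be absorbed. So a signed square of `u - φ` with an exponential
weight in `λu` is added to `ψ`; its derivative contributes `λ(u - φ)² e |du|²`, which wins for large
`λ` (`testFun_lower_bound`). The outcome is `W dψ(∇u) - C|ψ|W ≥ δW - C₂` with `|ψ| ≤ M`
(`exists_graphTest_bound`). Integrating this, and comparing the volumes of `σ_u` and `σ_φ`
(`exists_volume_comparison`), proves the estimate.

The local computations use a chart of `Σ` as a spatial chart, which is legitimate since `π ∘ ι` has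
invertible differential. `meanCurvature_eq` moves the curvature, defined in charts centred at each
point, to one fixed chart; `riemannianVolume_restrict_source` does this for the volume. The
divergence theorem on a half space and a partition of unity do the rest. -/

noncomputable section

namespace SpacelikePMC

/-! ## Linear algebra of positive definite forms -/

section Forms

variable {V : Type*} [NormedAddCommGroup V] [NormedSpace ℝ V]

/-- Symmetric positive definite continuous bilinear forms. -/
structure IsInner (B : V →L[ℝ] V →L[ℝ] ℝ) : Prop where
  symm : ∀ v w, B v w = B w v
  pos : ∀ v, v ≠ 0 → 0 < B v v

namespace IsInner

variable {B : V →L[ℝ] V →L[ℝ] ℝ}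

lemma nonneg (hB : IsInner B) (v : V) : 0 ≤ B v v := by
  by_cases h : v = 0
  · simp [h]
  · exact (hB.pos v h).le

lemma injective (hB : IsInner B) : Function.Injective B := by
  refine (injective_iff_map_eq_zero B).2 fun v hv => ?_
  by_contra h
  have := hB.pos v h
  simp [hv] at this

lemma cauchySchwarz (hB : IsInner B) (v w : V) : (B v w) ^ 2 ≤ B v v * B w w := by
  by_cases h : w = 0
  · simp [h]
  have hw := hB.pos w h
  have key := hB.nonneg (B w w • v - B v w • w)
  have e : B (B w w • v - B v w • w) (B w w • v - B v w • w)
      = B w w * (B v v * B w w - (B v w) ^ 2) := by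
    simp only [map_sub, map_smul, sub_apply, smul_apply, smul_eq_mul]
    rw [hB.symm w v]; ring
  rw [e] at key
  have := nonneg_of_mul_nonneg_right key hw
  linarith

variable [FiniteDimensional ℝ V]

lemma isInvertible (hB : IsInner B) : B.IsInvertible := by
  have hfr : Module.finrank ℝ V = Module.finrank ℝ (V →L[ℝ] ℝ) := by
    rw [← (LinearMap.toContinuousLinearMap (E := V) (F' := ℝ) (𝕜 := ℝ)).finrank_eq]
    exact (Subspace.dual_finrank_eq (K := ℝ) (V := V)).symm
  let e := (LinearEquiv.ofInjectiveOfFinrankEq (B : V →ₗ[ℝ] (V →L[ℝ] ℝ)) hB.injective hfr)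
  exact ⟨e.toContinuousLinearEquiv, by ext; rfl⟩

end IsInner

/-- The vector that represents the covector `ℓ` for the form `B`. -/
def sharp (B : V →L[ℝ] V →L[ℝ] ℝ) (ℓ : V →L[ℝ] ℝ) : V := B.inverse ℓ

variable {B : V →L[ℝ] V →L[ℝ] ℝ}

lemma isInner_pullForm {W : Type*} [NormedAddCommGroup W] [NormedSpace ℝ W]
    {B : W →L[ℝ] W →L[ℝ] ℝ} (hB : IsInner B) {A : V →L[ℝ] W} (hA : Function.Injective A) :
    IsInner (pullForm B A) where
  symm v w := hB.symm _ _
  pos v hv := hB.pos _ (by simpa using hA.ne hv)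

@[simp] lemma form_add_apply (A B : V →L[ℝ] V →L[ℝ] ℝ) (v w : V) :
    (A + B) v w = A v w + B v w := rfl

@[simp] lemma form_sub_apply (A B : V →L[ℝ] V →L[ℝ] ℝ) (v w : V) :
    (A - B) v w = A v w - B v w := rfl

@[simp] lemma form_smul_apply (c : ℝ) (B : V →L[ℝ] V →L[ℝ] ℝ) (v w : V) :
    (c • B) v w = c * B v w := rfl

variable [FiniteDimensional ℝ V]

lemma IsInner.apply_sharp (hB : IsInner B) (ℓ : V →L[ℝ] ℝ) : B (sharp B ℓ) = ℓ := by
  obtain ⟨e, rfl⟩ := hB.isInvertible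
  simp [sharp]

lemma IsInner.eq_sharp (hB : IsInner B) {ℓ : V →L[ℝ] ℝ} {v : V} (h : B v = ℓ) :
    v = sharp B ℓ := hB.injective (by rw [h, hB.apply_sharp])

lemma IsInner.sq_le (hB : IsInner B) (ℓ : V →L[ℝ] ℝ) (v : V) :
    (ℓ v) ^ 2 ≤ ℓ (sharp B ℓ) * B v v := by
  have := hB.cauchySchwarz (sharp B ℓ) v
  rwa [hB.apply_sharp] at this

lemma IsInner.sharp_nonneg (hB : IsInner B) (ℓ : V →L[ℝ] ℝ) : 0 ≤ ℓ (sharp B ℓ) := by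
  have := hB.nonneg (sharp B ℓ)
  rwa [hB.apply_sharp] at this

end Forms

/-! ### Gram matrices: traces and determinants in the standard basis. -/

section Gram

variable {m : ℕ}

local notation "E" => EuclideanSpace ℝ (Fin m)

/-- The supremum that defines `covectorNorm` is at least `√q`, the value at the normalised
representing vector, so `q ≥ 1` would force a norm of at least `1`. Boundedness of the set has to be
checked because `sSup` of an unbounded set is `0`. -/
lemma IsInner.sharp_lt_one {B : E →L[ℝ] E →L[ℝ] ℝ} (hB : IsInner B) {ℓ : E →L[ℝ] ℝ}
    (h : covectorNorm B ℓ < 1) : ℓ (sharp B ℓ) < 1 := by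
  set q := ℓ (sharp B ℓ) with hq
  have hq0 : 0 ≤ q := hB.sharp_nonneg ℓ
  by_contra hcon
  push Not at hcon
  have hbdd : BddAbove {r : ℝ | ∃ v, B v v ≤ 1 ∧ r = |ℓ v|} := by
    -- A crude bound without square roots: `(ℓ v)² ≤ q ≤ (q + 1)²`.
    refine ⟨q + 1, ?_⟩
    rintro r ⟨v, hv, rfl⟩
    have := hB.sq_le ℓ v
    have h2 : (ℓ v) ^ 2 ≤ q := this.trans (by nlinarith [hB.nonneg v])
    exact abs_le_of_sq_le_sq (by nlinarith) (by linarith)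
  have hs : 0 < Real.sqrt q := Real.sqrt_pos.2 (by linarith)
  have hss : Real.sqrt q * Real.sqrt q = q := Real.mul_self_sqrt hq0
  have hmem : Real.sqrt q ∈ {r : ℝ | ∃ v, B v v ≤ 1 ∧ r = |ℓ v|} := by
    refine ⟨(Real.sqrt q)⁻¹ • sharp B ℓ, ?_, ?_⟩
    · simp only [map_smul, smul_apply, smul_eq_mul, hB.apply_sharp, ← hq]
      have : (√q)⁻¹ * ((√q)⁻¹ * q) = 1 := by
        nth_rewrite 3 [← hss]; field_simp
      exact this.le
    · rw [map_smul, smul_eq_mul, ← hq]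
      have : (√q)⁻¹ * q = √q := by
        nth_rewrite 2 [← hss]; field_simp
      rw [this, abs_of_pos hs]
  have h1 := le_csSup hbdd hmem
  have h2 : 1 ≤ Real.sqrt q := by rw [Real.one_le_sqrt]; exact hcon
  have h3 : covectorNorm B ℓ = sSup {r : ℝ | ∃ v, B v v ≤ 1 ∧ r = |ℓ v|} := rfl
  linarith

lemma eq_sum_single (v : E) : v = ∑ i, v i • EuclideanSpace.single i (1 : ℝ) := by
  ext j
  simp [Finset.sum_apply, Pi.single_apply]

lemma gram_apply (B : E →L[ℝ] E →L[ℝ] ℝ) (i j : Fin m) :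
    gram B i j = B (EuclideanSpace.single i 1) (EuclideanSpace.single j 1) := rfl

lemma clm_apply_eq_sum (ℓ : E →L[ℝ] ℝ) (v : E) :
    ℓ v = ∑ i, v i * ℓ (EuclideanSpace.single i 1) := by
  conv_lhs => rw [eq_sum_single v]
  simp [map_sum]

lemma form_apply_eq_sum (B : E →L[ℝ] E →L[ℝ] ℝ) (v w : E) :
    B v w = ∑ i, ∑ j, v i * w j * gram B i j := by
  rw [clm_apply_eq_sum (B v) w]
  have : ∀ j, B v (EuclideanSpace.single j 1)
      = ∑ i, v i * B (EuclideanSpace.single i 1) (EuclideanSpace.single j 1) := fun j => by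
    have := clm_apply_eq_sum (B.flip (EuclideanSpace.single j 1)) v
    simpa using this
  simp_rw [this, Finset.mul_sum]
  rw [Finset.sum_comm]
  refine Finset.sum_congr rfl fun i _ => Finset.sum_congr rfl fun j _ => ?_
  rw [gram_apply]; ring

lemma form_eq_dotProduct (B : E →L[ℝ] E →L[ℝ] ℝ) (v w : E) :
    B v w = v.ofLp ⬝ᵥ (gram B).mulVec w.ofLp := by
  rw [form_apply_eq_sum]
  simp only [dotProduct, Matrix.mulVec, Finset.mul_sum]
  refine Finset.sum_congr rfl fun i _ => Finset.sum_congr rfl fun j _ => ?_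
  ring

lemma posSemidef_gram {B : E →L[ℝ] E →L[ℝ] ℝ} (hs : ∀ v w, B v w = B w v)
    (hn : ∀ v, 0 ≤ B v v) : (gram B).PosSemidef := by
  refine Matrix.PosSemidef.of_dotProduct_mulVec_nonneg ?_ fun x => ?_
  · ext i j
    simp [gram_apply, hs (EuclideanSpace.single j 1)]
  · have := hn (WithLp.toLp 2 x)
    rw [form_eq_dotProduct] at this
    simpa using this

lemma IsInner.posDef_gram {B : E →L[ℝ] E →L[ℝ] ℝ} (hB : IsInner B) : (gram B).PosDef := by
  refine Matrix.PosDef.of_dotProduct_mulVec_pos (posSemidef_gram hB.symm hB.nonneg).1 fun x hx => ?_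
  have := hB.pos (WithLp.toLp 2 x) (by
    intro h; exact hx (by simpa using h))
  rw [form_eq_dotProduct] at this
  simpa using this

lemma IsInner.det_gram_pos {B : E →L[ℝ] E →L[ℝ] ℝ} (hB : IsInner B) : 0 < (gram B).det :=
  hB.posDef_gram.det_pos

lemma gram_pullForm (B : E →L[ℝ] E →L[ℝ] ℝ) (J : E →L[ℝ] E) :
    gram (pullForm B J) =
      (LinearMap.toMatrix (EuclideanSpace.basisFun (Fin m) ℝ).toBasis
        (EuclideanSpace.basisFun (Fin m) ℝ).toBasis (J : E →ₗ[ℝ] E)).transpose * gram B *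
      (LinearMap.toMatrix (EuclideanSpace.basisFun (Fin m) ℝ).toBasis
        (EuclideanSpace.basisFun (Fin m) ℝ).toBasis (J : E →ₗ[ℝ] E)) := by
  ext i j
  rw [gram_apply]
  change B (J _) (J _) = _
  rw [form_apply_eq_sum]
  simp only [Matrix.mul_apply, Matrix.transpose_apply, LinearMap.toMatrix_apply, Finset.sum_mul]
  rw [Finset.sum_comm]
  refine Finset.sum_congr rfl fun k _ => Finset.sum_congr rfl fun l _ => ?_
  simp
  ring

lemma det_gram_pullForm (B : E →L[ℝ] E →L[ℝ] ℝ) (J : E →L[ℝ] E) :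
    (gram (pullForm B J)).det = J.det ^ 2 * (gram B).det := by
  rw [gram_pullForm, Matrix.det_mul, Matrix.det_mul, Matrix.det_transpose,
    LinearMap.det_toMatrix]
  rw [ContinuousLinearMap.det]; ring

/-- Pulling back conjugates the endomorphism `B⁻¹A` by the matrix of `J`, and the trace is cyclic.
This makes the mean curvature independent of the chart of `Σ`. -/
lemma trace_inv_gram_pullForm (B : E →L[ℝ] E →L[ℝ] ℝ) (A : E →L[ℝ] E →L[ℝ] ℝ) (J : E →L[ℝ] E)
    (hJ : J.det ≠ 0) :
    Matrix.trace ((gram (pullForm B J))⁻¹ * gram (pullForm A J)) =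
      Matrix.trace ((gram B)⁻¹ * gram A) := by
  rw [gram_pullForm, gram_pullForm]
  set M := (LinearMap.toMatrix (EuclideanSpace.basisFun (Fin m) ℝ).toBasis
        (EuclideanSpace.basisFun (Fin m) ℝ).toBasis (J : E →ₗ[ℝ] E))
  have hM : IsUnit M.det := by
    rw [LinearMap.det_toMatrix, isUnit_iff_ne_zero]; exact hJ
  have hMt : IsUnit M.transpose.det := by rwa [Matrix.det_transpose]
  rw [Matrix.mul_inv_rev, Matrix.mul_inv_rev]
  have : M⁻¹ * ((gram B)⁻¹ * M.transpose⁻¹) * (M.transpose * gram A * M)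
      = M⁻¹ * ((gram B)⁻¹ * gram A * M) := by
    simp only [Matrix.mul_assoc]
    rw [← Matrix.mul_assoc (M.transpose⁻¹), Matrix.nonsing_inv_mul _ hMt, Matrix.one_mul]
  rw [this, Matrix.trace_mul_comm, Matrix.mul_assoc, Matrix.mul_nonsing_inv _ hM, Matrix.mul_one]

/-- The form `ℓ ⊗ ℓ'`. -/
def tensorForm {V : Type*} [NormedAddCommGroup V] [NormedSpace ℝ V]
    (ℓ ℓ' : V →L[ℝ] ℝ) : V →L[ℝ] V →L[ℝ] ℝ := ℓ.smulRight ℓ'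

@[simp] lemma tensorForm_apply {V : Type*} [NormedAddCommGroup V] [NormedSpace ℝ V]
    (ℓ ℓ' : V →L[ℝ] ℝ) (v w : V) : tensorForm ℓ ℓ' v w = ℓ v * ℓ' w := by
  simp [tensorForm]

lemma gram_mulVec (B : E →L[ℝ] E →L[ℝ] ℝ) (hB : ∀ v w, B v w = B w v) (v : E) :
    (gram B).mulVec v.ofLp = fun i => B v (EuclideanSpace.single i 1) := by
  funext i
  rw [hB, clm_apply_eq_sum]
  simp [Matrix.mulVec, dotProduct, gram_apply, mul_comm]

lemma IsInner.inv_gram_mulVec {B : E →L[ℝ] E →L[ℝ] ℝ} (hB : IsInner B) (ℓ : E →L[ℝ] ℝ) :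
    (gram B)⁻¹.mulVec (fun i => ℓ (EuclideanSpace.single i 1)) = (sharp B ℓ).ofLp := by
  have h := gram_mulVec B hB.symm (sharp B ℓ)
  rw [hB.apply_sharp] at h
  rw [← h, Matrix.mulVec_mulVec, Matrix.nonsing_inv_mul _ hB.det_gram_pos.ne'.isUnit,
    Matrix.one_mulVec]

lemma IsInner.trace_inv_mul_tensor {B : E →L[ℝ] E →L[ℝ] ℝ} (hB : IsInner B) (ℓ ℓ' : E →L[ℝ] ℝ) :
    Matrix.trace ((gram B)⁻¹ * gram (tensorForm ℓ ℓ')) = ℓ' (sharp B ℓ) := by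
  rw [clm_apply_eq_sum, ← hB.inv_gram_mulVec]
  simp only [Matrix.trace, Matrix.diag, Matrix.mul_apply, Matrix.mulVec, dotProduct, gram_apply,
    tensorForm_apply, Finset.sum_mul]
  refine Finset.sum_congr rfl fun i _ => Finset.sum_congr rfl fun j _ => ?_
  ring

lemma gram_add (A B : E →L[ℝ] E →L[ℝ] ℝ) : gram (A + B) = gram A + gram B := by
  ext i j; simp [gram_apply]

lemma gram_sub (A B : E →L[ℝ] E →L[ℝ] ℝ) : gram (A - B) = gram A - gram B := by
  ext i j; simp [gram_apply]

lemma gram_smul (c : ℝ) (A : E →L[ℝ] E →L[ℝ] ℝ) : gram (c • A) = c • gram A := by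
  ext i j; simp [gram_apply]

open scoped MatrixOrder Matrix.Norms.L2Operator in
-- Write the inverse Gram matrix as `Cᴴ C`; the trace becomes that of the positive semidefinite
-- matrix `C A Cᴴ`.
lemma IsInner.trace_inv_mul_nonneg {B A : E →L[ℝ] E →L[ℝ] ℝ} (hB : IsInner B)
    (hs : ∀ v w, A v w = A w v) (hn : ∀ v, 0 ≤ A v v) :
    0 ≤ Matrix.trace ((gram B)⁻¹ * gram A) := by
  obtain ⟨C, hC⟩ := CStarAlgebra.nonneg_iff_eq_star_mul_self.1
    hB.posDef_gram.inv.posSemidef.nonneg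
  rw [Matrix.star_eq_conjTranspose] at hC
  rw [hC, Matrix.mul_assoc, Matrix.trace_mul_comm]
  exact ((posSemidef_gram hs hn).mul_mul_conjTranspose_same C).trace_nonneg

/-- Both forms `c(B + kℓ⊗ℓ) ± A` are nonnegative, hence so are their traces against `B⁻¹`. The rank
one term is there because the time derivative of the metric is controlled by a Riemannian norm of
`(ℓ v, v)`, which exceeds the induced metric by a multiple of `(ℓ v)²`. -/
lemma IsInner.abs_trace_inv_mul_le {B A : E →L[ℝ] E →L[ℝ] ℝ} (hB : IsInner B)
    (hs : ∀ v w, A v w = A w v) {ℓ : E →L[ℝ] ℝ} {c k : ℝ}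
    (hA : ∀ v, |A v v| ≤ c * (B v v + k * ℓ v ^ 2)) :
    |Matrix.trace ((gram B)⁻¹ * gram A)| ≤ c * (m + k * ℓ (sharp B ℓ)) := by
  have htot : Matrix.trace ((gram B)⁻¹ * gram (c • (B + k • tensorForm ℓ ℓ)))
      = c * (m + k * ℓ (sharp B ℓ)) := by
    rw [gram_smul, gram_add, gram_smul, Matrix.mul_smul, Matrix.mul_add, Matrix.mul_smul,
      Matrix.trace_smul, Matrix.trace_add, Matrix.trace_smul, hB.trace_inv_mul_tensor,
      Matrix.nonsing_inv_mul _ hB.det_gram_pos.ne'.isUnit]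
    simp
  have h1 := hB.trace_inv_mul_nonneg (A := c • (B + k • tensorForm ℓ ℓ) - A)
    (fun v w => by
      simp only [form_sub_apply, form_smul_apply, form_add_apply, tensorForm_apply]
      rw [hs v w, hB.symm v w, mul_comm (ℓ v)])
    (fun v => by
      have := (abs_le.1 (hA v)).2
      simp only [form_sub_apply, form_smul_apply, form_add_apply, tensorForm_apply]
      nlinarith)
  have h2 := hB.trace_inv_mul_nonneg (A := c • (B + k • tensorForm ℓ ℓ) + A)
    (fun v w => by
      simp only [form_smul_apply, form_add_apply, tensorForm_apply]
      rw [hs v w, hB.symm v w, mul_comm (ℓ v)])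
    (fun v => by
      have := (abs_le.1 (hA v)).1
      simp only [form_smul_apply, form_add_apply, tensorForm_apply]
      nlinarith)
  rw [gram_sub, Matrix.mul_sub, Matrix.trace_sub, htot] at h1
  rw [gram_add, Matrix.mul_add, Matrix.trace_add, htot] at h2
  rw [abs_le]; constructor <;> linarith

/-- The matrix determinant lemma for a rank one update. For `B = σ_u` and `ℓ = du` it produces the
factor `1 - |du|²` that relates the volumes of `g_u` and `σ_u`. -/
lemma IsInner.det_gram_sub_tensor {B : E →L[ℝ] E →L[ℝ] ℝ} (hB : IsInner B) (ℓ : E →L[ℝ] ℝ) :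
    (gram (B - tensorForm ℓ ℓ)).det = (gram B).det * (1 - ℓ (sharp B ℓ)) := by
  have h : gram (B - tensorForm ℓ ℓ) = gram B +
      Matrix.replicateCol Unit (fun i => -ℓ (EuclideanSpace.single i 1)) *
      Matrix.replicateRow Unit (fun i => ℓ (EuclideanSpace.single i 1)) := by
    ext i j
    simp [gram_apply, Matrix.mul_apply, sub_eq_add_neg]
  have hu : IsUnit (gram B).det := hB.det_gram_pos.ne'.isUnit
  rw [h, Matrix.det_add_replicateCol_mul_replicateRow hu]
  congr 1
  have e : (gram B)⁻¹.mulVec (fun i => -ℓ (EuclideanSpace.single i 1)) = -(sharp B ℓ).ofLp := by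
    rw [← hB.inv_gram_mulVec, ← Matrix.mulVec_neg]; rfl
  simp only [Matrix.det_unique, Matrix.add_apply, Matrix.one_apply_eq]
  rw [Matrix.mul_assoc, ← Matrix.replicateCol_mulVec, e, clm_apply_eq_sum]
  simp [Matrix.mul_apply, mul_comm, sub_eq_add_neg]

lemma IsInner.det_gram_smul_sub_tensor {B : E →L[ℝ] E →L[ℝ] ℝ} (hB : IsInner B) (ℓ : E →L[ℝ] ℝ)
    (c : ℝ) :
    (gram (c • (B - tensorForm ℓ ℓ))).det = c ^ m * ((gram B).det * (1 - ℓ (sharp B ℓ))) := by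
  rw [gram_smul, Matrix.det_smul, hB.det_gram_sub_tensor]
  simp

end Gram

/-! ## The divergence theorem on a half space -/

section HalfSpaceDivergence

/-- Apply the divergence theorem on a box that has one face on the boundary hyperplane and contains
the support. The field vanishes on that face by `h0` and on the other faces by `hs`. -/
lemma setIntegral_halfSpace_pi_divergence_eq_zero {n : ℕ} (f : Fin (n + 1) → (Fin (n + 1) → ℝ) → ℝ)
    (f' : Fin (n + 1) → (Fin (n + 1) → ℝ) → (Fin (n + 1) → ℝ) →L[ℝ] ℝ) {R : ℝ} (hR : 0 ≤ R)
    (hc : ∀ i, ContinuousOn (f i) {y | 0 ≤ y 0})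
    (hd : ∀ i y, 0 < y 0 → HasFDerivAt (f i) (f' i y) y)
    (h0 : ∀ i y, y 0 = 0 → f i y = 0)
    (hs : ∀ i y, 0 ≤ y 0 → (∃ j, R ≤ |y j|) → f i y = 0)
    (hi : IntegrableOn (fun y => ∑ i, f' i y (Pi.single i 1)) {y | 0 < y 0}) :
    ∫ y in {y : Fin (n + 1) → ℝ | 0 < y 0}, ∑ i, f' i y (Pi.single i 1) = 0 := by
  set g : (Fin (n + 1) → ℝ) → ℝ := fun y => ∑ i, f' i y (Pi.single i 1) with hg
  let a : Fin (n + 1) → ℝ := fun j => if j = 0 then 0 else -(R + 1)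
  let b : Fin (n + 1) → ℝ := fun _ => R + 1
  have ha0 : a 0 = 0 := if_pos rfl
  have hab : a ≤ b := fun j => by
    by_cases h : j = 0
    · simp only [a, b, h, if_true]; linarith
    · simp only [a, b, h, if_false]; linarith
  have hIcc : Icc a b ⊆ {y | 0 ≤ y 0} := fun y hy => by
    have := hy.1 0; rwa [ha0] at this
  have hIoo : (Set.pi univ fun i => Ioo (a i) (b i)) ⊆ {y | 0 < y 0} := fun y hy => by
    have := (hy 0 (mem_univ _)).1; rwa [ha0] at this
  have hae : (Set.pi univ fun i => Ioo (a i) (b i)) =ᵐ[volume] Icc a b :=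
    Measure.univ_pi_Ioo_ae_eq_Icc
  -- The sides of the box lie at `R + 1` rather than `R`, so a point of the half space outside it
  -- has a neighbourhood where the field vanishes, and there the derivative is zero too.
  have hout : ∀ y ∈ {y : Fin (n + 1) → ℝ | 0 < y 0} \ (Set.pi univ fun i => Ioo (a i) (b i)),
      g y = 0 := by
    rintro y ⟨hy0, hy⟩
    have hj : ∃ j, R < |y j| := by
      by_contra hcon
      push Not at hcon
      refine hy fun j _ => ?_
      have := abs_le.1 (hcon j)
      refine ⟨?_, by simp only [b]; linarith⟩
      by_cases h : j = 0
      · subst h; rw [ha0]; exact hy0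
      · simp only [a, h, if_false]; linarith
    obtain ⟨j, hj⟩ := hj
    have hev : ∀ᶠ z in 𝓝 y, 0 < z 0 ∧ R < |z j| := by
      have c1 : Continuous fun z : Fin (n + 1) → ℝ => z 0 := continuous_apply 0
      have c2 : Continuous fun z : Fin (n + 1) → ℝ => |z j| := (continuous_apply j).abs
      exact (c1.continuousAt.eventually (lt_mem_nhds hy0)).and
        (c2.continuousAt.eventually (lt_mem_nhds hj))
    refine Finset.sum_eq_zero fun i _ => ?_
    have hz : f i =ᶠ[𝓝 y] fun _ => 0 := hev.mono fun z hz => hs i z hz.1.le ⟨j, hz.2.le⟩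
    have := (hd i y hy0).congr_of_eventuallyEq hz.symm
    rw [this.unique (hasFDerivAt_const 0 y)]
    simp
  have key := integral_divergence_of_hasFDerivAt_off_countable' a b hab f f' ∅ countable_empty
    (fun i => (hc i).mono hIcc) (fun y hy i => hd i y (hIoo hy.1))
    ((hi.mono_set hIoo).congr_set_ae hae.symm)
  rw [setIntegral_eq_of_subset_of_forall_sdiff_eq_zero
    (measurableSet_lt measurable_const (measurable_pi_apply 0)) hIoo hout,
    setIntegral_congr_set hae, key]
  refine Finset.sum_eq_zero fun i _ => ?_
  have hmem : ∀ c : ℝ, 0 ≤ c → ∀ x ∈ Icc (a ∘ i.succAbove) (b ∘ i.succAbove),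
      (i = 0 → 0 ≤ c) → 0 ≤ (i.insertNth c x : Fin (n + 1) → ℝ) 0 := by
    intro c hc x hx _
    by_cases h : i = 0
    · subst h; simpa using hc
    · obtain ⟨j, hj⟩ := Fin.exists_succAbove_eq (Ne.symm h)
      have := hx.1 j
      simp only [Function.comp_apply, hj, ha0] at this
      rw [← hj, Fin.insertNth_apply_succAbove]
      exact this
  have h1 : ∫ x in Icc (a ∘ i.succAbove) (b ∘ i.succAbove), f i (i.insertNth (b i) x) = 0 := by
    refine setIntegral_eq_zero_of_forall_eq_zero fun x hx => ?_
    refine hs i _ (hmem _ (by simp only [b]; linarith) x hx fun _ => by simp only [b]; linarith)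
      ⟨i, ?_⟩
    rw [Fin.insertNth_apply_same]
    exact (le_abs_self _).trans' (by simp only [b]; linarith)
  have h2 : ∫ x in Icc (a ∘ i.succAbove) (b ∘ i.succAbove), f i (i.insertNth (a i) x) = 0 := by
    refine setIntegral_eq_zero_of_forall_eq_zero fun x hx => ?_
    by_cases h : i = 0
    · subst h
      refine h0 _ _ ?_
      rw [Fin.insertNth_apply_same, ha0]
    · obtain ⟨j, hj⟩ := Fin.exists_succAbove_eq (Ne.symm h)
      refine hs i _ ?_ ⟨i, ?_⟩
      · have := hx.1 j
        simp only [Function.comp_apply, hj, ha0] at this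
        rw [← hj, Fin.insertNth_apply_succAbove]
        exact this
      · rw [Fin.insertNth_apply_same]
        simp only [a, h, if_false, abs_neg]
        exact (le_abs_self _).trans' (by linarith)
  rw [h1, h2, sub_zero]

/-- The integral of the divergence of a compactly supported vector field on a closed half space
that vanishes on the boundary is zero. -/
lemma setIntegral_halfSpace_divergence_eq_zero {m : ℕ} [NeZero m]
    (f : Fin m → EuclideanSpace ℝ (Fin m) → ℝ)
    (f' : Fin m → EuclideanSpace ℝ (Fin m) → EuclideanSpace ℝ (Fin m) →L[ℝ] ℝ)
    {R : ℝ} (hR : 0 ≤ R)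
    (hc : ∀ i, ContinuousOn (f i) {y | 0 ≤ y 0})
    (hd : ∀ i y, 0 < y 0 → HasFDerivAt (f i) (f' i y) y)
    (h0 : ∀ i y, y 0 = 0 → f i y = 0)
    (hs : ∀ i y, 0 ≤ y 0 → R ≤ ‖y‖ → f i y = 0)
    (hi : IntegrableOn (fun y => ∑ i, f' i y (EuclideanSpace.single i 1)) {y | 0 < y 0}) :
    ∫ y in {y : EuclideanSpace ℝ (Fin m) | 0 < y 0},
      ∑ i, f' i y (EuclideanSpace.single i 1) = 0 := by
  obtain ⟨n, rfl⟩ : ∃ n, m = n + 1 := Nat.exists_eq_succ_of_ne_zero (NeZero.ne m)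
  let e : (Fin (n + 1) → ℝ) ≃L[ℝ] EuclideanSpace ℝ (Fin (n + 1)) :=
    (EuclideanSpace.equiv (Fin (n + 1)) ℝ).symm
  have he : ∀ x j, e x j = x j := fun x j => rfl
  have hemb : MeasurableEmbedding e := e.toHomeomorph.measurableEmbedding
  have hmp : MeasurePreserving e volume volume := PiLp.volume_preserving_toLp (Fin (n + 1))
  have hsingle : ∀ i : Fin (n + 1), e (Pi.single i 1) = EuclideanSpace.single i 1 := fun i => by
    ext j; simp [he, Pi.single_apply]
  have hpre : e ⁻¹' {y | 0 < y 0} = {x | 0 < x 0} := by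
    ext x; simp [he]
  have := setIntegral_halfSpace_pi_divergence_eq_zero (fun i x => f i (e x))
    (fun i x => (f' i (e x)).comp (e : (Fin (n + 1) → ℝ) →L[ℝ] EuclideanSpace ℝ (Fin (n + 1)))) hR
    (fun i => (hc i).comp e.continuous.continuousOn fun x hx => by simpa [he] using hx)
    (fun i x hx => (hd i (e x) (by simpa [he] using hx)).comp x e.hasFDerivAt)
    (fun i x hx => h0 i _ (by simpa [he] using hx))
    (fun i x hx ⟨j, hj⟩ => hs i _ (by simpa [he] using hx) (hj.trans (by
      have := PiLp.norm_apply_le (e x) j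
      simpa [he] using this)))
    (by
      have h2 := (hmp.integrableOn_comp_preimage hemb).2 hi
      rw [hpre] at h2
      refine h2.congr_fun (fun x _ => ?_) (by
        exact measurableSet_lt measurable_const (measurable_pi_apply 0))
      simp [hsingle])
  rw [← hmp.setIntegral_preimage_emb hemb, hpre]
  refine Eq.trans ?_ this
  refine integral_congr_ae (Eventually.of_forall fun x => ?_)
  simp [hsingle]

end HalfSpaceDivergence

/-! ## The divergence of a tangential field along an immersion -/

section Jacobi

variable {m : ℕ} {V : Type*} [NormedAddCommGroup V] [NormedSpace ℝ V]

/-- Factor out `A`: the determinant of `1 + s A⁻¹H` is a polynomial in `s` whose linear coefficient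
is the trace. -/
lemma hasDerivAt_det_add_smul (A H : Matrix (Fin m) (Fin m) ℝ) (hA : IsUnit A.det) :
    HasDerivAt (fun s : ℝ => (A + s • H).det) (A.det * Matrix.trace (A⁻¹ * H)) 0 := by
  set P := ((1 + (Polynomial.X : Polynomial ℝ) •
    (A⁻¹ * H).map Polynomial.C).det).divX.divX with hP
  have h1 : ∀ s : ℝ, (A + s • H).det =
      A.det * (1 + Matrix.trace (A⁻¹ * H) * s + P.eval s * s ^ 2) := fun s => by
    rw [← Matrix.det_one_add_smul, ← Matrix.det_mul, Matrix.mul_add, Matrix.mul_one,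
      Matrix.mul_smul, ← Matrix.mul_assoc, Matrix.mul_nonsing_inv _ hA, Matrix.one_mul]
  have h2 : HasDerivAt (fun s : ℝ => A.det * (1 + Matrix.trace (A⁻¹ * H) * s + P.eval s * s ^ 2))
      (A.det * (Matrix.trace (A⁻¹ * H) * 1 +
        (P.derivative.eval 0 * (0 : ℝ) ^ 2 + P.eval 0 * (2 * (0 : ℝ) ^ 1 * 1)))) 0 := by
    refine HasDerivAt.const_mul _ ?_
    refine HasDerivAt.add (((hasDerivAt_id (0 : ℝ)).const_mul _).const_add _) ?_
    exact (P.hasDerivAt 0).mul (hasDerivAt_pow 2 (0 : ℝ) |>.congr_deriv (by ring))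
  simp_rw [h1]
  convert h2 using 1
  ring

/-- Jacobi's formula. The determinant is a polynomial in the entries, so it is differentiable, and
its derivative is identified along the line through `M y` in the direction of the derivative of `M`.
-/
lemma hasFDerivAt_det {M : V → Matrix (Fin m) (Fin m) ℝ} {M' : Fin m → Fin m → V →L[ℝ] ℝ} {y : V}
    (h : ∀ i j, HasFDerivAt (fun z => M z i j) (M' i j) y) (hu : IsUnit (M y).det) :
    HasFDerivAt (fun z => (M z).det)
      ((M y).det • ∑ i, ∑ j, (M y)⁻¹ i j • M' j i) y := by
  let d : (Fin m → Fin m → ℝ) → ℝ := fun A => Matrix.det (Matrix.of A)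
  have hd : Differentiable ℝ d := by
    have : d = fun A => ∑ σ : Equiv.Perm (Fin m), (Equiv.Perm.sign σ : ℤ) • ∏ i, A (σ i) i := by
      funext A; simp only [d, Matrix.det_apply]; rfl
    rw [this]
    fun_prop
  let N : V → (Fin m → Fin m → ℝ) := fun z i j => M z i j
  have hN : HasFDerivAt N (ContinuousLinearMap.pi fun i => ContinuousLinearMap.pi fun j => M' i j) y :=
    hasFDerivAt_pi.2 fun i => hasFDerivAt_pi.2 fun j => h i j
  have hcomp := (hd (N y)).hasFDerivAt.comp y hN
  refine hcomp.congr_fderiv ?_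
  ext v
  set H : Fin m → Fin m → ℝ := fun i j => M' i j v with hH
  have hline : HasDerivAt (fun s : ℝ => d (N y + s • H)) (fderiv ℝ d (N y) H) 0 := by
    have hl : HasDerivAt (fun s : ℝ => N y + s • H) H 0 := by
      simpa using ((hasDerivAt_id (0 : ℝ)).smul_const H).const_add (N y)
    have : HasFDerivAt d (fderiv ℝ d (N y)) (N y + (0 : ℝ) • H) := by
      simpa using (hd (N y)).hasFDerivAt
    exact this.comp_hasDerivAt 0 hl
  have h2 := hasDerivAt_det_add_smul (M y) (Matrix.of H) hu
  have := hline.unique h2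
  change fderiv ℝ d (N y) H = _
  rw [this]
  simp [Matrix.trace, Matrix.mul_apply, hH]

end Jacobi

/-! ### Tangential divergence and second fundamental form of an immersion. -/

section Immersion

variable {m : ℕ} {W : Type*} [NormedAddCommGroup W] [NormedSpace ℝ W]

local notation "E" => EuclideanSpace ℝ (Fin m)

/-- Christoffel symbols of the first kind formed from the derivative of a metric. -/
def gammaFirst (dB : W →L[ℝ] W →L[ℝ] W →L[ℝ] ℝ) (a b c : W) : ℝ :=
  (dB a b c + dB b a c - dB c a b) / 2

/-- The covector `∇_v (F_* w)` of an immersion `F`, tested against `n`. -/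
def hessForm (B : W → W →L[ℝ] W →L[ℝ] ℝ) {V : Type*} [NormedAddCommGroup V] [NormedSpace ℝ V]
    (F : V → W) (y : V) (v w : V) (n : W) : ℝ :=
  B (F y) (fderiv ℝ (fderiv ℝ F) y v w) n +
    gammaFirst (fderiv ℝ B (F y)) (fderiv ℝ F y v) (fderiv ℝ F y w) n

variable {B : W → W →L[ℝ] W →L[ℝ] ℝ} {F : EuclideanSpace ℝ (Fin m) → W}
  {y : EuclideanSpace ℝ (Fin m)}

lemma hasFDerivAt_form_apply {B : W → W →L[ℝ] W →L[ℝ] ℝ} {V : Type*} [NormedAddCommGroup V]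
    [NormedSpace ℝ V] {F : V → W} {y : V} (hB : DifferentiableAt ℝ B (F y))
    (hF : DifferentiableAt ℝ F y) {p q : V → W} {p' q' : V →L[ℝ] W}
    (hp : HasFDerivAt p p' y) (hq : HasFDerivAt q q' y) :
    ∃ L : V →L[ℝ] ℝ, HasFDerivAt (fun z => B (F z) (p z) (q z)) L y ∧
      ∀ v, L v = fderiv ℝ B (F y) (fderiv ℝ F y v) (p y) (q y) + B (F y) (p' v) (q y)
        + B (F y) (p y) (q' v) := by
  have h0 : HasFDerivAt (fun z => B (F z)) ((fderiv ℝ B (F y)).comp (fderiv ℝ F y)) y :=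
    HasFDerivAt.comp (g := B) y hB.hasFDerivAt hF.hasFDerivAt
  have h1 := (h0.clm_apply hp).clm_apply hq
  refine ⟨_, h1, fun v => ?_⟩
  simp
  ring

/-- The divergence of the tangential part of a constant field `Y` along an immersion `F`
into a space with metric `B`, in terms of the second fundamental form. -/
lemma divergence_tangential (hB : DifferentiableAt ℝ B (F y)) (hsymm : ∀ z a b, B z a b = B z b a)
    (hF : ContDiffAt ℝ 2 F y) (hG : IsInner (pullForm (B (F y)) (fderiv ℝ F y))) (Y : W)
    {V : E → E} (hV : DifferentiableAt ℝ V y)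
    (hVeq : ∀ᶠ z in 𝓝 y, ∀ w, B (F z) (fderiv ℝ F z (V z)) (fderiv ℝ F z w)
      = B (F z) Y (fderiv ℝ F z w)) :
    ∃ L : Fin m → E →L[ℝ] ℝ,
      (∀ i, HasFDerivAt (fun z => √(gram (pullForm (B (F z)) (fderiv ℝ F z))).det * V z i) (L i) y) ∧
      ∑ i, L i (EuclideanSpace.single i 1) = √(gram (pullForm (B (F y)) (fderiv ℝ F y))).det *
        (∑ i, ∑ j, (gram (pullForm (B (F y)) (fderiv ℝ F y)))⁻¹ i j *
          (gammaFirst (fderiv ℝ B (F y)) (fderiv ℝ F y (EuclideanSpace.single i 1)) Y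
            (fderiv ℝ F y (EuclideanSpace.single j 1)) +
          hessForm B F y (EuclideanSpace.single i 1) (EuclideanSpace.single j 1)
            (Y - fderiv ℝ F y (V y)))) := by
  set e : Fin m → E := fun i => EuclideanSpace.single i 1 with he
  have hF1 : DifferentiableAt ℝ F y := hF.differentiableAt (by norm_num)
  have hF' : DifferentiableAt ℝ (fderiv ℝ F) y :=
    (hF.fderiv_right (m := 1) (by norm_num)).differentiableAt (by norm_num)
  have hFe : ∀ w, HasFDerivAt (fun z => fderiv ℝ F z w)
      ((ContinuousLinearMap.apply ℝ W w).comp (fderiv ℝ (fderiv ℝ F) y)) y := fun w =>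
    (ContinuousLinearMap.apply ℝ W w).hasFDerivAt.comp y hF'.hasFDerivAt
  have hF2s : ∀ v w, fderiv ℝ (fderiv ℝ F) y v w = fderiv ℝ (fderiv ℝ F) y w v :=
    (hF.isSymmSndFDerivAt (by simp)).eq
  set dF := fderiv ℝ F y with hdF
  set ddF := fderiv ℝ (fderiv ℝ F) y with hddF
  set dB := fderiv ℝ B (F y) with hdB
  have hdBs : ∀ v a b, dB v a b = dB v b a := fun v a b => by
    have h1 : ∀ a b, HasFDerivAt (fun z => B z a b) _ (F y) := fun a b =>
      (hB.hasFDerivAt.clm_apply (hasFDerivAt_const a _)).clm_apply (hasFDerivAt_const b _)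
    have h2 := h1 a b
    simp_rw [hsymm _ a b] at h2
    simpa using DFunLike.congr_fun (h2.unique (h1 b a)) v
  -- derivatives of the coefficients of the induced metric
  have hM : ∀ i j, ∃ L : E →L[ℝ] ℝ,
      HasFDerivAt (fun z => gram (pullForm (B (F z)) (fderiv ℝ F z)) i j) L y ∧
      ∀ v, L v = dB (dF v) (dF (e i)) (dF (e j)) + B (F y) (ddF v (e i)) (dF (e j))
        + B (F y) (dF (e i)) (ddF v (e j)) := fun i j =>
    hasFDerivAt_form_apply hB hF1 (hFe (e i)) (hFe (e j))
  choose M' hM' hM'v using hM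
  have hb : ∀ j, ∃ L : E →L[ℝ] ℝ,
      HasFDerivAt (fun z => B (F z) Y (fderiv ℝ F z (e j))) L y ∧
      ∀ v, L v = dB (dF v) Y (dF (e j)) + B (F y) ((0 : E →L[ℝ] W) v) (dF (e j))
        + B (F y) Y (ddF v (e j)) := fun j =>
    hasFDerivAt_form_apply hB hF1 (hasFDerivAt_const Y y) (hFe (e j))
  choose b' hb' hb'v using hb
  set M := gram (pullForm (B (F y)) dF) with hMdef
  have hdet : 0 < M.det := hG.det_gram_pos
  have hdetD := hasFDerivAt_det (M := fun z => gram (pullForm (B (F z)) (fderiv ℝ F z)))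
    (M' := M') hM' hdet.ne'.isUnit
  have hsq := hdetD.sqrt hdet.ne'
  have hVi : ∀ i, HasFDerivAt (fun z => V z i)
      ((EuclideanSpace.proj i : E →L[ℝ] ℝ).comp (fderiv ℝ V y)) y := fun i =>
    (EuclideanSpace.proj i : E →L[ℝ] ℝ).hasFDerivAt.comp y hV.hasFDerivAt
  refine ⟨_, fun i => hsq.mul (hVi i), ?_⟩
  -- the differentiated linear system
  have hMV : ∀ j, (fun z => ∑ k, gram (pullForm (B (F z)) (fderiv ℝ F z)) j k * V z k)
      =ᶠ[𝓝 y] fun z => B (F z) Y (fderiv ℝ F z (e j)) := fun j => by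
    filter_upwards [hVeq] with z hz
    rw [← hz (e j)]
    have := clm_apply_eq_sum (((pullForm (B (F z)) (fderiv ℝ F z))) (e j)) (V z)
    rw [hsymm]
    refine Eq.trans ?_ this.symm
    exact Finset.sum_congr rfl fun k _ => mul_comm _ _
  -- The field `V` solves the linear system `M V = b`. Differentiating the system gives the
  -- derivative of `V` without differentiating an inverse matrix.
  have hlin : ∀ i j, ∑ k, M j k * (fderiv ℝ V y (e i)) k =
      b' j (e i) - ∑ k, M' j k (e i) * V y k := fun i j => by
    have h1 : HasFDerivAt (fun z => ∑ k, gram (pullForm (B (F z)) (fderiv ℝ F z)) j k * V z k)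
        (∑ k, (gram (pullForm (B (F y)) (fderiv ℝ F y)) j k •
          ((EuclideanSpace.proj k : E →L[ℝ] ℝ).comp (fderiv ℝ V y)) + V y k • M' j k)) y :=
      HasFDerivAt.fun_sum fun k _ => (hM' j k).mul (hVi k)
    have h2 := (h1.congr_of_eventuallyEq (hMV j).symm).unique (hb' j)
    rw [← h2]
    simp [Finset.sum_add_distrib, mul_comm, hMdef, hdF]
  have hsol : ∀ i, (fderiv ℝ V y (e i)) i =
      ∑ j, M⁻¹ i j * (b' j (e i) - ∑ k, M' j k (e i) * V y k) := fun i => by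
    have h1 : M.mulVec (fderiv ℝ V y (e i)).ofLp =
        fun j => b' j (e i) - ∑ k, M' j k (e i) * V y k := funext fun j => hlin i j
    have h2 : (fderiv ℝ V y (e i)).ofLp = M⁻¹.mulVec (M.mulVec (fderiv ℝ V y (e i)).ofLp) := by
      rw [Matrix.mulVec_mulVec, Matrix.nonsing_inv_mul _ hdet.ne'.isUnit, Matrix.one_mulVec]
    rw [h1] at h2
    exact congrFun h2 i
  have hMsymm : ∀ i j, M⁻¹ i j = M⁻¹ j i := fun i j => by
    have : M.transpose = M := by ext i j; exact hsymm _ _ _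
    have h2 : M⁻¹.transpose = M⁻¹ := by rw [Matrix.transpose_nonsing_inv, this]
    conv_lhs => rw [← h2]
    rfl
  have hdFV : dF (V y) = ∑ k, V y k • dF (e k) := by
    conv_lhs => rw [eq_sum_single (V y)]
    simp [map_sum, he]
  -- These are the numbers `⟨∇_i F_j, F_k⟩`. They are symmetric in `i`, `j` because the connection
  -- has no torsion and second derivatives commute.
  set a : Fin m → Fin m → Fin m → ℝ := fun i j k => hessForm B F y (e i) (e j) (dF (e k)) with ha
  have haval : ∀ i j k, a i j k = B (F y) (ddF (e i) (e j)) (dF (e k)) +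
      gammaFirst dB (dF (e i)) (dF (e j)) (dF (e k)) := fun i j k => rfl
  have hasymm : ∀ i j k, a i j k = a j i k := fun i j k => by
    rw [haval, haval, hF2s, gammaFirst, gammaFirst, hdBs (dF (e k))]; ring
  -- Metric compatibility: `∂_i⟨F_j, F_k⟩ = ⟨∇_i F_j, F_k⟩ + ⟨F_j, ∇_i F_k⟩`.
  have hM'a : ∀ i j k, M' j k (e i) = a i j k + a i k j := fun i j k => by
    rw [hM'v, haval, haval, gammaFirst, gammaFirst, hsymm _ (dF (e j)), hdBs (dF (e k)),
      hdBs (dF (e j)), hdBs (dF (e i)) (dF (e k))]; ring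
  -- Metric compatibility for `⟨Y, F_j⟩`. As `Y` is constant in coordinates, its covariant
  -- derivative is a Christoffel term alone.
  have hb'a : ∀ i j, b' j (e i) = gammaFirst dB (dF (e i)) Y (dF (e j)) +
      hessForm B F y (e i) (e j) Y := fun i j => by
    rw [hb'v]
    change _ = _ + (B (F y) (ddF (e i) (e j)) Y + gammaFirst dB (dF (e i)) (dF (e j)) Y)
    rw [gammaFirst, gammaFirst, hsymm _ Y, hdBs Y, hdBs (dF (e i)) (dF (e j)) Y]
    simp; ring
  have hess_sub : ∀ i j, hessForm B F y (e i) (e j) (Y - dF (V y)) =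
      hessForm B F y (e i) (e j) Y - ∑ k, V y k * a i j k := fun i j => by
    have hl : ∀ n, hessForm B F y (e i) (e j) n = (B (F y) (ddF (e i) (e j)) +
      (1 / 2 : ℝ) • (dB (dF (e i)) (dF (e j)) + dB (dF (e j)) (dF (e i))
        - (dB.flip (dF (e i))).flip (dF (e j)))) n := fun n => by
      change B (F y) (ddF (e i) (e j)) n + gammaFirst dB (dF (e i)) (dF (e j)) n = _
      rw [gammaFirst]; simp; ring
    rw [hdFV, hl, hl, map_sub, map_sum]
    simp_rw [map_smul, smul_eq_mul, ← hl]
    rfl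
  have hs : √M.det * √M.det = M.det := Real.mul_self_sqrt hdet.le
  have hspos : 0 < √M.det := Real.sqrt_pos.2 hdet
  have hfac : ∀ t : ℝ, 1 / (2 * √M.det) * (M.det * t) = √M.det * (t / 2) := fun t => by
    nth_rewrite 2 [← hs]; field_simp
  -- The derivative of `√det` cancels one of the two terms of `∂_i M_{jk} V^k`. The surviving term
  -- turns `Y` into its normal part `Y - F_*V` in the second fundamental form.
  have hsum1 : ∑ i, V y i * ((∑ j, ∑ k, M⁻¹ j k * M' k j (e i)) / 2) =
      ∑ i, ∑ j, M⁻¹ i j * ∑ k, V y k * a i k j := by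
    have h1 : ∀ i, (∑ j, ∑ k, M⁻¹ j k * M' k j (e i)) / 2 = ∑ j, ∑ k, M⁻¹ j k * a i j k := by
      intro i
      have : ∑ j, ∑ k, M⁻¹ j k * M' k j (e i) = ∑ j, ∑ k, M⁻¹ j k * a i k j +
          ∑ j, ∑ k, M⁻¹ j k * a i j k := by
        simp_rw [hM'a, mul_add, Finset.sum_add_distrib]
      rw [this]
      have h2 : ∑ j, ∑ k, M⁻¹ j k * a i k j = ∑ j, ∑ k, M⁻¹ j k * a i j k := by
        rw [Finset.sum_comm]
        refine Finset.sum_congr rfl fun j _ => Finset.sum_congr rfl fun k _ => ?_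
        rw [hMsymm]
      rw [h2]; ring
    simp_rw [h1, Finset.mul_sum]
    rw [Finset.sum_comm]
    refine Finset.sum_congr rfl fun j _ => ?_
    rw [Finset.sum_comm]
    refine Finset.sum_congr rfl fun k _ => Finset.sum_congr rfl fun i _ => ?_
    rw [hasymm i j k]; ring
  have hterm : ∀ i, (√M.det • (EuclideanSpace.proj i : E →L[ℝ] ℝ).comp (fderiv ℝ V y) +
      V y i • (1 / (2 * √M.det)) • (M.det • ∑ i, ∑ j, M⁻¹ i j • M' j i)) (e i) =
      √M.det * (∑ j, M⁻¹ i j * (b' j (e i) - ∑ k, M' j k (e i) * V y k) +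
        V y i * ((∑ j, ∑ k, M⁻¹ j k * M' k j (e i)) / 2)) := fun i => by
    rw [← hsol]
    have := hfac (∑ j, ∑ k, M⁻¹ j k * M' k j (e i))
    simp only [add_apply, smul_apply, smul_eq_mul, ContinuousLinearMap.comp_apply,
      PiLp.proj_apply, sum_apply]
    rw [this]; ring
  refine (Finset.sum_congr rfl fun i _ => hterm i).trans ?_
  rw [← Finset.mul_sum, Finset.sum_add_distrib, hsum1, ← Finset.sum_add_distrib]
  congr 1
  refine Finset.sum_congr rfl fun i _ => ?_
  rw [← Finset.sum_add_distrib]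
  refine Finset.sum_congr rfl fun j _ => ?_
  rw [hess_sub, hb'a, ← mul_add]
  congr 1
  have : ∑ k, M' j k (e i) * V y k = ∑ k, V y k * a i j k + ∑ k, V y k * a i k j := by
    rw [← Finset.sum_add_distrib]
    refine Finset.sum_congr rfl fun k _ => ?_
    rw [hM'a]; ring
  rw [this]; ring

end Immersion

/-! ## Invariance of the second fundamental form -/

section Invariance

variable {V V' W W' : Type*} [NormedAddCommGroup V] [NormedSpace ℝ V] [NormedAddCommGroup V']
  [NormedSpace ℝ V'] [NormedAddCommGroup W] [NormedSpace ℝ W] [NormedAddCommGroup W']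
  [NormedSpace ℝ W']

lemma fderiv_fderiv_comp {f : V → V'} {g : V' → W} {h : V → W} {x : V} (hf : ContDiffAt ℝ 2 f x)
    (hg : ContDiffAt ℝ 2 g (f x)) (hh : h =ᶠ[𝓝 x] fun z => g (f z)) (v w : V) :
    fderiv ℝ (fderiv ℝ h) x v w =
      fderiv ℝ (fderiv ℝ g) (f x) (fderiv ℝ f x v) (fderiv ℝ f x w) +
        fderiv ℝ g (f x) (fderiv ℝ (fderiv ℝ f) x v w) := by
  have h1 : fderiv ℝ h =ᶠ[𝓝 x] fun z => (fderiv ℝ g (f z)).comp (fderiv ℝ f z) := by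
    have e1 : ∀ᶠ z in 𝓝 x, ContDiffAt ℝ 2 f z := hf.eventually (by simp)
    have e2 : ∀ᶠ z in 𝓝 x, ContDiffAt ℝ 2 g (f z) :=
      hf.continuousAt.eventually (hg.eventually (by simp))
    filter_upwards [e1, e2, hh.eventuallyEq_nhds] with z h1 h2 h3
    rw [h3.fderiv_eq]
    exact fderiv_comp z (h2.differentiableAt (by norm_num)) (h1.differentiableAt (by norm_num))
  have hf' : DifferentiableAt ℝ (fderiv ℝ f) x :=
    (hf.fderiv_right (m := 1) (by norm_num)).differentiableAt (by norm_num)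
  have hg' : DifferentiableAt ℝ (fderiv ℝ g) (f x) :=
    (hg.fderiv_right (m := 1) (by norm_num)).differentiableAt (by norm_num)
  have hf1 : DifferentiableAt ℝ f x := hf.differentiableAt (by norm_num)
  have h2 : HasFDerivAt (fun z => fderiv ℝ g (f z))
      ((fderiv ℝ (fderiv ℝ g) (f x)).comp (fderiv ℝ f x)) x :=
    HasFDerivAt.comp (g := fderiv ℝ g) x hg'.hasFDerivAt hf1.hasFDerivAt
  rw [h1.fderiv_eq, (h2.clm_comp hf'.hasFDerivAt).fderiv]
  simp [add_comm]

/-- Naturality of the Levi-Civita connection: the second derivatives of `Ψ` that appear in `D²(Ψ ∘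
F)` are cancelled by those in the derivative of the pulled back metric. No condition on `n` is
needed. -/
lemma hessForm_comp_target {B : W → W →L[ℝ] W →L[ℝ] ℝ} {B' : W' → W' →L[ℝ] W' →L[ℝ] ℝ}
    {Ψ : W → W'} {F : V → W} {F' : V → W'} {x : V} (hF : ContDiffAt ℝ 2 F x)
    (hΨ : ContDiffAt ℝ 2 Ψ (F x)) (hF' : F' =ᶠ[𝓝 x] fun z => Ψ (F z))
    (hB : DifferentiableAt ℝ B (F x)) (hB' : DifferentiableAt ℝ B' (Ψ (F x)))
    (hsymm : ∀ z a b, B' z a b = B' z b a)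
    (hBB' : ∀ᶠ z in 𝓝 (F x), B z = pullForm (B' (Ψ z)) (fderiv ℝ Ψ z)) (v w : V) (n : W) :
    hessForm B' F' x v w (fderiv ℝ Ψ (F x) n) = hessForm B F x v w n := by
  have hΨ1 : DifferentiableAt ℝ Ψ (F x) := hΨ.differentiableAt (by norm_num)
  have hF1 : DifferentiableAt ℝ F x := hF.differentiableAt (by norm_num)
  have hΨ' : DifferentiableAt ℝ (fderiv ℝ Ψ) (F x) :=
    (hΨ.fderiv_right (m := 1) (by norm_num)).differentiableAt (by norm_num)
  have hΨs : ∀ v w, fderiv ℝ (fderiv ℝ Ψ) (F x) v w = fderiv ℝ (fderiv ℝ Ψ) (F x) w v :=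
    (hΨ.isSymmSndFDerivAt (by simp)).eq
  have hdB : ∀ a b c, fderiv ℝ B (F x) a b c =
      fderiv ℝ B' (Ψ (F x)) (fderiv ℝ Ψ (F x) a) (fderiv ℝ Ψ (F x) b) (fderiv ℝ Ψ (F x) c) +
      B' (Ψ (F x)) (fderiv ℝ (fderiv ℝ Ψ) (F x) a b) (fderiv ℝ Ψ (F x) c) +
      B' (Ψ (F x)) (fderiv ℝ Ψ (F x) b) (fderiv ℝ (fderiv ℝ Ψ) (F x) a c) := by
    intro a b c
    have hp : ∀ b, HasFDerivAt (fun z => fderiv ℝ Ψ z b)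
        ((ContinuousLinearMap.apply ℝ W' b).comp (fderiv ℝ (fderiv ℝ Ψ) (F x))) (F x) := fun b =>
      (ContinuousLinearMap.apply ℝ W' b).hasFDerivAt.comp _ hΨ'.hasFDerivAt
    obtain ⟨L, hL, hLv⟩ := hasFDerivAt_form_apply hB' hΨ1 (hp b) (hp c)
    have h2 := (hB.hasFDerivAt.clm_apply (hasFDerivAt_const b (F x))).clm_apply
      (hasFDerivAt_const c (F x))
    have h3 : (fun z => B z b c) =ᶠ[𝓝 (F x)]
        fun z => B' (Ψ z) (fderiv ℝ Ψ z b) (fderiv ℝ Ψ z c) := by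
      filter_upwards [hBB'] with z hz
      rw [hz]; rfl
    have := DFunLike.congr_fun (h2.unique (hL.congr_of_eventuallyEq h3)) a
    rw [hLv] at this
    simpa using this
  have hBx : B (F x) = pullForm (B' (Ψ (F x))) (fderiv ℝ Ψ (F x)) := hBB'.self_of_nhds
  have hdF' : fderiv ℝ F' x = (fderiv ℝ Ψ (F x)).comp (fderiv ℝ F x) := by
    rw [hF'.fderiv_eq]; exact fderiv_comp x hΨ1 hF1
  rw [hessForm, hessForm, fderiv_fderiv_comp hF hΨ hF', hdF', hF'.self_of_nhds, gammaFirst,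
    gammaFirst, hdB, hdB, hdB, hBx]
  set dv := fderiv ℝ F x v
  set dw := fderiv ℝ F x w
  change B' (Ψ (F x)) (_ + _) _ + (_ + _ - fderiv ℝ B' (Ψ (F x)) (fderiv ℝ Ψ (F x) n)
    (fderiv ℝ Ψ (F x) dv) (fderiv ℝ Ψ (F x) dw)) / 2 =
    B' (Ψ (F x)) (fderiv ℝ Ψ (F x) (fderiv ℝ (fderiv ℝ F) x v w)) (fderiv ℝ Ψ (F x) n) + _
  rw [map_add, hΨs n dv, hΨs n dw, hΨs dw dv,
    hsymm _ (fderiv ℝ Ψ (F x) dw) (fderiv ℝ (fderiv ℝ Ψ) (F x) dv n),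
    hsymm _ (fderiv ℝ Ψ (F x) dv) (fderiv ℝ (fderiv ℝ Ψ) (F x) dw n)]
  simp only [add_apply, ContinuousLinearMap.comp_apply]
  change _ + (fderiv ℝ B' (Ψ (F x)) (fderiv ℝ Ψ (F x) dv) (fderiv ℝ Ψ (F x) dw) _ +
    fderiv ℝ B' (Ψ (F x)) (fderiv ℝ Ψ (F x) dw) (fderiv ℝ Ψ (F x) dv) _ - _) / 2 = _
  ring

/-- Reparametrising the source adds the tangent vector `F_*(D²Φ(v, w))`, which `n` annihilates.
Hence, unlike for changes of target, normality of `n` is essential. -/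
lemma hessForm_comp_source {B : W → W →L[ℝ] W →L[ℝ] ℝ} {Φ : V → V'} {F : V' → W} {F' : V → W}
    {x : V} (hΦ : ContDiffAt ℝ 2 Φ x) (hF : ContDiffAt ℝ 2 F (Φ x))
    (hF' : F' =ᶠ[𝓝 x] fun z => F (Φ z)) (v w : V) (n : W)
    (hn : ∀ v, B (F (Φ x)) (fderiv ℝ F (Φ x) v) n = 0) :
    hessForm B F' x v w n = hessForm B F (Φ x) (fderiv ℝ Φ x v) (fderiv ℝ Φ x w) n := by
  have hdF' : fderiv ℝ F' x = (fderiv ℝ F (Φ x)).comp (fderiv ℝ Φ x) := by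
    rw [hF'.fderiv_eq]
    exact fderiv_comp x (hF.differentiableAt (by norm_num)) (hΦ.differentiableAt (by norm_num))
  rw [hessForm, hessForm, fderiv_fderiv_comp hΦ hF hF', hdF', hF'.self_of_nhds, map_add, add_apply,
    hn]
  simp

end Invariance

/-! ## Fields of bilinear forms along maps -/

section Pullback

variable {V : Type*} [NormedAddCommGroup V] [NormedSpace ℝ V]
  {W : Type*} [NormedAddCommGroup W] [NormedSpace ℝ W] {K : Type*} [TopologicalSpace K]
  {J : ModelWithCorners ℝ W K} {N : Type*} [TopologicalSpace N] [ChartedSpace K N]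

lemma contMDiffOn_mfderivWithin_const [IsManifold J ∞ N] {f : V → N} {s : Set V}
    (hf : ContMDiffOn 𝓘(ℝ, V) J ∞ f s) (hs : UniqueDiffOn ℝ s) (v : V) :
    ContMDiffOn 𝓘(ℝ, V) J.tangent ∞
      (fun y => (⟨f y, mfderivWithin 𝓘(ℝ, V) J f s y v⟩ : TangentBundle J N)) s := by
  have h1 := hf.contMDiffOn_tangentMapWithin (m := ∞) (by simp)
    (uniqueMDiffOn_iff_uniqueDiffOn.2 hs)
  have h2 : ContMDiff 𝓘(ℝ, V) 𝓘(ℝ, V).tangent ∞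
      (fun y => (⟨y, v⟩ : TangentBundle 𝓘(ℝ, V) V)) := fun y =>
    contMDiffAt_vectorSpace_iff_contDiffAt.2 contDiffAt_const
  exact h1.comp h2.contMDiffOn fun y hy => hy

/-- Smoothness of a tensor field. -/
def SmoothForm (g : BilinField J N) [IsManifold J ∞ N] : Prop :=
  ContMDiff J (J.prod 𝓘(ℝ, W →L[ℝ] W →L[ℝ] ℝ)) ∞
    (fun p => Bundle.TotalSpace.mk' (W →L[ℝ] W →L[ℝ] ℝ)
      (E := fun p : N => TangentSpace J p →L[ℝ] TangentSpace J p →L[ℝ] ℝ) p (g p))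

variable [IsManifold J ∞ N] {g : BilinField J N}

lemma SmoothForm.contMDiffOn_apply (hg : SmoothForm g) {f : V → N} {s : Set V}
    (hf : ContMDiffOn 𝓘(ℝ, V) J ∞ f s) {A B : (y : V) → TangentSpace J (f y)}
    (hA : ContMDiffOn 𝓘(ℝ, V) J.tangent ∞ (fun y => (⟨f y, A y⟩ : TangentBundle J N)) s)
    (hB : ContMDiffOn 𝓘(ℝ, V) J.tangent ∞ (fun y => (⟨f y, B y⟩ : TangentBundle J N)) s) :
    ContDiffOn ℝ ∞ (fun y => g (f y) (A y) (B y)) s := by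
  have h1 : ContMDiffOn 𝓘(ℝ, V) (J.prod 𝓘(ℝ, W →L[ℝ] W →L[ℝ] ℝ)) ∞
      (fun y => Bundle.TotalSpace.mk' (W →L[ℝ] W →L[ℝ] ℝ)
        (E := fun p : N => TangentSpace J p →L[ℝ] TangentSpace J p →L[ℝ] ℝ) (f y) (g (f y))) s :=
    ContMDiff.comp_contMDiffOn (f := f) hg hf
  have h2 := ContMDiffOn.clm_bundle_apply₂ (F₁ := W) (F₂ := W) (F₃ := ℝ)
    (E₁ := fun p : N => TangentSpace J p) (E₂ := fun p : N => TangentSpace J p)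
    (E₃ := Bundle.Trivial N ℝ) h1 hA hB
  rw [← contMDiffOn_iff_contDiffOn]
  intro y hy
  exact ((Bundle.contMDiffWithinAt_totalSpace (F := ℝ) (E := Bundle.Trivial N ℝ)).1 (h2 y hy)).2

lemma SmoothForm.contDiffOn_pullForm [FiniteDimensional ℝ V] (hg : SmoothForm g) {f : V → N}
    {s : Set V} (hf : ContMDiffOn 𝓘(ℝ, V) J ∞ f s) (hs : UniqueDiffOn ℝ s) :
    ContDiffOn ℝ ∞ (fun y => (pullForm (V := V) (W := W) (g (f y))
      (mfderivWithin 𝓘(ℝ, V) J f s y) : V →L[ℝ] V →L[ℝ] ℝ)) s := by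
  refine contDiffOn_clm_apply.2 fun v => contDiffOn_clm_apply.2 fun w => ?_
  exact hg.contMDiffOn_apply hf (contMDiffOn_mfderivWithin_const hf hs v)
    (contMDiffOn_mfderivWithin_const hf hs w)

end Pullback

/-! ## The metric in a chart of the hypersurface -/

section Chart

variable {m : ℕ} [NeZero m] {S : Type*} [TopologicalSpace S]
  [ChartedSpace (EuclideanSpace ℝ (Fin m)) S] [IsManifold (𝓡 m) ∞ S] (𝓜 : SplitSpacetime m S)
  {Sig : Type*} [TopologicalSpace Sig] [ChartedSpace (EuclideanHalfSpace m) Sig]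
  [IsManifold (𝓡∂ m) ∞ Sig] (ι : Sig → ℝ × S) (x₀ : Sig)

local notation "E" => EuclideanSpace ℝ (Fin m)

/-- The map `(t, y) ↦ (t, π(x))`, where `y` is the coordinate of `x` in the chart at `x₀`. -/
def hatPoint (z : ℝ × E) : ℝ × S := (z.1, (ι ((extChartAt (𝓡∂ m) x₀).symm z.2)).2)

/-- The derivative of `π ∘ ι` in the chart at `x₀`. -/
def hatDeriv (y : E) : E →L[ℝ] E :=
  mfderivWithin 𝓘(ℝ, E) (𝓡 m) (fun y => (ι ((extChartAt (𝓡∂ m) x₀).symm y)).2)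
    (range (𝓡∂ m)) y

/-- The spatial tensor, pulled back to the chart at `x₀`. -/
def hatσ (z : ℝ × E) : E →L[ℝ] E →L[ℝ] ℝ :=
  pullForm (V := E) (W := E) (𝓜.σ (hatPoint ι x₀ z)) (hatDeriv ι x₀ z.2)

/-- The lapse, pulled back to the chart at `x₀`. -/
def hatLapse (z : ℝ × E) : ℝ := 𝓜.lapse (hatPoint ι x₀ z)

/-- The Lorentzian metric, pulled back to the chart at `x₀`. -/
def hatMetric (z : ℝ × E) : (ℝ × E) →L[ℝ] (ℝ × E) →L[ℝ] ℝ :=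
  pullForm (V := ℝ × E) (W := ℝ × E) (𝓜.g (hatPoint ι x₀ z))
    ((ContinuousLinearMap.id ℝ ℝ).prodMap (hatDeriv ι x₀ z.2))

lemma hatMetric_apply (z a b : ℝ × E) : hatMetric 𝓜 ι x₀ z a b =
    hatLapse 𝓜 ι x₀ z ^ 2 * (-(a.1 * b.1) + hatσ 𝓜 ι x₀ z a.2 b.2) :=
  𝓜.g_eq (hatPoint ι x₀ z) (a.1, hatDeriv ι x₀ z.2 a.2) (b.1, hatDeriv ι x₀ z.2 b.2)

lemma hatLapse_pos (z : ℝ × E) : 0 < hatLapse 𝓜 ι x₀ z := 𝓜.lapse_pos _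

lemma hatσ_symm (z : ℝ × E) (a b : E) : hatσ 𝓜 ι x₀ z a b = hatσ 𝓜 ι x₀ z b a :=
  𝓜.σ_symm (hatPoint ι x₀ z) (hatDeriv ι x₀ z.2 a) (hatDeriv ι x₀ z.2 b)

lemma hatMetric_symm (z a b : ℝ × E) : hatMetric 𝓜 ι x₀ z a b = hatMetric 𝓜 ι x₀ z b a := by
  rw [hatMetric_apply, hatMetric_apply, hatσ_symm, mul_comm a.1]

variable {ι} {𝓜}

lemma smoothForm_g : SmoothForm 𝓜.g := 𝓜.contMDiff_g

lemma contMDiff_snd_comp (hι : 𝓜.IsSmoothSpacelikeHypersurface ι) :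
    ContMDiff (𝓡∂ m) (𝓡 m) ∞ (fun x => (ι x).2) := contMDiff_snd.comp hι.contMDiff

lemma contMDiff_height (hι : 𝓜.IsSmoothSpacelikeHypersurface ι) :
    ContMDiff (𝓡∂ m) 𝓘(ℝ, ℝ) ∞ (SplitSpacetime.height ι) := contMDiff_fst.comp hι.contMDiff

/-- The differential of a function on `Σ`, as a covector of the model space. -/
def differential (f : Sig → ℝ) (x : Sig) : E →L[ℝ] ℝ := mfderiv (𝓡∂ m) 𝓘(ℝ, ℝ) f x

/-- The differential of `π ∘ ι`, as a map of the model space. -/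
def projDeriv (ι : Sig → ℝ × S) (x : Sig) : E →L[ℝ] E :=
  mfderiv (𝓡∂ m) (𝓡 m) (fun x => (ι x).2) x

/-- The spatial tensor at `(t, π x)`, as a form on the tangent space of `Σ` at `x`. -/
def spatialForm (𝓜 : SplitSpacetime m S) (ι : Sig → ℝ × S) (t : ℝ) (x : Sig) : E →L[ℝ] E →L[ℝ] ℝ :=
  pullForm (V := E) (W := E) (𝓜.σ (t, (ι x).2)) (projDeriv ι x)

lemma mfderiv_immersion_apply (hι : 𝓜.IsSmoothSpacelikeHypersurface ι) (x : Sig)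
    (v : TangentSpace (𝓡∂ m) x) :
    mfderiv (𝓡∂ m) (ambientModel m) ι x v =
      (differential (SplitSpacetime.height ι) x v, projDeriv ι x v) := by
  have h := mfderiv_prodMk ((contMDiff_height hι).mdifferentiable (by simp) x)
    ((contMDiff_snd_comp hι).mdifferentiable (by simp) x)
  exact DFunLike.congr_fun h v

/-- This is the spacelike condition on `Σ`, divided by the square of the lapse. -/
lemma sq_differential_height_lt (hι : 𝓜.IsSmoothSpacelikeHypersurface ι) (x : Sig)
    {v : E} (hv : v ≠ 0) :
    (differential (SplitSpacetime.height ι) x v) ^ 2 <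
      spatialForm 𝓜 ι (SplitSpacetime.height ι x) x v v := by
  have h := hι.spacelike x v hv
  have h3 := 𝓜.g_eq (ι x) (mfderiv (𝓡∂ m) (ambientModel m) ι x v)
    (mfderiv (𝓡∂ m) (ambientModel m) ι x v)
  rw [h3] at h
  have h2 := pos_of_mul_pos_right h (sq_nonneg _)
  have h4 : dτ (mfderiv (𝓡∂ m) (ambientModel m) ι x v) =
      differential (SplitSpacetime.height ι) x v := by
    exact congrArg (Prod.fst (α := ℝ) (β := E)) (mfderiv_immersion_apply hι x v)
  have h5 : dπ (mfderiv (𝓡∂ m) (ambientModel m) ι x v) = projDeriv ι x v := by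
    exact congrArg (Prod.snd (α := ℝ) (β := E)) (mfderiv_immersion_apply hι x v)
  rw [h4, h5] at h2
  change 0 < _ + spatialForm 𝓜 ι (SplitSpacetime.height ι x) x v v at h2
  rw [sq]; linarith

/-- A tangent vector of `Σ` killed by `dπ` would be a multiple of `∂_τ`, hence not spacelike. So `π
∘ ι` has invertible differential everywhere, and a chart of `Σ` can serve as spatial coordinates for
the graphs. -/
lemma projDeriv_injective (hι : 𝓜.IsSmoothSpacelikeHypersurface ι) (x : Sig) :
    Function.Injective (projDeriv (m := m) ι x) := by
  refine (injective_iff_map_eq_zero _).2 fun v hv => ?_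
  by_contra hne
  have h := sq_differential_height_lt hι x (v := v) hne
  have : spatialForm 𝓜 ι (SplitSpacetime.height ι x) x v v = 0 := by
    have h1 : ∀ (B : E →L[ℝ] E →L[ℝ] ℝ) (w : E), w = 0 → B w w = 0 := fun B w hw => by
      rw [hw, map_zero]
    exact h1 (𝓜.σ (SplitSpacetime.height ι x, (ι x).2)) (projDeriv ι x v) hv
  rw [this] at h
  exact absurd h (not_lt.2 (sq_nonneg _))

lemma isInner_σ (𝓜 : SplitSpacetime m S) (p : ℝ × S) : IsInner (V := E) (𝓜.σ p) :=
  ⟨fun v w => 𝓜.σ_symm _ v w, fun v hv => 𝓜.σ_pos _ v hv⟩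

lemma isInner_spatialForm (hι : 𝓜.IsSmoothSpacelikeHypersurface ι) (t : ℝ) (x : Sig) :
    IsInner (spatialForm 𝓜 ι t x) :=
  isInner_pullForm (isInner_σ 𝓜 _) (projDeriv_injective hι x)

variable {x₀}

lemma uniqueDiffOn_target : UniqueDiffOn ℝ (extChartAt (𝓡∂ m) x₀).target :=
  uniqueDiffOn_extChartAt_target x₀

lemma uniqueDiffWithinAt_range {y : E} (hy : y ∈ range (𝓡∂ m)) :
    UniqueDiffWithinAt ℝ (range (𝓡∂ m)) y := (𝓡∂ m).uniqueDiffOn y hy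

lemma target_subset_range : (extChartAt (𝓡∂ m) x₀).target ⊆ range (𝓡∂ m) :=
  extChartAt_target_subset_range x₀

lemma mdiffWithinAt_symm {y : E} (hy : y ∈ (extChartAt (𝓡∂ m) x₀).target) :
    MDifferentiableWithinAt 𝓘(ℝ, E) (𝓡∂ m) (extChartAt (𝓡∂ m) x₀).symm (range (𝓡∂ m)) y := by
  haveI : IsManifold (𝓡∂ m) 1 Sig := .of_le (n := ∞) (by simp)
  exact mdifferentiableWithinAt_extChartAt_symm hy

/-- The derivative of the inverse of the chart at `x₀`. -/
def symmDeriv (x₀ : Sig) (y : E) : E →L[ℝ] E :=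
  mfderivWithin 𝓘(ℝ, E) (𝓡∂ m) (extChartAt (𝓡∂ m) x₀).symm (range (𝓡∂ m)) y

lemma symmDeriv_isInvertible {y : E} (hy : y ∈ (extChartAt (𝓡∂ m) x₀).target) :
    (symmDeriv x₀ y).IsInvertible := by
  haveI : IsManifold (𝓡∂ m) 1 Sig := .of_le (n := ∞) (by simp)
  exact isInvertible_mfderivWithin_extChartAt_symm hy

lemma hatDeriv_eq (hι : 𝓜.IsSmoothSpacelikeHypersurface ι) {y : E}
    (hy : y ∈ (extChartAt (𝓡∂ m) x₀).target) :
    hatDeriv ι x₀ y = (projDeriv ι ((extChartAt (𝓡∂ m) x₀).symm y)).comp (symmDeriv x₀ y) :=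
  mfderiv_comp_mfderivWithin (g := fun x => (ι x).2) y
    ((contMDiff_snd_comp hι).mdifferentiable (by simp) _) (mdiffWithinAt_symm hy)
    (uniqueMDiffWithinAt_iff_uniqueDiffWithinAt.2
      (uniqueDiffWithinAt_range (target_subset_range hy)))

lemma fderivWithin_comp_symm {f : Sig → ℝ} {y : E}
    (hf : MDifferentiableAt (𝓡∂ m) 𝓘(ℝ, ℝ) f ((extChartAt (𝓡∂ m) x₀).symm y))
    (hy : y ∈ (extChartAt (𝓡∂ m) x₀).target) :
    fderivWithin ℝ (fun y => f ((extChartAt (𝓡∂ m) x₀).symm y)) (range (𝓡∂ m)) y =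
      (differential f ((extChartAt (𝓡∂ m) x₀).symm y)).comp (symmDeriv x₀ y) := by
  rw [← mfderivWithin_eq_fderivWithin]
  exact mfderiv_comp_mfderivWithin (g := f) y hf (mdiffWithinAt_symm hy)
    (uniqueMDiffWithinAt_iff_uniqueDiffWithinAt.2
      (uniqueDiffWithinAt_range (target_subset_range hy)))

lemma hatDeriv_injective (hι : 𝓜.IsSmoothSpacelikeHypersurface ι) {y : E}
    (hy : y ∈ (extChartAt (𝓡∂ m) x₀).target) : Function.Injective (hatDeriv ι x₀ y) := by
  rw [hatDeriv_eq hι hy]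
  exact (projDeriv_injective hι _).comp (symmDeriv_isInvertible hy).injective

lemma isInner_hatσ (hι : 𝓜.IsSmoothSpacelikeHypersurface ι) {z : ℝ × E}
    (hz : z.2 ∈ (extChartAt (𝓡∂ m) x₀).target) : IsInner (hatσ 𝓜 ι x₀ z) :=
  isInner_pullForm (V := E) (W := E) (isInner_σ 𝓜 _) (hatDeriv_injective hι hz)

lemma coordForm_σPull (hι : 𝓜.IsSmoothSpacelikeHypersurface ι) (u : Sig → ℝ) {y : E}
    (hy : y ∈ (extChartAt (𝓡∂ m) x₀).target) :
    coordForm (𝓡∂ m) (𝓜.σPull ι u) x₀ y =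
      hatσ 𝓜 ι x₀ (u ((extChartAt (𝓡∂ m) x₀).symm y), y) := by
  ext v w
  rw [hatσ, hatDeriv_eq hι hy]
  rfl

lemma hatσ_eq_pullForm (hι : 𝓜.IsSmoothSpacelikeHypersurface ι) (t : ℝ) {y : E}
    (hy : y ∈ (extChartAt (𝓡∂ m) x₀).target) :
    hatσ 𝓜 ι x₀ (t, y) =
      pullForm (spatialForm 𝓜 ι t ((extChartAt (𝓡∂ m) x₀).symm y)) (symmDeriv x₀ y) := by
  ext v w
  rw [hatσ, hatDeriv_eq hι hy]
  rfl

lemma contMDiffOn_snd_symm (hι : 𝓜.IsSmoothSpacelikeHypersurface ι) :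
    ContMDiffOn 𝓘(ℝ, E) (𝓡 m) ∞ (fun y => (ι ((extChartAt (𝓡∂ m) x₀).symm y)).2)
      (extChartAt (𝓡∂ m) x₀).target :=
  (contMDiff_snd_comp hι).comp_contMDiffOn (contMDiffOn_extChartAt_symm x₀)

lemma contMDiffOn_hatPoint (hι : 𝓜.IsSmoothSpacelikeHypersurface ι) :
    ContMDiffOn 𝓘(ℝ, ℝ × E) (ambientModel m) ∞ (hatPoint ι x₀)
      (univ ×ˢ (extChartAt (𝓡∂ m) x₀).target) := by
  refine ContMDiffOn.prodMk (contDiff_fst.contMDiff.contMDiffOn) ?_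
  exact (contMDiffOn_snd_symm hι).comp (f := fun z : ℝ × E => z.2)
    contDiff_snd.contMDiff.contMDiffOn fun z hz => hz.2

lemma mfderivWithin_hatPoint (hι : 𝓜.IsSmoothSpacelikeHypersurface ι) {z : ℝ × E}
    (hz : z.2 ∈ (extChartAt (𝓡∂ m) x₀).target) :
    mfderivWithin 𝓘(ℝ, ℝ × E) (ambientModel m) (hatPoint ι x₀)
      (univ ×ˢ (extChartAt (𝓡∂ m) x₀).target) z =
      (ContinuousLinearMap.id ℝ ℝ).prodMap (hatDeriv ι x₀ z.2) := by
  have hu : UniqueDiffWithinAt ℝ (univ ×ˢ (extChartAt (𝓡∂ m) x₀).target : Set (ℝ × E)) z :=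
    (uniqueDiffOn_univ.prod uniqueDiffOn_target) z ⟨mem_univ _, hz⟩
  have h1 : MDifferentiableWithinAt 𝓘(ℝ, E) (𝓡 m)
      (fun y => (ι ((extChartAt (𝓡∂ m) x₀).symm y)).2) (range (𝓡∂ m)) z.2 :=
    ((contMDiff_snd_comp hι).mdifferentiable (by simp) _).comp_mdifferentiableWithinAt _
      (mdiffWithinAt_symm hz)
  have h2 : HasMFDerivWithinAt 𝓘(ℝ, ℝ × E) 𝓘(ℝ, E) (fun z : ℝ × E => z.2)
      (univ ×ˢ (extChartAt (𝓡∂ m) x₀).target) z (ContinuousLinearMap.snd ℝ ℝ E) :=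
    hasFDerivAt_snd.hasFDerivWithinAt.hasMFDerivWithinAt
  have h3 : HasMFDerivWithinAt 𝓘(ℝ, ℝ × E) 𝓘(ℝ, ℝ) (fun z : ℝ × E => z.1)
      (univ ×ˢ (extChartAt (𝓡∂ m) x₀).target) z (ContinuousLinearMap.fst ℝ ℝ E) :=
    hasFDerivAt_fst.hasFDerivWithinAt.hasMFDerivWithinAt
  have h4 := HasMFDerivWithinAt.comp z (g := fun y => (ι ((extChartAt (𝓡∂ m) x₀).symm y)).2)
    h1.hasMFDerivWithinAt h2 (fun z hz => target_subset_range hz.2)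
  have h5 := h3.prodMk h4
  refine (h5.mfderivWithin (uniqueMDiffWithinAt_iff_uniqueDiffWithinAt.2 hu)).trans ?_
  rfl

lemma contDiffOn_hatMetric (hι : 𝓜.IsSmoothSpacelikeHypersurface ι) :
    ContDiffOn ℝ ∞ (hatMetric 𝓜 ι x₀) (univ ×ˢ (extChartAt (𝓡∂ m) x₀).target) := by
  refine ((smoothForm_g (𝓜 := 𝓜)).contDiffOn_pullForm (contMDiffOn_hatPoint hι)
    (uniqueDiffOn_univ.prod uniqueDiffOn_target)).congr fun z hz => ?_
  rw [hatMetric, ← mfderivWithin_hatPoint hι hz.2]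

lemma contDiffOn_hatLapse (hι : 𝓜.IsSmoothSpacelikeHypersurface ι) :
    ContDiffOn ℝ ∞ (hatLapse 𝓜 ι x₀) (univ ×ˢ (extChartAt (𝓡∂ m) x₀).target) :=
  contMDiffOn_iff_contDiffOn.1 (𝓜.contMDiff_lapse.comp_contMDiffOn (contMDiffOn_hatPoint hι))

/-- Smoothness is postulated for the metric and the lapse only; the spatial tensor is recovered as
`g / α²` on vectors without time component. -/
lemma contDiffOn_hatσ (hι : 𝓜.IsSmoothSpacelikeHypersurface ι) :
    ContDiffOn ℝ ∞ (hatσ 𝓜 ι x₀) (univ ×ˢ (extChartAt (𝓡∂ m) x₀).target) := by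
  refine contDiffOn_clm_apply.2 fun v => contDiffOn_clm_apply.2 fun w => ?_
  have h1 : ContDiffOn ℝ ∞ (fun z => hatMetric 𝓜 ι x₀ z (0, v) (0, w) / hatLapse 𝓜 ι x₀ z ^ 2)
      (univ ×ˢ (extChartAt (𝓡∂ m) x₀).target) :=
    (((contDiffOn_hatMetric hι).clm_apply contDiffOn_const).clm_apply contDiffOn_const).div
      ((contDiffOn_hatLapse hι).pow 2) fun z _ => (pow_pos (hatLapse_pos 𝓜 ι x₀ z) 2).ne'
  refine h1.congr fun z _ => ?_
  have := (hatLapse_pos 𝓜 ι x₀ z).ne'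
  rw [hatMetric_apply]
  field_simp
  simp

end Chart

/-! ## The Riemannian volume in charts -/

section ChartVolume

variable {m : ℕ} [NeZero m] {Sig : Type*} [TopologicalSpace Sig]
  [ChartedSpace (EuclideanHalfSpace m) Sig]

local notation "E" => EuclideanSpace ℝ (Fin m)

/-- The change of coordinates from the chart at `x₀` to the chart at `x₁`. -/
def transition (x₀ x₁ : Sig) (y : E) : E :=
  extChartAt (𝓡∂ m) x₁ ((extChartAt (𝓡∂ m) x₀).symm y)

lemma transition_mem_range (x₀ x₁ : Sig) (y : E) : transition x₀ x₁ y ∈ range (𝓡∂ m) := by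
  rw [transition, extChartAt_coe]; exact mem_range_self _

lemma transition_mem_target {x₀ x₁ : Sig} {y : E}
    (h : (extChartAt (𝓡∂ m) x₀).symm y ∈ (extChartAt (𝓡∂ m) x₁).source) :
    transition x₀ x₁ y ∈ (extChartAt (𝓡∂ m) x₁).target := (extChartAt (𝓡∂ m) x₁).map_source h

lemma symm_transition {x₀ x₁ : Sig} {y : E}
    (h : (extChartAt (𝓡∂ m) x₀).symm y ∈ (extChartAt (𝓡∂ m) x₁).source) :
    (extChartAt (𝓡∂ m) x₁).symm (transition x₀ x₁ y) = (extChartAt (𝓡∂ m) x₀).symm y :=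
  (extChartAt (𝓡∂ m) x₁).left_inv h

lemma eventually_symm_mem_source {x₀ : Sig} {U : Set Sig} (hU : IsOpen U) {y : E}
    (hy : y ∈ (extChartAt (𝓡∂ m) x₀).target) (h : (extChartAt (𝓡∂ m) x₀).symm y ∈ U) :
    ∀ᶠ z in 𝓝[range (𝓡∂ m)] y, z ∈ (extChartAt (𝓡∂ m) x₀).target ∧
      (extChartAt (𝓡∂ m) x₀).symm z ∈ U := by
  have h1 := extChartAt_target_mem_nhdsWithin_of_mem (I := 𝓡∂ m) hy
  have h2 : ContinuousWithinAt (extChartAt (𝓡∂ m) x₀).symm (range (𝓡∂ m)) y :=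
    ((continuousOn_extChartAt_symm x₀) y hy).mono_of_mem_nhdsWithin h1
  filter_upwards [h1, h2 (hU.mem_nhds h)] with z hz hz' using ⟨hz, hz'⟩

variable [IsManifold (𝓡∂ m) ∞ Sig]

lemma contDiffWithinAt_transition {x₀ x₁ : Sig} {y : E} (hy : y ∈ (extChartAt (𝓡∂ m) x₀).target)
    (h : (extChartAt (𝓡∂ m) x₀).symm y ∈ (extChartAt (𝓡∂ m) x₁).source) :
    ContDiffWithinAt ℝ ∞ (transition x₀ x₁) (range (𝓡∂ m)) y := by
  rw [extChartAt_source] at h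
  exact ((contMDiffAt_extChartAt' (n := ∞) h).comp_contMDiffWithinAt y
    (contMDiffWithinAt_extChartAt_symm_range x₀ hy)).contDiffWithinAt

lemma symmDeriv_transition {x₀ x₁ : Sig} {y : E} (hy : y ∈ (extChartAt (𝓡∂ m) x₀).target)
    (h : (extChartAt (𝓡∂ m) x₀).symm y ∈ (extChartAt (𝓡∂ m) x₁).source) :
    symmDeriv x₀ y = (symmDeriv x₁ (transition x₀ x₁ y)).comp
      (fderivWithin ℝ (transition x₀ x₁) (range (𝓡∂ m)) y) := by
  have hev : (extChartAt (𝓡∂ m) x₀).symm =ᶠ[𝓝[range (𝓡∂ m)] y]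
      (extChartAt (𝓡∂ m) x₁).symm ∘ transition x₀ x₁ := by
    filter_upwards [eventually_symm_mem_source (isOpen_extChartAt_source x₁) hy h] with z hz
    exact (symm_transition hz.2).symm
  rw [symmDeriv, hev.mfderivWithin_eq (symm_transition h).symm]
  rw [← mfderivWithin_eq_fderivWithin]
  exact mfderivWithin_comp y (mdiffWithinAt_symm (transition_mem_target h))
    ((contDiffWithinAt_transition hy h).differentiableWithinAt (by simp)).mdifferentiableWithinAt
    (fun z _ => transition_mem_range _ _ _)
    (uniqueMDiffWithinAt_iff_uniqueDiffWithinAt.2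
      (uniqueDiffWithinAt_range (target_subset_range hy)))

/-- A tensor field evaluated at a point, as a form on the model space. -/
def fieldAt (B : BilinField (𝓡∂ m) Sig) (x : Sig) : E →L[ℝ] E →L[ℝ] ℝ := B x

lemma coordForm_eq (B : BilinField (𝓡∂ m) Sig) (x₀ : Sig) (y : E) :
    coordForm (𝓡∂ m) B x₀ y =
      pullForm (fieldAt B ((extChartAt (𝓡∂ m) x₀).symm y)) (symmDeriv x₀ y) := rfl

lemma coordForm_transition (B : BilinField (𝓡∂ m) Sig) {x₀ x₁ : Sig} {y : E}
    (hy : y ∈ (extChartAt (𝓡∂ m) x₀).target)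
    (h : (extChartAt (𝓡∂ m) x₀).symm y ∈ (extChartAt (𝓡∂ m) x₁).source) :
    coordForm (𝓡∂ m) B x₀ y = pullForm (coordForm (𝓡∂ m) B x₁ (transition x₀ x₁ y))
      (fderivWithin ℝ (transition x₀ x₁) (range (𝓡∂ m)) y) := by
  rw [coordForm_eq, coordForm_eq, symmDeriv_transition hy h, symm_transition h]
  rfl

lemma sqrt_det_coordForm_transition (B : BilinField (𝓡∂ m) Sig) {x₀ x₁ : Sig} {y : E}
    (hy : y ∈ (extChartAt (𝓡∂ m) x₀).target)
    (h : (extChartAt (𝓡∂ m) x₀).symm y ∈ (extChartAt (𝓡∂ m) x₁).source) :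
    √(gram (coordForm (𝓡∂ m) B x₀ y)).det =
      |(fderivWithin ℝ (transition x₀ x₁) (range (𝓡∂ m)) y).det| *
        √(gram (coordForm (𝓡∂ m) B x₁ (transition x₀ x₁ y))).det := by
  rw [coordForm_transition B hy h, det_gram_pullForm, Real.sqrt_mul (sq_nonneg _),
    Real.sqrt_sq_eq_abs]

omit [IsManifold (𝓡∂ m) ∞ Sig] in
lemma measurableSet_extChartAt_target (x₀ : Sig) :
    MeasurableSet (extChartAt (𝓡∂ m) x₀).target := by
  rw [extChartAt_target]
  exact ((chartAt _ x₀).open_target.preimage (𝓡∂ m).continuous_symm).measurableSet.inter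
    (𝓡∂ m).isClosed_range.measurableSet

variable [MeasurableSpace Sig] [BorelSpace Sig]

omit [IsManifold (𝓡∂ m) ∞ Sig] in
lemma measurableSet_symm_preimage (x₀ : Sig) {A : Set Sig} (hA : MeasurableSet A) :
    MeasurableSet ((extChartAt (𝓡∂ m) x₀).symm ⁻¹' A ∩ (extChartAt (𝓡∂ m) x₀).target) := by
  have h1 : Continuous ((extChartAt (𝓡∂ m) x₀).target.restrict (extChartAt (𝓡∂ m) x₀).symm) :=
    (continuousOn_extChartAt_symm x₀).restrict
  have h2 := (measurableSet_extChartAt_target x₀).subtype_image (h1.measurable hA)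
  convert h2 using 1
  ext y
  constructor
  · rintro ⟨h1, h2⟩
    exact ⟨⟨y, h2⟩, h1, rfl⟩
  · rintro ⟨⟨z, h2⟩, h1, rfl⟩
    exact ⟨h1, h2⟩

omit [IsManifold (𝓡∂ m) ∞ Sig] in
lemma aemeasurable_symm (x₀ : Sig) (f : E → ENNReal) : AEMeasurable (extChartAt (𝓡∂ m) x₀).symm
    ((volume.restrict (extChartAt (𝓡∂ m) x₀).target).withDensity f) :=
  (((continuousOn_extChartAt_symm x₀).aemeasurable
    (measurableSet_extChartAt_target x₀))).mono_ac (withDensity_absolutelyContinuous _ _)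

omit [IsManifold (𝓡∂ m) ∞ Sig] in
lemma chartVolume_apply (B : BilinField (𝓡∂ m) Sig) (x₀ : Sig) {A : Set Sig}
    (hA : MeasurableSet A) : chartVolume (𝓡∂ m) B x₀ A =
      ∫⁻ y in (extChartAt (𝓡∂ m) x₀).symm ⁻¹' A ∩ (extChartAt (𝓡∂ m) x₀).target,
        ENNReal.ofReal √(gram (coordForm (𝓡∂ m) B x₀ y)).det := by
  rw [chartVolume, Measure.map_apply_of_aemeasurable (aemeasurable_symm x₀ _) hA,
    withDensity_apply', Measure.restrict_restrict' (measurableSet_extChartAt_target x₀)]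

omit [IsManifold (𝓡∂ m) ∞ Sig] in
lemma measurableSet_chartSource (x₀ : Sig) : MeasurableSet (extChartAt (𝓡∂ m) x₀).source :=
  (isOpen_extChartAt_source x₀).measurableSet

omit [IsManifold (𝓡∂ m) ∞ Sig] in
lemma chartVolume_inter_source (B : BilinField (𝓡∂ m) Sig) (x₀ : Sig) {A : Set Sig}
    (hA : MeasurableSet A) : chartVolume (𝓡∂ m) B x₀ A =
      chartVolume (𝓡∂ m) B x₀ (A ∩ (extChartAt (𝓡∂ m) x₀).source) := by
  rw [chartVolume_apply B x₀ hA, chartVolume_apply B x₀ (hA.inter (measurableSet_chartSource x₀))]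
  congr 2
  ext y
  simp only [mem_inter_iff, mem_preimage]
  exact ⟨fun h => ⟨⟨h.1, (extChartAt (𝓡∂ m) x₀).map_target h.2⟩, h.2⟩, fun h => ⟨h.1.1, h.2⟩⟩

/-- The change of variables formula for the transition map. The map is differentiated within the
half space, so that points of the boundary need no separate treatment. -/
lemma chartVolume_eq_of_subset (B : BilinField (𝓡∂ m) Sig) (x₀ x₁ : Sig) {A : Set Sig}
    (hA : MeasurableSet A) (h₀ : A ⊆ (extChartAt (𝓡∂ m) x₀).source)
    (h₁ : A ⊆ (extChartAt (𝓡∂ m) x₁).source) :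
    chartVolume (𝓡∂ m) B x₀ A = chartVolume (𝓡∂ m) B x₁ A := by
  rw [chartVolume_apply B x₀ hA, chartVolume_apply B x₁ hA]
  set s₀ := (extChartAt (𝓡∂ m) x₀).symm ⁻¹' A ∩ (extChartAt (𝓡∂ m) x₀).target with hs₀
  have himg : transition x₀ x₁ '' s₀ =
      (extChartAt (𝓡∂ m) x₁).symm ⁻¹' A ∩ (extChartAt (𝓡∂ m) x₁).target := by
    ext y
    constructor
    · rintro ⟨z, hz, rfl⟩
      refine ⟨?_, transition_mem_target (h₁ hz.1)⟩
      rw [mem_preimage, symm_transition (h₁ hz.1)]; exact hz.1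
    · rintro ⟨hy, hyt⟩
      refine ⟨transition x₁ x₀ y, ⟨?_, transition_mem_target (h₀ hy)⟩, ?_⟩
      · rw [mem_preimage, symm_transition (h₀ hy)]; exact hy
      · rw [transition, symm_transition (h₀ hy)]
        exact (extChartAt (𝓡∂ m) x₁).right_inv hyt
  rw [← himg, lintegral_image_eq_lintegral_abs_det_fderiv_mul volume
    (measurableSet_symm_preimage x₀ hA)
    (f' := fun y => fderivWithin ℝ (transition x₀ x₁) (range (𝓡∂ m)) y)]
  · refine setLIntegral_congr_fun (measurableSet_symm_preimage x₀ hA) fun y hy => ?_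
    rw [← ENNReal.ofReal_mul (abs_nonneg _), ← sqrt_det_coordForm_transition B hy.2 (h₁ hy.1)]
  · intro y hy
    exact ((contDiffWithinAt_transition hy.2 (h₁ hy.1)).differentiableWithinAt
      (by simp)).hasFDerivWithinAt.mono fun z hz => target_subset_range hz.2
  · intro y hy z hz hyz
    have h1 := symm_transition (h₁ hy.1)
    rw [hyz, symm_transition (h₁ hz.1)] at h1
    rw [← (extChartAt (𝓡∂ m) x₀).right_inv hy.2, ← (extChartAt (𝓡∂ m) x₀).right_inv hz.2, h1]

variable [CompactSpace Sig]

omit [IsManifold (𝓡∂ m) ∞ Sig] [MeasurableSpace Sig] [BorelSpace Sig] in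
lemma exists_seq_chartSource_cover (x₀ : Sig) :
    ∃ f : ℕ → Sig, (⋃ k, (extChartAt (𝓡∂ m) (f k)).source) = univ := by
  obtain ⟨t, ht⟩ := isCompact_univ.elim_finite_subcover
    (fun x : Sig => (extChartAt (𝓡∂ m) x).source) (fun x => isOpen_extChartAt_source x)
    (fun x _ => mem_iUnion.2 ⟨x, mem_extChartAt_source x⟩)
  have hne : Nonempty (t : Set Sig) := by
    obtain ⟨i, hi, -⟩ := mem_iUnion₂.1 (ht (mem_univ x₀))
    exact ⟨⟨i, hi⟩⟩
  obtain ⟨f, hf⟩ := (t.finite_toSet.countable).exists_surjective (nonempty_coe_sort.1 hne)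
  refine ⟨fun k => f k, eq_univ_of_forall fun x => ?_⟩
  obtain ⟨i, hi, hx⟩ := mem_iUnion₂.1 (ht (mem_univ x))
  obtain ⟨k, hk⟩ := hf ⟨i, hi⟩
  refine mem_iUnion.2 ⟨k, ?_⟩
  simp only [hk]; exact hx

/-- On a chart domain the Riemannian volume is the chart measure. -/
lemma riemannianVolume_apply_of_subset (B : BilinField (𝓡∂ m) Sig) (x₀ : Sig) {A : Set Sig}
    (hA : MeasurableSet A) (h₀ : A ⊆ (extChartAt (𝓡∂ m) x₀).source) :
    riemannianVolume (𝓡∂ m) B A = chartVolume (𝓡∂ m) B x₀ A := by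
  obtain ⟨f, hf⟩ := exists_seq_chartSource_cover (m := m) x₀
  let D : ℕ → Set Sig := disjointed fun k => (extChartAt (𝓡∂ m) (f k)).source
  have hDm : ∀ k, MeasurableSet (D k) := fun k =>
    MeasurableSet.disjointed (fun k => measurableSet_chartSource (f k)) k
  have hDs : ∀ k, D k ⊆ (extChartAt (𝓡∂ m) (f k)).source := fun k => disjointed_subset _ k
  have hDd : Pairwise (fun i j => Disjoint (D i) (D j)) := disjoint_disjointed _
  have hDu : (⋃ k, D k) = univ := by rw [iUnion_disjointed, hf]
  -- Gluing the chart measures along a disjoint countable cover gives a measure that agrees with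
  -- each chart measure on its chart domain. It therefore dominates all of them, and with them their
  -- supremum.
  let ν : Measure Sig := Measure.sum fun k => (chartVolume (𝓡∂ m) B (f k)).restrict (D k)
  have hν : ∀ {A : Set Sig}, MeasurableSet A →
      ν A = ∑' k, chartVolume (𝓡∂ m) B (f k) (A ∩ D k) := fun {A} hA => by
    rw [Measure.sum_apply _ hA]
    exact tsum_congr fun k => Measure.restrict_apply hA
  have hsplit : ∀ (x : Sig) {A : Set Sig}, MeasurableSet A →
      A ⊆ (extChartAt (𝓡∂ m) x).source → ν A = chartVolume (𝓡∂ m) B x A := by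
    intro x A hA hx
    rw [hν hA]
    have : ∀ k, chartVolume (𝓡∂ m) B (f k) (A ∩ D k) = chartVolume (𝓡∂ m) B x (A ∩ D k) :=
      fun k => chartVolume_eq_of_subset B _ _ (hA.inter (hDm k))
        (inter_subset_right.trans (hDs k)) (inter_subset_left.trans hx)
    simp_rw [this]
    rw [← measure_iUnion (fun i j hij => (hDd hij).mono inter_subset_right inter_subset_right)
      (fun k => hA.inter (hDm k)), ← inter_iUnion, hDu, inter_univ]
  refine le_antisymm ?_ (Measure.le_iff'.1 (le_iSup (fun x => chartVolume (𝓡∂ m) B x) x₀) A)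
  rw [← hsplit x₀ hA h₀]
  refine Measure.le_iff'.1 (iSup_le fun x => Measure.le_iff.2 fun A hA => ?_) A
  rw [chartVolume_inter_source B x hA, ← hsplit x (hA.inter (measurableSet_chartSource x))
    inter_subset_right]
  exact measure_mono inter_subset_left

lemma riemannianVolume_restrict_source (B : BilinField (𝓡∂ m) Sig) (x₀ : Sig) :
    (riemannianVolume (𝓡∂ m) B).restrict (extChartAt (𝓡∂ m) x₀).source =
      chartVolume (𝓡∂ m) B x₀ := by
  ext A hA
  rw [Measure.restrict_apply hA, riemannianVolume_apply_of_subset B x₀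
    (hA.inter (measurableSet_chartSource x₀)) inter_subset_right, ← chartVolume_inter_source B x₀ hA]

/-- The integral of a function that vanishes outside a chart domain, in the chart. -/
lemma integral_riemannianVolume_eq (B : BilinField (𝓡∂ m) Sig) (x₀ : Sig)
    (hB : ContinuousOn (fun y => coordForm (𝓡∂ m) B x₀ y) (extChartAt (𝓡∂ m) x₀).target)
    {f : Sig → ℝ} (hf : Continuous f) (hs : ∀ x ∉ (extChartAt (𝓡∂ m) x₀).source, f x = 0) :
    ∫ x, f x ∂(riemannianVolume (𝓡∂ m) B) = ∫ y in (extChartAt (𝓡∂ m) x₀).target,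
      √(gram (coordForm (𝓡∂ m) B x₀ y)).det * f ((extChartAt (𝓡∂ m) x₀).symm y) := by
  rw [← setIntegral_eq_integral_of_forall_compl_eq_zero (s := (extChartAt (𝓡∂ m) x₀).source) hs,
    riemannianVolume_restrict_source, chartVolume, integral_map (aemeasurable_symm x₀ _)
      hf.aestronglyMeasurable]
  have hd : ContinuousOn (fun y => √(gram (coordForm (𝓡∂ m) B x₀ y)).det)
      (extChartAt (𝓡∂ m) x₀).target := by
    refine Real.continuous_sqrt.comp_continuousOn ?_
    refine Continuous.comp_continuousOn (g := fun M : Matrix (Fin m) (Fin m) ℝ => M.det)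
      continuous_id.matrix_det ?_
    refine continuousOn_pi.2 fun i => continuousOn_pi.2 fun j => ?_
    exact (hB.clm_apply continuousOn_const).clm_apply continuousOn_const
  have := integral_withDensity_eq_integral_toReal_smul₀
    (μ := volume.restrict (extChartAt (𝓡∂ m) x₀).target)
    (f := fun y => ENNReal.ofReal √(gram (coordForm (𝓡∂ m) B x₀ y)).det)
    ((hd.aemeasurable (measurableSet_extChartAt_target x₀)).ennreal_ofReal)
    (Eventually.of_forall fun y => ENNReal.ofReal_lt_top)
    (fun y => f ((extChartAt (𝓡∂ m) x₀).symm y))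
  rw [this]
  refine integral_congr_ae (Eventually.of_forall fun y => ?_)
  simp [ENNReal.toReal_ofReal (Real.sqrt_nonneg _)]

end ChartVolume

/-! ## The unit normal and the tilt function -/

section Normal

variable {m : ℕ} [NeZero m] {S : Type*} [TopologicalSpace S]
  [ChartedSpace (EuclideanSpace ℝ (Fin m)) S] [IsManifold (𝓡 m) ∞ S] (𝓜 : SplitSpacetime m S)
  {Sig : Type*} [TopologicalSpace Sig] [ChartedSpace (EuclideanHalfSpace m) Sig]
  [IsManifold (𝓡∂ m) ∞ Sig] (ι : Sig → ℝ × S)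

local notation "E" => EuclideanSpace ℝ (Fin m)

/-- The Lorentzian metric at a point, as a form on the model space. -/
def metricAt (p : ℝ × S) : (ℝ × E) →L[ℝ] (ℝ × E) →L[ℝ] ℝ := 𝓜.g p

/-- The spatial tensor at a point, as a form on the model space. -/
def spatialAt (p : ℝ × S) : E →L[ℝ] E →L[ℝ] ℝ := 𝓜.σ p

lemma metricAt_apply (p : ℝ × S) (v w : ℝ × E) : metricAt 𝓜 p v w =
    𝓜.lapse p ^ 2 * (-(v.1 * w.1) + spatialAt 𝓜 p v.2 w.2) := 𝓜.g_eq p v w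

/-- The gradient of `u` for the metric `σ_u`. -/
def spatialGrad (u : Sig → ℝ) (x : Sig) : E := sharp (spatialForm 𝓜 ι (u x) x) (differential u x)

/-- The square `|du|²` of the norm of the differential for the metric `σ_u`. -/
def slopeSq (u : Sig → ℝ) (x : Sig) : ℝ := differential u x (spatialGrad 𝓜 ι u x)

/-- The explicit tilt `(1 - |du|²)^{-1/2}`. -/
def gammaFactor (u : Sig → ℝ) (x : Sig) : ℝ := (√(1 - slopeSq 𝓜 ι u x))⁻¹

/-- The explicit future unit normal. -/
def unitNormal (u : Sig → ℝ) (x : Sig) : ℝ × E :=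
  (gammaFactor 𝓜 ι u x / 𝓜.lapse (u x, (ι x).2)) •
    ((1, projDeriv ι x (spatialGrad 𝓜 ι u x)) : ℝ × E)

variable {𝓜} {ι}

lemma slopeSq_nonneg (hι : 𝓜.IsSmoothSpacelikeHypersurface ι) (u : Sig → ℝ) (x : Sig) :
    0 ≤ slopeSq 𝓜 ι u x := (isInner_spatialForm hι (u x) x).sharp_nonneg _

lemma slopeSq_lt_one (hι : 𝓜.IsSmoothSpacelikeHypersurface ι) {u : Sig → ℝ} {x : Sig}
    (h : 𝓜.gradNorm ι u x < 1) : slopeSq 𝓜 ι u x < 1 :=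
  (isInner_spatialForm hι (u x) x).sharp_lt_one h

lemma one_le_gammaFactor (hι : 𝓜.IsSmoothSpacelikeHypersurface ι) {u : Sig → ℝ} {x : Sig}
    (h : slopeSq 𝓜 ι u x < 1) : 1 ≤ gammaFactor 𝓜 ι u x := by
  rw [gammaFactor]
  refine (one_le_inv₀ (Real.sqrt_pos.2 (by linarith))).2 ?_
  rw [Real.sqrt_le_one]
  have := slopeSq_nonneg hι u x
  linarith

lemma gammaFactor_sq {u : Sig → ℝ} {x : Sig} (h : slopeSq 𝓜 ι u x < 1) :
    gammaFactor 𝓜 ι u x ^ 2 * (1 - slopeSq 𝓜 ι u x) = 1 := by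
  rw [gammaFactor, inv_pow, Real.sq_sqrt (by linarith)]
  exact inv_mul_cancel₀ (by linarith)

lemma mfderiv_graphMap_apply (hι : 𝓜.IsSmoothSpacelikeHypersurface ι) {u : Sig → ℝ}
    (hu : ContMDiff (𝓡∂ m) 𝓘(ℝ, ℝ) ∞ u) (x : Sig) (v : E) :
    (mfderiv (𝓡∂ m) (ambientModel m) (SplitSpacetime.graphMap ι u) x : E →L[ℝ] ℝ × E) v =
      (differential u x v, projDeriv ι x v) := by
  have h := mfderiv_prodMk (hu.mdifferentiable (by simp) x)
    ((contMDiff_snd_comp hι).mdifferentiable (by simp) x)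
  exact DFunLike.congr_fun h v

lemma projDeriv_surjective (hι : 𝓜.IsSmoothSpacelikeHypersurface ι) (x : Sig) :
    Function.Surjective (projDeriv (m := m) ι x) := by
  have h : Function.Injective (projDeriv (m := m) ι x).toLinearMap := projDeriv_injective hι x
  exact LinearMap.injective_iff_surjective.1 h

/-- Orthogonality to the graph forces the spatial part to be `N.1` times the projected gradient, the
normalisation fixes `|N.1|`, and the time orientation fixes the sign. So the chosen normal is the
explicit one. -/
lemma isFutureUnitNormal_iff (hι : 𝓜.IsSmoothSpacelikeHypersurface ι) {u : Sig → ℝ}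
    (hu : ContMDiff (𝓡∂ m) 𝓘(ℝ, ℝ) ∞ u) {x : Sig} (h : slopeSq 𝓜 ι u x < 1) (N : ℝ × E) :
    𝓜.IsFutureUnitNormal ι u x N ↔ N = unitNormal 𝓜 ι u x := by
  set p := SplitSpacetime.graphMap ι u x with hp
  set α := 𝓜.lapse p with hα
  have hαpos : 0 < α := 𝓜.lapse_pos p
  set W := gammaFactor 𝓜 ι u x with hW
  have hW1 : 1 ≤ W := one_le_gammaFactor hι h
  have hW2 := gammaFactor_sq h
  rw [← hW] at hW2
  have hB := isInner_spatialForm hι (u x) x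
  set q := slopeSq 𝓜 ι u x with hq
  set G := spatialGrad 𝓜 ι u x with hG
  have hGv : ∀ v, spatialAt 𝓜 p (projDeriv ι x G) (projDeriv ι x v) = differential u x v :=
    fun v => DFunLike.congr_fun (hB.apply_sharp (differential u x)) v
  have hGG : spatialAt 𝓜 p (projDeriv ι x G) (projDeriv ι x G) = q := hGv G
  have hiff : 𝓜.IsFutureUnitNormal ι u x N ↔
      (∀ v : E, metricAt 𝓜 p N (differential u x v, projDeriv ι x v) = 0) ∧
      metricAt 𝓜 p N N = -1 ∧ metricAt 𝓜 p (α⁻¹, 0) N < 0 := by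
    refine and_congr (forall_congr' fun v => ?_) Iff.rfl
    rw [← mfderiv_graphMap_apply hι hu x v]; rfl
  rw [hiff]
  simp_rw [metricAt_apply, ← hα]
  constructor
  · rintro ⟨h1, h2, h3⟩
    have hN1 : 0 < N.1 := by
      have h4 : spatialAt 𝓜 p (0 : E) N.2 = 0 := by simp
      simp only [h4, add_zero] at h3
      by_contra hcon
      push Not at hcon
      have : 0 ≤ α ^ 2 * -(α⁻¹ * N.1) := by
        have : 0 ≤ α⁻¹ * -N.1 := mul_nonneg (inv_pos.2 hαpos).le (by linarith)
        have := mul_nonneg (sq_nonneg α) this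
        linarith
      linarith
    obtain ⟨c, hc⟩ := projDeriv_surjective hι x N.2
    have hcG : c = N.1 • G := by
      refine hB.injective ?_
      ext v
      have h5 := h1 v
      have h6 : -(N.1 * differential u x v) + spatialAt 𝓜 p N.2 (projDeriv ι x v) = 0 :=
        (mul_eq_zero.1 h5).resolve_left (pow_pos hαpos 2).ne'
      rw [← hc] at h6
      rw [map_smul, hG, spatialGrad, hB.apply_sharp]
      change spatialAt 𝓜 p (projDeriv ι x c) (projDeriv ι x v) = N.1 * differential u x v
      linarith
    have hN2 : N.2 = N.1 • projDeriv ι x G := by rw [← hc, hcG, map_smul]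
    have h7 : α ^ 2 * N.1 ^ 2 * (1 - q) = 1 := by
      rw [hN2] at h2
      simp only [map_smul, smul_apply, smul_eq_mul, hGG] at h2
      nlinarith
    have h8 : N.1 = W / α := by
      have h9 : (α * N.1) ^ 2 = W ^ 2 := by
        have h10 : (1 - q) ≠ 0 := by linarith
        have : ((α * N.1) ^ 2 - W ^ 2) * (1 - q) = 0 := by linarith
        have := (mul_eq_zero.1 this).resolve_right h10
        linarith
      have := (pow_left_inj₀ (by positivity) (by linarith) two_ne_zero).1 h9
      field_simp; linarith
    rw [unitNormal, ← hG]
    change N = (W / α) • ((1, projDeriv ι x G) : ℝ × E)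
    ext1
    · simp [h8]
    · rw [hN2, h8]; rfl
  · rintro rfl
    have e1 : (unitNormal 𝓜 ι u x).1 = W / α := by simp [unitNormal, hα, hp, hW]; rfl
    have e2 : (unitNormal 𝓜 ι u x).2 = (W / α) • projDeriv ι x G := rfl
    rw [e1, e2]
    refine ⟨fun v => ?_, ?_, ?_⟩
    · rw [map_smul, smul_apply, hGv]; simp
    · simp only [map_smul, smul_apply, smul_eq_mul, hGG]
      field_simp
      linarith
    · rw [map_zero]
      have : 0 < α ^ 2 * (α⁻¹ * (W / α)) := by positivity
      simp; linarith

lemma normal_eq (hι : 𝓜.IsSmoothSpacelikeHypersurface ι) {u : Sig → ℝ}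
    (hu : ContMDiff (𝓡∂ m) 𝓘(ℝ, ℝ) ∞ u) {x : Sig} (h : slopeSq 𝓜 ι u x < 1) :
    𝓜.normal ι u x = unitNormal 𝓜 ι u x := by
  have hex : ∃ N, 𝓜.IsFutureUnitNormal ι u x N :=
    ⟨_, (isFutureUnitNormal_iff hι hu h (unitNormal 𝓜 ι u x)).2 rfl⟩
  rw [SplitSpacetime.normal, dif_pos hex]
  exact (isFutureUnitNormal_iff hι hu h _).1 hex.choose_spec

lemma tilt_eq (hι : 𝓜.IsSmoothSpacelikeHypersurface ι) {u : Sig → ℝ}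
    (hu : ContMDiff (𝓡∂ m) 𝓘(ℝ, ℝ) ∞ u) {x : Sig} (h : slopeSq 𝓜 ι u x < 1) :
    𝓜.tilt ι u x = gammaFactor 𝓜 ι u x := by
  rw [SplitSpacetime.tilt, normal_eq hι hu h]
  have h1 := metricAt_apply 𝓜 (SplitSpacetime.graphMap ι u x)
    ((𝓜.lapse (SplitSpacetime.graphMap ι u x))⁻¹, 0) (unitNormal 𝓜 ι u x)
  have hpos := 𝓜.lapse_pos (SplitSpacetime.graphMap ι u x)
  have e1 : (unitNormal 𝓜 ι u x).1 =
      gammaFactor 𝓜 ι u x / 𝓜.lapse (SplitSpacetime.graphMap ι u x) := by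
    simp [unitNormal]; rfl
  refine (congrArg Neg.neg h1).trans ?_
  rw [e1, map_zero]
  field_simp
  simp

end Normal

/-! ## The mean curvature in a fixed chart -/

section MeanCurvature

variable {m : ℕ} [NeZero m] {S : Type*} [TopologicalSpace S]
  [ChartedSpace (EuclideanSpace ℝ (Fin m)) S] [IsManifold (𝓡 m) ∞ S] (𝓜 : SplitSpacetime m S)
  {Sig : Type*} [TopologicalSpace Sig] [ChartedSpace (EuclideanHalfSpace m) Sig]
  [IsManifold (𝓡∂ m) ∞ Sig] (ι : Sig → ℝ × S)

local notation "E" => EuclideanSpace ℝ (Fin m)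

omit [NeZero m] in
lemma IsInner.apply_sharp_pullForm {B : E →L[ℝ] E →L[ℝ] ℝ} (hB : IsInner B) {A : E →L[ℝ] E}
    (hA : A.IsInvertible) (ℓ : E →L[ℝ] ℝ) : A (sharp (pullForm B A) (ℓ.comp A)) = sharp B ℓ := by
  obtain ⟨e, rfl⟩ := hA
  have h1 : e.symm (sharp B ℓ) = sharp (pullForm B (e : E →L[ℝ] E)) (ℓ.comp (e : E →L[ℝ] E)) := by
    refine (isInner_pullForm hB e.injective).eq_sharp ?_
    ext v
    change B (e (e.symm (sharp B ℓ))) (e v) = ℓ (e v)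
    rw [e.apply_symm_apply, hB.apply_sharp]
  rw [← h1]
  exact e.apply_symm_apply _

/-- The Lorentzian metric in the preferred chart of `ℝ × S` at `p`. -/
def ambientForm (p : ℝ × S) : ℝ × E → (ℝ × E) →L[ℝ] (ℝ × E) →L[ℝ] ℝ :=
  coordForm (ambientModel m) 𝓜.g p

/-- The derivative of the inverse of the preferred chart of `ℝ × S` at `p`. -/
def ambientSymmDeriv (p : ℝ × S) (z : ℝ × E) : (ℝ × E) →L[ℝ] (ℝ × E) :=
  mfderiv 𝓘(ℝ, ℝ × E) (ambientModel m) (extChartAt (ambientModel m) p).symm z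

lemma ambientForm_eq (p : ℝ × S) (z : ℝ × E) : ambientForm 𝓜 p z =
    pullForm (metricAt 𝓜 ((extChartAt (ambientModel m) p).symm z)) (ambientSymmDeriv p z) := by
  have h : range (ambientModel m) = univ := ModelWithCorners.range_eq_univ _
  unfold ambientForm coordForm ambientSymmDeriv
  rw [h, mfderivWithin_univ]
  rfl

lemma ambientForm_symm (p : ℝ × S) (z a b : ℝ × E) :
    ambientForm 𝓜 p z a b = ambientForm 𝓜 p z b a := by
  have h : ∀ q v w, metricAt 𝓜 q v w = metricAt 𝓜 q w v := fun q v w => by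
    have h1 : spatialAt 𝓜 q v.2 w.2 = spatialAt 𝓜 q w.2 v.2 := 𝓜.σ_symm q v.2 w.2
    rw [metricAt_apply, metricAt_apply, mul_comm v.1, h1]
  rw [ambientForm_eq]
  exact h _ _ _

lemma differentiableAt_ambientForm (p : ℝ × S) {z : ℝ × E}
    (hz : z ∈ (extChartAt (ambientModel m) p).target) :
    DifferentiableAt ℝ (ambientForm 𝓜 p) z := by
  have ho : IsOpen (extChartAt (ambientModel m) p).target := isOpen_extChartAt_target p
  have h1 := (smoothForm_g (𝓜 := 𝓜)).contDiffOn_pullForm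
    (contMDiffOn_extChartAt_symm (I := ambientModel m) (n := ∞) p) ho.uniqueDiffOn
  have h2 : ContDiffOn ℝ ∞ (ambientForm 𝓜 p) (extChartAt (ambientModel m) p).target := by
    refine h1.congr fun z hz => ?_
    rw [ambientForm_eq, mfderivWithin_of_mem_nhds (ho.mem_nhds hz)]
    rfl
  exact (h2.contDiffAt (ho.mem_nhds hz)).differentiableAt (by simp)

lemma christoffelFirst_eq (p : ℝ × S) (z a b c : ℝ × E) :
    christoffelFirst (ambientModel m) 𝓜.g p z a b c =
      gammaFirst (fderiv ℝ (ambientForm 𝓜 p) z) a b c := by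
  have h : range (ambientModel m) = univ := ModelWithCorners.range_eq_univ _
  unfold christoffelFirst
  rw [h, fderivWithin_univ]
  rfl

/-- Tangent vectors at `p` are coordinate vectors in the preferred chart at `p`. Hence the abstract
normal can enter the coordinate formula of `secondFundamentalForm` unchanged. -/
lemma ambientSymmDeriv_self (p : ℝ × S) :
    ambientSymmDeriv p (extChartAt (ambientModel m) p p) = ContinuousLinearMap.id ℝ (ℝ × E) := by
  haveI : IsManifold (ambientModel m) 1 (ℝ × S) := .of_le (n := ∞) (by simp)
  have h : range (ambientModel m) = univ := ModelWithCorners.range_eq_univ _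
  have h2 := mfderivWithin_range_extChartAt_symm (I := ambientModel m) (x := p)
  rw [h, mfderivWithin_univ] at h2
  exact h2

lemma symmDeriv_self (x : Sig) :
    symmDeriv x (extChartAt (𝓡∂ m) x x) = ContinuousLinearMap.id ℝ E := by
  haveI : IsManifold (𝓡∂ m) 1 Sig := .of_le (n := ∞) (by simp)
  exact mfderivWithin_range_extChartAt_symm (I := 𝓡∂ m) (x := x)

variable (x₀ : Sig)

/-- The map `hatPoint`, read in the chart of `ℝ × S` at `p`. -/
def ambientHat (p : ℝ × S) (z : ℝ × E) : ℝ × E :=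
  extChartAt (ambientModel m) p (hatPoint ι x₀ z)

variable {𝓜} {ι} {x₀}

lemma target_mem_nhds {y : E} (hy : y ∈ (extChartAt (𝓡∂ m) x₀).target)
    (hi : y ∈ interior (range (𝓡∂ m))) : (extChartAt (𝓡∂ m) x₀).target ∈ 𝓝 y := by
  have h1 := extChartAt_target_mem_nhdsWithin_of_mem (I := 𝓡∂ m) hy
  rwa [nhdsWithin_eq_nhds.2 (mem_interior_iff_mem_nhds.1 hi)] at h1

lemma prod_target_mem_nhds {z : ℝ × E} (hy : z.2 ∈ (extChartAt (𝓡∂ m) x₀).target)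
    (hi : z.2 ∈ interior (range (𝓡∂ m))) :
    (univ ×ˢ (extChartAt (𝓡∂ m) x₀).target : Set (ℝ × E)) ∈ 𝓝 z :=
  prod_mem_nhds univ_mem (target_mem_nhds hy hi)

lemma contMDiffAt_hatPoint (hι : 𝓜.IsSmoothSpacelikeHypersurface ι) {z : ℝ × E}
    (hy : z.2 ∈ (extChartAt (𝓡∂ m) x₀).target) (hi : z.2 ∈ interior (range (𝓡∂ m))) :
    ContMDiffAt 𝓘(ℝ, ℝ × E) (ambientModel m) ∞ (hatPoint ι x₀) z :=
  (contMDiffOn_hatPoint hι).contMDiffAt (prod_target_mem_nhds hy hi)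

lemma contDiffAt_ambientHat (hι : 𝓜.IsSmoothSpacelikeHypersurface ι) {p : ℝ × S} {z : ℝ × E}
    (hy : z.2 ∈ (extChartAt (𝓡∂ m) x₀).target) (hi : z.2 ∈ interior (range (𝓡∂ m)))
    (hp : hatPoint ι x₀ z ∈ (extChartAt (ambientModel m) p).source) :
    ContDiffAt ℝ ∞ (ambientHat ι x₀ p) z := by
  rw [extChartAt_source] at hp
  exact ((contMDiffAt_extChartAt' (n := ∞) hp).comp z (contMDiffAt_hatPoint hι hy hi)).contDiffAt

lemma prodMap_hatDeriv_eq (hι : 𝓜.IsSmoothSpacelikeHypersurface ι) {p : ℝ × S} {z : ℝ × E}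
    (hy : z.2 ∈ (extChartAt (𝓡∂ m) x₀).target) (hi : z.2 ∈ interior (range (𝓡∂ m)))
    (hp : hatPoint ι x₀ z ∈ (extChartAt (ambientModel m) p).source) :
    (ContinuousLinearMap.id ℝ ℝ).prodMap (hatDeriv ι x₀ z.2) =
      (ambientSymmDeriv p (ambientHat ι x₀ p z)).comp (fderiv ℝ (ambientHat ι x₀ p) z) := by
  haveI : IsManifold (ambientModel m) 1 (ℝ × S) := .of_le (n := ∞) (by simp)
  have h1 := mfderivWithin_hatPoint hι hy
  rw [mfderivWithin_of_mem_nhds (prod_target_mem_nhds hy hi)] at h1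
  have hev : hatPoint ι x₀ =ᶠ[𝓝 z]
      (extChartAt (ambientModel m) p).symm ∘ ambientHat ι x₀ p := by
    filter_upwards [(contMDiffAt_hatPoint hι hy hi).continuousAt.preimage_mem_nhds
      ((isOpen_extChartAt_source p).mem_nhds hp)] with w hw
    exact ((extChartAt (ambientModel m) p).left_inv hw).symm
  rw [← h1, hev.mfderiv_eq, ← mfderiv_eq_fderiv]
  refine mfderiv_comp z ?_ ((contDiffAt_ambientHat hι hy hi hp).differentiableAt
    (by simp)).mdifferentiableAt
  have ho : IsOpen (extChartAt (ambientModel m) p).target := isOpen_extChartAt_target p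
  exact ((contMDiffOn_extChartAt_symm (I := ambientModel m) (n := ∞) p).contMDiffAt
    (ho.mem_nhds ((extChartAt (ambientModel m) p).map_source hp))).mdifferentiableAt (by simp)

/-- This exhibits the chart metric and the ambient coordinate metric as related by `ambientHat`,
which is what `hessForm_comp_target` requires. -/
lemma hatMetric_eq_pullForm (hι : 𝓜.IsSmoothSpacelikeHypersurface ι) {p : ℝ × S} {z : ℝ × E}
    (hy : z.2 ∈ (extChartAt (𝓡∂ m) x₀).target) (hi : z.2 ∈ interior (range (𝓡∂ m)))
    (hp : hatPoint ι x₀ z ∈ (extChartAt (ambientModel m) p).source) :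
    hatMetric 𝓜 ι x₀ z = pullForm (ambientForm 𝓜 p (ambientHat ι x₀ p z))
      (fderiv ℝ (ambientHat ι x₀ p) z) := by
  have h : (extChartAt (ambientModel m) p).symm (ambientHat ι x₀ p z) = hatPoint ι x₀ z :=
    (extChartAt (ambientModel m) p).left_inv hp
  rw [ambientForm_eq, h, hatMetric, prodMap_hatDeriv_eq hι hy hi hp]
  rfl

variable (𝓜) (ι) (x₀)

/-- A function on `Σ` in the chart at `x₀`. -/
def hatFun (u : Sig → ℝ) (y : E) : ℝ := u ((extChartAt (𝓡∂ m) x₀).symm y)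

/-- The differential of a function on `Σ` in the chart at `x₀`. -/
def hatDiff (u : Sig → ℝ) (y : E) : E →L[ℝ] ℝ := fderivWithin ℝ (hatFun x₀ u) (range (𝓡∂ m)) y

/-- The graph of a function in the chart at `x₀`. -/
def hatGraph (u : Sig → ℝ) (y : E) : ℝ × E := (hatFun x₀ u y, y)

/-- The gradient of `u` in the chart at `x₀`. -/
def hatGrad (u : Sig → ℝ) (y : E) : E :=
  sharp (hatσ 𝓜 ι x₀ (hatGraph x₀ u y)) (hatDiff x₀ u y)

/-- The unit normal in the chart at `x₀`. -/
def hatNormal (u : Sig → ℝ) (y : E) : ℝ × E :=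
  (gammaFactor 𝓜 ι u ((extChartAt (𝓡∂ m) x₀).symm y) / hatLapse 𝓜 ι x₀ (hatGraph x₀ u y)) •
    ((1, hatGrad 𝓜 ι x₀ u y) : ℝ × E)

variable {𝓜} {ι} {x₀} {u : Sig → ℝ}

lemma hatDiff_eq (hu : ContMDiff (𝓡∂ m) 𝓘(ℝ, ℝ) 1 u) {y : E}
    (hy : y ∈ (extChartAt (𝓡∂ m) x₀).target) : hatDiff x₀ u y =
      (differential u ((extChartAt (𝓡∂ m) x₀).symm y)).comp (symmDeriv x₀ y) :=
  fderivWithin_comp_symm (hu.mdifferentiable (by simp) _) hy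

lemma symmDeriv_hatGrad (hι : 𝓜.IsSmoothSpacelikeHypersurface ι)
    (hu : ContMDiff (𝓡∂ m) 𝓘(ℝ, ℝ) 1 u) {y : E} (hy : y ∈ (extChartAt (𝓡∂ m) x₀).target) :
    symmDeriv x₀ y (hatGrad 𝓜 ι x₀ u y) =
      spatialGrad 𝓜 ι u ((extChartAt (𝓡∂ m) x₀).symm y) := by
  rw [hatGrad, hatGraph, hatσ_eq_pullForm hι _ hy, hatDiff_eq hu hy]
  exact (isInner_spatialForm hι _ _).apply_sharp_pullForm (symmDeriv_isInvertible hy) _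

lemma hatDiff_hatGrad (hι : 𝓜.IsSmoothSpacelikeHypersurface ι)
    (hu : ContMDiff (𝓡∂ m) 𝓘(ℝ, ℝ) 1 u) {f : Sig → ℝ} (hf : ContMDiff (𝓡∂ m) 𝓘(ℝ, ℝ) 1 f)
    {y : E} (hy : y ∈ (extChartAt (𝓡∂ m) x₀).target) :
    hatDiff x₀ f y (hatGrad 𝓜 ι x₀ u y) =
      differential f ((extChartAt (𝓡∂ m) x₀).symm y)
        (spatialGrad 𝓜 ι u ((extChartAt (𝓡∂ m) x₀).symm y)) := by
  rw [hatDiff_eq hf hy, ← symmDeriv_hatGrad hι hu hy]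
  rfl

lemma contDiffOn_hatFun {n : WithTop ℕ∞} (hn : n ≤ ∞)
    (hu : ContMDiff (𝓡∂ m) 𝓘(ℝ, ℝ) n u) :
    ContDiffOn ℝ n (hatFun x₀ u) (extChartAt (𝓡∂ m) x₀).target :=
  contMDiffOn_iff_contDiffOn.1 (hu.comp_contMDiffOn
    ((contMDiffOn_extChartAt_symm x₀).of_le hn))

lemma contDiffOn_hatGraph (hu : ContMDiff (𝓡∂ m) 𝓘(ℝ, ℝ) ∞ u) :
    ContDiffOn ℝ ∞ (hatGraph x₀ u) (extChartAt (𝓡∂ m) x₀).target :=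
  (contDiffOn_hatFun le_rfl hu).prodMk contDiffOn_id

lemma fderiv_hatGraph (hu : ContMDiff (𝓡∂ m) 𝓘(ℝ, ℝ) ∞ u) {y : E}
    (hy : y ∈ (extChartAt (𝓡∂ m) x₀).target) (hi : y ∈ interior (range (𝓡∂ m))) :
    fderiv ℝ (hatGraph x₀ u) y = (hatDiff x₀ u y).prod (ContinuousLinearMap.id ℝ E) := by
  have h1 : DifferentiableAt ℝ (hatFun x₀ u) y :=
    ((contDiffOn_hatFun le_rfl hu).contDiffAt (target_mem_nhds hy hi)).differentiableAt (by simp)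
  rw [hatDiff, fderivWithin_of_mem_nhds (mem_interior_iff_mem_nhds.1 hi)]
  exact (h1.hasFDerivAt.prodMk (hasFDerivAt_id y)).fderiv

lemma hatMetric_hatNormal (hι : 𝓜.IsSmoothSpacelikeHypersurface ι) {y : E}
    (hy : y ∈ (extChartAt (𝓡∂ m) x₀).target) (v : E) :
    hatMetric 𝓜 ι x₀ (hatGraph x₀ u y) (hatDiff x₀ u y v, v) (hatNormal 𝓜 ι x₀ u y) = 0 := by
  have h : hatσ 𝓜 ι x₀ (hatGraph x₀ u y) v (hatGrad 𝓜 ι x₀ u y) = hatDiff x₀ u y v := by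
    rw [hatσ_symm, hatGrad, (isInner_hatσ hι hy).apply_sharp]
  rw [hatNormal, map_smul, hatMetric_apply, h]
  simp

end MeanCurvature

/-! ### Comparison of the mean curvature with its expression in one fixed chart. -/

section MeanCurvatureChart

variable {m : ℕ} [NeZero m] {S : Type*} [TopologicalSpace S]
  [ChartedSpace (EuclideanSpace ℝ (Fin m)) S] [IsManifold (𝓡 m) ∞ S] {𝓜 : SplitSpacetime m S}
  {Sig : Type*} [TopologicalSpace Sig] [ChartedSpace (EuclideanHalfSpace m) Sig]
  [IsManifold (𝓡∂ m) ∞ Sig] {ι : Sig → ℝ × S} {x₀ : Sig} {u : Sig → ℝ}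

local notation "E" => EuclideanSpace ℝ (Fin m)

/-- Interior points may be detected in any chart, not just in the preferred chart at the point. This
links the half space in a fixed chart to the interior and boundary of `Σ`. -/
lemma mem_interior_range_iff {y : E} (hy : y ∈ (extChartAt (𝓡∂ m) x₀).target) :
    y ∈ interior (range (𝓡∂ m)) ↔ (extChartAt (𝓡∂ m) x₀).symm y ∈ (𝓡∂ m).interior Sig := by
  haveI : IsManifold (𝓡∂ m) 1 Sig := .of_le (n := ∞) (by simp)
  have hs := (extChartAt (𝓡∂ m) x₀).map_target hy
  have hr := (extChartAt (𝓡∂ m) x₀).right_inv hy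
  rw [extChartAt_source] at hs
  have h1 := ModelWithCorners.isInteriorPoint_iff_of_mem_atlas (I := 𝓡∂ m) (n := 1) one_ne_zero
    (chart_mem_atlas (EuclideanHalfSpace m) x₀) hs
  change _ ↔ (extChartAt (𝓡∂ m) x₀) ((extChartAt (𝓡∂ m) x₀).symm y) ∈
    interior (extChartAt (𝓡∂ m) x₀).target at h1
  rw [hr] at h1
  refine Iff.trans ?_ h1.symm
  exact ⟨fun h => mem_interior_iff_mem_nhds.2 (target_mem_nhds hy h),
    fun h => interior_mono target_subset_range h⟩

lemma extChartAt_mem_interior_range {x : Sig} (hx : x ∈ (𝓡∂ m).interior Sig) :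
    extChartAt (𝓡∂ m) x x ∈ interior (range (𝓡∂ m)) := hx

/-- The form `(v, w) ↦ hessForm B F y v w n`. -/
def hessClm {W V : Type*} [NormedAddCommGroup W] [NormedSpace ℝ W] [NormedAddCommGroup V]
    [NormedSpace ℝ V] (B : W → W →L[ℝ] W →L[ℝ] ℝ) (F : V → W) (y : V) (n : W) : V →L[ℝ] V →L[ℝ] ℝ :=
  ((ContinuousLinearMap.compL ℝ V W ℝ ((B (F y)).flip n)).comp (fderiv ℝ (fderiv ℝ F) y)) +
    (1 / 2 : ℝ) • (pullForm ((ContinuousLinearMap.compL ℝ W (W →L[ℝ] ℝ) ℝ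
        (ContinuousLinearMap.apply ℝ ℝ n)).comp (fderiv ℝ B (F y))) (fderiv ℝ F y) +
      (pullForm ((ContinuousLinearMap.compL ℝ W (W →L[ℝ] ℝ) ℝ
        (ContinuousLinearMap.apply ℝ ℝ n)).comp (fderiv ℝ B (F y))) (fderiv ℝ F y)).flip -
      pullForm (fderiv ℝ B (F y) n) (fderiv ℝ F y))

lemma hessClm_apply {W V : Type*} [NormedAddCommGroup W] [NormedSpace ℝ W] [NormedAddCommGroup V]
    [NormedSpace ℝ V] (B : W → W →L[ℝ] W →L[ℝ] ℝ) (F : V → W) (y v w : V) (n : W) :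
    hessClm B F y n v w = hessForm B F y v w n := by
  rw [hessClm, hessForm, gammaFirst]
  simp [pullForm]
  ring

lemma fderiv_ambientHat_hatNormal (hι : 𝓜.IsSmoothSpacelikeHypersurface ι)
    (hu : ContMDiff (𝓡∂ m) 𝓘(ℝ, ℝ) ∞ u) {y : E} (hy : y ∈ (extChartAt (𝓡∂ m) x₀).target)
    (hi : y ∈ interior (range (𝓡∂ m))) :
    fderiv ℝ (ambientHat ι x₀
        (SplitSpacetime.graphMap ι u ((extChartAt (𝓡∂ m) x₀).symm y))) (hatGraph x₀ u y)
      (hatNormal 𝓜 ι x₀ u y) = unitNormal 𝓜 ι u ((extChartAt (𝓡∂ m) x₀).symm y) := by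
  set x := (extChartAt (𝓡∂ m) x₀).symm y with hx
  set p := SplitSpacetime.graphMap ι u x with hp
  have hq : hatPoint ι x₀ (hatGraph x₀ u y) = p := rfl
  have h1 := prodMap_hatDeriv_eq hι (p := p) (z := hatGraph x₀ u y) hy hi
    (by rw [hq]; exact mem_extChartAt_source p)
  have h2 : ambientHat ι x₀ p (hatGraph x₀ u y) = extChartAt (ambientModel m) p p := rfl
  rw [h2, ambientSymmDeriv_self, ContinuousLinearMap.id_comp] at h1
  rw [← h1, hatNormal, map_smul, unitNormal]
  congr 1
  change ((1 : ℝ), hatDeriv ι x₀ y (hatGrad 𝓜 ι x₀ u y)) = _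
  rw [hatDeriv_eq hι hy, ContinuousLinearMap.comp_apply, symmDeriv_hatGrad hι (hu.of_le (by simp)) hy]

/-- Near `x`, the coordinate expression of the graph map in the charts centred at `x` and `F_u(x)`
is `Ψ ∘ hatGraph ∘ Φ`, with `Φ` the transition to the chart at `x₀` and `Ψ` the change of ambient
coordinates. Remove `Ψ` by `hessForm_comp_target` and `Φ` by `hessForm_comp_source`. -/
lemma secondFundamentalForm_eq (hι : 𝓜.IsSmoothSpacelikeHypersurface ι)
    (hu : ContMDiff (𝓡∂ m) 𝓘(ℝ, ℝ) ∞ u) {y : E} (hy : y ∈ (extChartAt (𝓡∂ m) x₀).target)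
    (hi : y ∈ interior (range (𝓡∂ m)))
    (hq : slopeSq 𝓜 ι u ((extChartAt (𝓡∂ m) x₀).symm y) < 1) (v w : E) :
    𝓜.secondFundamentalForm ι u ((extChartAt (𝓡∂ m) x₀).symm y) v w =
      -hessForm (hatMetric 𝓜 ι x₀) (hatGraph x₀ u) y
        (fderiv ℝ (transition ((extChartAt (𝓡∂ m) x₀).symm y) x₀)
          (extChartAt (𝓡∂ m) ((extChartAt (𝓡∂ m) x₀).symm y) ((extChartAt (𝓡∂ m) x₀).symm y)) v)
        (fderiv ℝ (transition ((extChartAt (𝓡∂ m) x₀).symm y) x₀)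
          (extChartAt (𝓡∂ m) ((extChartAt (𝓡∂ m) x₀).symm y) ((extChartAt (𝓡∂ m) x₀).symm y)) w)
        (hatNormal 𝓜 ι x₀ u y) := by
  set x := (extChartAt (𝓡∂ m) x₀).symm y with hx
  set p := SplitSpacetime.graphMap ι u x with hp
  set z := extChartAt (𝓡∂ m) x x with hz
  set Φ := transition (m := m) x x₀ with hΦdef
  set Ψ := ambientHat (m := m) ι x₀ p with hΨdef
  set F : E → ℝ × E := writtenInExtChartAt (𝓡∂ m) (ambientModel m) x (SplitSpacetime.graphMap ι u)
    with hF
  have hxs : x ∈ (extChartAt (𝓡∂ m) x₀).source := (extChartAt (𝓡∂ m) x₀).map_target hy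
  have hzi : z ∈ interior (range (𝓡∂ m)) :=
    extChartAt_mem_interior_range (m := m) ((mem_interior_range_iff hy).1 hi)
  have hzt : z ∈ (extChartAt (𝓡∂ m) x).target := mem_extChartAt_target (I := 𝓡∂ m) x
  have hzx : (extChartAt (𝓡∂ m) x).symm z = x := extChartAt_to_inv (I := 𝓡∂ m) x
  have hΦz : Φ z = y := by
    rw [hΦdef, transition, hzx, hx]; exact (extChartAt (𝓡∂ m) x₀).right_inv hy
  have hΦ : ContDiffAt ℝ 2 Φ z :=
    ((contDiffWithinAt_transition hzt (by rw [hzx]; exact hxs)).contDiffAt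
      (mem_interior_iff_mem_nhds.1 hzi)).of_le (by norm_cast)
  have hG : ContDiffAt ℝ 2 (hatGraph x₀ u) y :=
    ((contDiffOn_hatGraph hu).contDiffAt (target_mem_nhds hy hi)).of_le (by norm_cast)
  have hpq : hatPoint ι x₀ (hatGraph x₀ u y) = p := rfl
  have hps : p ∈ (extChartAt (ambientModel m) p).source := mem_extChartAt_source p
  have hΨ : ContDiffAt ℝ 2 Ψ (hatGraph x₀ u y) :=
    (contDiffAt_ambientHat hι (z := hatGraph x₀ u y) hy hi (by rw [hpq]; exact hps)).of_le
      (by norm_cast)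
  have hΨp : Ψ (hatGraph x₀ u y) = extChartAt (ambientModel m) p p := rfl
  have hFev : F =ᶠ[𝓝 z] fun z => Ψ ((fun z => hatGraph x₀ u (Φ z)) z) := by
    have h1 := eventually_symm_mem_source (isOpen_extChartAt_source (I := 𝓡∂ m) x₀) hzt
      (by rw [hzx]; exact hxs)
    rw [nhdsWithin_eq_nhds.2 (mem_interior_iff_mem_nhds.1 hzi)] at h1
    filter_upwards [h1] with z' hz'
    have h2 : (extChartAt (𝓡∂ m) x₀).symm (Φ z') = (extChartAt (𝓡∂ m) x).symm z' :=
      symm_transition hz'.2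
    change extChartAt (ambientModel m) p
        (SplitSpacetime.graphMap ι u ((extChartAt (𝓡∂ m) x).symm z')) =
      extChartAt (ambientModel m) p
        (SplitSpacetime.graphMap ι u ((extChartAt (𝓡∂ m) x₀).symm (Φ z')))
    rw [h2]
  have hB : DifferentiableAt ℝ (hatMetric 𝓜 ι x₀) (hatGraph x₀ u y) :=
    ((contDiffOn_hatMetric hι).contDiffAt (prod_target_mem_nhds hy hi)).differentiableAt (by simp)
  have hB' : DifferentiableAt ℝ (ambientForm 𝓜 p) (extChartAt (ambientModel m) p p) :=
    differentiableAt_ambientForm 𝓜 p (mem_extChartAt_target p)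
  have hBB' : ∀ᶠ w in 𝓝 (hatGraph x₀ u y),
      hatMetric 𝓜 ι x₀ w = pullForm (ambientForm 𝓜 p (Ψ w)) (fderiv ℝ Ψ w) := by
    have e1 : ∀ᶠ w in 𝓝 (hatGraph x₀ u y), w.2 ∈ (extChartAt (𝓡∂ m) x₀).target ∩
        interior (range (𝓡∂ m)) :=
      continuous_snd.continuousAt.preimage_mem_nhds
        (inter_mem (target_mem_nhds hy hi) (isOpen_interior.mem_nhds hi))
    have e2 : ∀ᶠ w in 𝓝 (hatGraph x₀ u y),
        hatPoint ι x₀ w ∈ (extChartAt (ambientModel m) p).source :=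
      (contMDiffAt_hatPoint hι (z := hatGraph x₀ u y) hy hi).continuousAt.preimage_mem_nhds
        ((isOpen_extChartAt_source p).mem_nhds hps)
    filter_upwards [e1, e2] with w h1 h2
    exact hatMetric_eq_pullForm hι h1.1 h1.2 h2
  have hG' : ContDiffAt ℝ 2 (fun z => hatGraph x₀ u (Φ z)) z :=
    ContDiffAt.comp z (g := hatGraph x₀ u) (by rw [hΦz]; exact hG) hΦ
  have hGz : hatGraph x₀ u (Φ z) = hatGraph x₀ u y := by rw [hΦz]
  have key1 := hessForm_comp_target (B := hatMetric 𝓜 ι x₀) (B' := ambientForm 𝓜 p) (Ψ := Ψ)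
    (F := fun z => hatGraph x₀ u (Φ z)) (F' := F) (x := z) hG'
    (by rw [hGz]; exact hΨ) hFev (by rw [hGz]; exact hB)
    (by rw [hGz, hΨp]; exact hB') (ambientForm_symm 𝓜 p) (by rw [hGz]; exact hBB')
    v w (hatNormal 𝓜 ι x₀ u y)
  have key2 := hessForm_comp_source (B := hatMetric 𝓜 ι x₀) (Φ := Φ) (F := hatGraph x₀ u)
    (F' := fun z => hatGraph x₀ u (Φ z)) (x := z) hΦ (by rw [hΦz]; exact hG)
    (Eventually.of_forall fun _ => rfl) v w (hatNormal 𝓜 ι x₀ u y) (by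
      intro v
      rw [hΦz, fderiv_hatGraph hu hy hi]
      exact hatMetric_hatNormal hι hy v)
  rw [hΦz] at key2
  rw [← key2, ← key1, hGz, fderiv_ambientHat_hatNormal hι hu hy hi]
  have hdF : fderivWithin ℝ F (range (𝓡∂ m)) =ᶠ[𝓝 z] fderiv ℝ F := by
    filter_upwards [isOpen_interior.mem_nhds hzi] with z' hz'
    exact fderivWithin_of_mem_nhds (mem_interior_iff_mem_nhds.1 hz')
  have hddF : fderivWithin ℝ (fderivWithin ℝ F (range (𝓡∂ m))) (range (𝓡∂ m)) z =
      fderiv ℝ (fderiv ℝ F) z := by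
    rw [fderivWithin_of_mem_nhds (mem_interior_iff_mem_nhds.1 hzi), hdF.fderiv_eq]
  have hFz : F z = extChartAt (ambientModel m) p p := by
    rw [hFev.self_of_nhds]; change Ψ (hatGraph x₀ u (Φ z)) = _; rw [hGz, hΨp]
  rw [hessForm, hFz, ← hddF, ← hdF.self_of_nhds, ← christoffelFirst_eq]
  rw [neg_add, ← sub_eq_add_neg]
  have hN : (𝓜.normal ι u x : ℝ × E) = unitNormal 𝓜 ι u x := normal_eq hι hu hq
  rw [← hN]
  rfl

/-- The metric and the second fundamental form at `x` are both pulled back by the same Jacobian `J`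
of the transition map, which drops out of the trace. The definition uses different charts at
different points; only the right side can be integrated by parts in one chart. -/
lemma meanCurvature_eq (hι : 𝓜.IsSmoothSpacelikeHypersurface ι)
    (hu : ContMDiff (𝓡∂ m) 𝓘(ℝ, ℝ) ∞ u) {y : E} (hy : y ∈ (extChartAt (𝓡∂ m) x₀).target)
    (hi : y ∈ interior (range (𝓡∂ m)))
    (hq : slopeSq 𝓜 ι u ((extChartAt (𝓡∂ m) x₀).symm y) < 1) :
    𝓜.meanCurvature ι u ((extChartAt (𝓡∂ m) x₀).symm y) =
      -∑ i, ∑ j, (gram (pullForm (hatMetric 𝓜 ι x₀ (hatGraph x₀ u y))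
          (fderiv ℝ (hatGraph x₀ u) y)))⁻¹ i j *
        hessForm (hatMetric 𝓜 ι x₀) (hatGraph x₀ u) y (EuclideanSpace.single i 1)
          (EuclideanSpace.single j 1) (hatNormal 𝓜 ι x₀ u y) := by
  set x := (extChartAt (𝓡∂ m) x₀).symm y with hx
  set J := fderiv ℝ (transition x x₀) (extChartAt (𝓡∂ m) x x) with hJdef
  set G := pullForm (hatMetric 𝓜 ι x₀ (hatGraph x₀ u y)) (fderiv ℝ (hatGraph x₀ u) y) with hG
  have hxs : x ∈ (extChartAt (𝓡∂ m) x₀).source := (extChartAt (𝓡∂ m) x₀).map_target hy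
  have hzi : extChartAt (𝓡∂ m) x x ∈ interior (range (𝓡∂ m)) :=
    extChartAt_mem_interior_range (m := m) ((mem_interior_range_iff hy).1 hi)
  have hzx : (extChartAt (𝓡∂ m) x).symm (extChartAt (𝓡∂ m) x x) = x := extChartAt_to_inv (I := 𝓡∂ m) x
  have hΦz : transition x x₀ (extChartAt (𝓡∂ m) x x) = y := by
    rw [transition, hzx, hx]; exact (extChartAt (𝓡∂ m) x₀).right_inv hy
  have hJ : (symmDeriv x₀ y).comp J = ContinuousLinearMap.id ℝ E := by
    have := symmDeriv_transition (x₁ := x₀) (mem_extChartAt_target (I := 𝓡∂ m) x)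
      (by rw [hzx]; exact hxs)
    rwa [symmDeriv_self, hΦz, fderivWithin_of_mem_nhds (mem_interior_iff_mem_nhds.1 hzi),
      eq_comm] at this
  have hJv : ∀ v, symmDeriv x₀ y (J v) = v := fun v => DFunLike.congr_fun hJ v
  have hJdet : J.det ≠ 0 := fun h0 => by
    have h1 : LinearMap.det (symmDeriv x₀ y : E →ₗ[ℝ] E) * J.det = 1 := by
      have h2 : (symmDeriv x₀ y : E →ₗ[ℝ] E) ∘ₗ (J : E →ₗ[ℝ] E) = LinearMap.id :=
        LinearMap.ext hJv
      change _ * LinearMap.det (J : E →ₗ[ℝ] E) = 1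
      rw [← LinearMap.det_comp, h2, LinearMap.det_id]
    rw [h0, mul_zero] at h1
    exact zero_ne_one h1
  have hgram : gram (𝓜.gPull ι u x) = gram (pullForm G J) := by
    have key : ∀ v w : E, metricAt 𝓜 (SplitSpacetime.graphMap ι u x)
        ((mfderiv (𝓡∂ m) (ambientModel m) (SplitSpacetime.graphMap ι u) x : E →L[ℝ] ℝ × E) v)
        ((mfderiv (𝓡∂ m) (ambientModel m) (SplitSpacetime.graphMap ι u) x : E →L[ℝ] ℝ × E) w) =
        pullForm G J v w := fun v w => by
      rw [mfderiv_graphMap_apply hι hu, mfderiv_graphMap_apply hι hu, metricAt_apply, hG,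
        fderiv_hatGraph hu hy hi]
      change _ = hatMetric 𝓜 ι x₀ (hatGraph x₀ u y) (hatDiff x₀ u y (J v), J v)
        (hatDiff x₀ u y (J w), J w)
      have hd : ∀ v, hatDiff x₀ u y (J v) = differential u x v := fun v => by
        rw [hatDiff_eq (hu.of_le (by simp)) hy, ContinuousLinearMap.comp_apply, hJv]
      have hs : hatσ 𝓜 ι x₀ (hatGraph x₀ u y) (J v) (J w) = spatialForm 𝓜 ι (u x) x v w := by
        rw [hatGraph, hatσ_eq_pullForm hι _ hy]
        change spatialForm 𝓜 ι (u x) x (symmDeriv x₀ y (J v)) (symmDeriv x₀ y (J w)) = _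
        rw [hJv, hJv]
      rw [hatMetric_apply, hd, hd, hs]
      rfl
    ext i j
    exact key _ _
  have hII : (Matrix.of fun i j : Fin m => 𝓜.secondFundamentalForm ι u x
      (EuclideanSpace.single i 1) (EuclideanSpace.single j 1)) =
      gram (pullForm (-hessClm (hatMetric 𝓜 ι x₀) (hatGraph x₀ u) y (hatNormal 𝓜 ι x₀ u y)) J) := by
    ext i j
    rw [Matrix.of_apply, secondFundamentalForm_eq hι hu hy hi hq, ← hessClm_apply]
    rfl
  have hGs : ∀ i j, (gram G)⁻¹ i j = (gram G)⁻¹ j i := fun i j => by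
    have : (gram G).transpose = gram G := by ext i j; exact hatMetric_symm _ _ _ _ _ _
    have h2 : (gram G)⁻¹.transpose = (gram G)⁻¹ := by rw [Matrix.transpose_nonsing_inv, this]
    conv_lhs => rw [← h2]
    rfl
  rw [SplitSpacetime.meanCurvature, hgram, hII, trace_inv_gram_pullForm _ _ _ hJdet, Matrix.trace,
    Finset.sum_comm, ← Finset.sum_neg_distrib]
  refine Finset.sum_congr rfl fun i _ => ?_
  rw [Matrix.diag_apply, Matrix.mul_apply, ← Finset.sum_neg_distrib]
  refine Finset.sum_congr rfl fun j _ => ?_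
  rw [gram_apply, ← hessClm_apply, hGs]
  simp

end MeanCurvatureChart

/-! ## The divergence of the tangential part of `∂_τ` in a chart -/

section ChartFlux

variable {m : ℕ} [NeZero m] {S : Type*} [TopologicalSpace S]
  [ChartedSpace (EuclideanSpace ℝ (Fin m)) S] [IsManifold (𝓡 m) ∞ S] (𝓜 : SplitSpacetime m S)
  {Sig : Type*} [TopologicalSpace Sig] [ChartedSpace (EuclideanHalfSpace m) Sig]
  [IsManifold (𝓡∂ m) ∞ Sig] (ι : Sig → ℝ × S) (x₀ : Sig) (u : Sig → ℝ)

local notation "E" => EuclideanSpace ℝ (Fin m)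

omit [NeZero m] in
lemma ContDiffWithinAt.sharp {V : Type*} [NormedAddCommGroup V] [NormedSpace ℝ V]
    {n : WithTop ℕ∞} {B : V → E →L[ℝ] E →L[ℝ] ℝ} {ℓ : V → E →L[ℝ] ℝ} {s : Set V} {y : V}
    (hB : ContDiffWithinAt ℝ n B s y) (hℓ : ContDiffWithinAt ℝ n ℓ s y) (hi : IsInner (B y)) :
    ContDiffWithinAt ℝ n (fun z => sharp (B z) (ℓ z)) s y :=
  ((ContinuousLinearMap.IsInvertible.contDiffAt_map_inverse
    hi.isInvertible).comp_contDiffWithinAt y hB).clm_apply hℓ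

omit [NeZero m] in
lemma contDiffOn_det_gram {V : Type*} [NormedAddCommGroup V] [NormedSpace ℝ V] {n : WithTop ℕ∞}
    {B : V → E →L[ℝ] E →L[ℝ] ℝ} {s : Set V} (hB : ContDiffOn ℝ n B s) :
    ContDiffOn ℝ n (fun z => (gram (B z)).det) s := by
  simp_rw [Matrix.det_apply]
  refine ContDiffOn.sum fun σ _ => ?_
  refine ContDiffOn.const_smul (Equiv.Perm.sign σ : ℤˣ) ?_
  refine contDiffOn_prod fun i _ => ?_
  exact (hB.clm_apply contDiffOn_const).clm_apply contDiffOn_const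

/-- The induced metric of the graph of `u` in the chart at `x₀`. -/
def hatInduced (y : E) : E →L[ℝ] E →L[ℝ] ℝ :=
  hatLapse 𝓜 ι x₀ (hatGraph x₀ u y) ^ 2 •
    (hatσ 𝓜 ι x₀ (hatGraph x₀ u y) - tensorForm (hatDiff x₀ u y) (hatDiff x₀ u y))

/-- The tangential part of `∂_τ` along the graph of `u` in the chart at `x₀`. -/
def hatFlux (y : E) : E :=
  -(1 - hatDiff x₀ u y (hatGrad 𝓜 ι x₀ u y))⁻¹ • hatGrad 𝓜 ι x₀ u y

/-- The term `½ tr_{g_u} (∂_τ g)` in the chart at `x₀`. -/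
def hatDrift (y : E) : ℝ :=
  ∑ i, ∑ j, (gram (hatInduced 𝓜 ι x₀ u y))⁻¹ i j *
    gammaFirst (fderiv ℝ (hatMetric 𝓜 ι x₀) (hatGraph x₀ u y))
      (hatDiff x₀ u y (EuclideanSpace.single i 1), EuclideanSpace.single i 1) (1, 0)
      (hatDiff x₀ u y (EuclideanSpace.single j 1), EuclideanSpace.single j 1)

variable {𝓜} {ι} {x₀} {u}

lemma hatDiff_hatGrad_self (hι : 𝓜.IsSmoothSpacelikeHypersurface ι)
    (hu : ContMDiff (𝓡∂ m) 𝓘(ℝ, ℝ) ∞ u) {y : E} (hy : y ∈ (extChartAt (𝓡∂ m) x₀).target) :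
    hatDiff x₀ u y (hatGrad 𝓜 ι x₀ u y) = slopeSq 𝓜 ι u ((extChartAt (𝓡∂ m) x₀).symm y) :=
  hatDiff_hatGrad hι (hu.of_le (by simp)) (hu.of_le (by simp)) hy

lemma sq_hatDiff_le (hι : 𝓜.IsSmoothSpacelikeHypersurface ι)
    (hu : ContMDiff (𝓡∂ m) 𝓘(ℝ, ℝ) ∞ u) {y : E} (hy : y ∈ (extChartAt (𝓡∂ m) x₀).target) (v : E) :
    (hatDiff x₀ u y v) ^ 2 ≤ slopeSq 𝓜 ι u ((extChartAt (𝓡∂ m) x₀).symm y) *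
      hatσ 𝓜 ι x₀ (hatGraph x₀ u y) v v := by
  rw [← hatDiff_hatGrad_self hι hu hy]
  exact (isInner_hatσ hι (z := hatGraph x₀ u y) hy).sq_le _ v

lemma hatInduced_apply (y v w : E) : hatInduced 𝓜 ι x₀ u y v w =
    hatLapse 𝓜 ι x₀ (hatGraph x₀ u y) ^ 2 * (hatσ 𝓜 ι x₀ (hatGraph x₀ u y) v w -
      hatDiff x₀ u y v * hatDiff x₀ u y w) := by
  simp [hatInduced]

lemma isInner_hatInduced (hι : 𝓜.IsSmoothSpacelikeHypersurface ι)
    (hu : ContMDiff (𝓡∂ m) 𝓘(ℝ, ℝ) ∞ u) {y : E} (hy : y ∈ (extChartAt (𝓡∂ m) x₀).target)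
    (hq : slopeSq 𝓜 ι u ((extChartAt (𝓡∂ m) x₀).symm y) < 1) :
    IsInner (hatInduced 𝓜 ι x₀ u y) where
  symm v w := by rw [hatInduced_apply, hatInduced_apply, hatσ_symm, mul_comm (hatDiff x₀ u y v)]
  pos v hv := by
    rw [hatInduced_apply]
    have h1 := (isInner_hatσ (𝓜 := 𝓜) hι (z := hatGraph x₀ u y) hy).pos v hv
    have h2 := sq_hatDiff_le hι hu hy v
    have h3 := hatLapse_pos 𝓜 ι x₀ (hatGraph x₀ u y)
    refine mul_pos (pow_pos h3 2) ?_
    nlinarith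

lemma pullForm_fderiv_hatGraph (hu : ContMDiff (𝓡∂ m) 𝓘(ℝ, ℝ) ∞ u) {y : E}
    (hy : y ∈ (extChartAt (𝓡∂ m) x₀).target) (hi : y ∈ interior (range (𝓡∂ m))) :
    pullForm (hatMetric 𝓜 ι x₀ (hatGraph x₀ u y)) (fderiv ℝ (hatGraph x₀ u) y) =
      hatInduced 𝓜 ι x₀ u y := by
  ext v w
  rw [fderiv_hatGraph hu hy hi, hatInduced_apply]
  change hatMetric 𝓜 ι x₀ (hatGraph x₀ u y) (hatDiff x₀ u y v, v) (hatDiff x₀ u y w, w) = _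
  rw [hatMetric_apply]
  ring

lemma mapsTo_hatGraph : MapsTo (hatGraph x₀ u) (extChartAt (𝓡∂ m) x₀).target
    (univ ×ˢ (extChartAt (𝓡∂ m) x₀).target) := fun _ hy => ⟨mem_univ _, hy⟩

lemma contDiffOn_hatDiff {n k : WithTop ℕ∞} (hk : k ≤ ∞) (hn : n + 1 ≤ k)
    (hu : ContMDiff (𝓡∂ m) 𝓘(ℝ, ℝ) k u) :
    ContDiffOn ℝ n (hatDiff x₀ u) (extChartAt (𝓡∂ m) x₀).target := by
  have h1 := contDiffOn_hatFun (x₀ := x₀) hk hu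
  have hk1 : 1 ≤ k := le_trans (by simp) hn
  refine (h1.fderivWithin uniqueDiffOn_target hn).congr fun y hy => ?_
  exact fderivWithin_of_mem_nhdsWithin (extChartAt_target_mem_nhdsWithin_of_mem (I := 𝓡∂ m) hy)
    (uniqueDiffWithinAt_range (target_subset_range hy))
    ((h1.differentiableOn (by intro h; simp [h] at hk1)) y hy)

lemma contDiffOn_hatσ_graph (hι : 𝓜.IsSmoothSpacelikeHypersurface ι)
    (hu : ContMDiff (𝓡∂ m) 𝓘(ℝ, ℝ) ∞ u) :
    ContDiffOn ℝ ∞ (fun y => hatσ 𝓜 ι x₀ (hatGraph x₀ u y)) (extChartAt (𝓡∂ m) x₀).target :=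
  (contDiffOn_hatσ hι).comp (contDiffOn_hatGraph hu) mapsTo_hatGraph

lemma contDiffOn_hatGrad (hι : 𝓜.IsSmoothSpacelikeHypersurface ι)
    (hu : ContMDiff (𝓡∂ m) 𝓘(ℝ, ℝ) ∞ u) :
    ContDiffOn ℝ ∞ (hatGrad 𝓜 ι x₀ u) (extChartAt (𝓡∂ m) x₀).target := fun y hy =>
  ContDiffWithinAt.sharp (contDiffOn_hatσ_graph hι hu y hy)
    (contDiffOn_hatDiff le_rfl (by simp) hu y hy) (isInner_hatσ hι hy)

lemma contDiffOn_hatInduced (hι : 𝓜.IsSmoothSpacelikeHypersurface ι)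
    (hu : ContMDiff (𝓡∂ m) 𝓘(ℝ, ℝ) ∞ u) :
    ContDiffOn ℝ ∞ (hatInduced 𝓜 ι x₀ u) (extChartAt (𝓡∂ m) x₀).target := by
  have h1 : ContDiffOn ℝ ∞ (hatDiff x₀ u) (extChartAt (𝓡∂ m) x₀).target :=
    contDiffOn_hatDiff le_rfl (by simp) hu
  refine contDiffOn_clm_apply.2 fun v => contDiffOn_clm_apply.2 fun w => ?_
  simp only [hatInduced_apply]
  exact (((contDiffOn_hatLapse hι).comp (contDiffOn_hatGraph hu) mapsTo_hatGraph).pow 2).mul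
    ((((contDiffOn_hatσ_graph hι hu).clm_apply contDiffOn_const).clm_apply contDiffOn_const).sub
      ((h1.clm_apply contDiffOn_const).mul (h1.clm_apply contDiffOn_const)))

lemma contDiffOn_hatFlux (hι : 𝓜.IsSmoothSpacelikeHypersurface ι)
    (hu : ContMDiff (𝓡∂ m) 𝓘(ℝ, ℝ) ∞ u) (hq : ∀ x, slopeSq 𝓜 ι u x < 1) :
    ContDiffOn ℝ ∞ (hatFlux 𝓜 ι x₀ u) (extChartAt (𝓡∂ m) x₀).target := by
  have h1 : ContDiffOn ℝ ∞ (hatDiff x₀ u) (extChartAt (𝓡∂ m) x₀).target :=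
    contDiffOn_hatDiff le_rfl (by simp) hu
  refine ContDiffOn.smul (ContDiffOn.neg (ContDiffOn.inv (contDiffOn_const.sub
    (h1.clm_apply (contDiffOn_hatGrad hι hu))) fun y hy => ?_)) (contDiffOn_hatGrad hι hu)
  have := hq ((extChartAt (𝓡∂ m) x₀).symm y)
  rw [hatDiff_hatGrad_self hι hu hy]
  linarith

lemma contDiffOn_sqrt_det_hatInduced (hι : 𝓜.IsSmoothSpacelikeHypersurface ι)
    (hu : ContMDiff (𝓡∂ m) 𝓘(ℝ, ℝ) ∞ u) (hq : ∀ x, slopeSq 𝓜 ι u x < 1) :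
    ContDiffOn ℝ ∞ (fun y => √(gram (hatInduced 𝓜 ι x₀ u y)).det)
      (extChartAt (𝓡∂ m) x₀).target :=
  (contDiffOn_det_gram (contDiffOn_hatInduced hι hu)).sqrt fun _ hy =>
    (isInner_hatInduced hι hu hy (hq _)).det_gram_pos.ne'

/-- This justifies calling `hatFlux` the tangential part of `∂_τ`: it has the same products with
tangent vectors of the graph. -/
lemma hatMetric_hatFlux (hι : 𝓜.IsSmoothSpacelikeHypersurface ι)
    (hu : ContMDiff (𝓡∂ m) 𝓘(ℝ, ℝ) ∞ u) {y : E} (hy : y ∈ (extChartAt (𝓡∂ m) x₀).target)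
    (hq : slopeSq 𝓜 ι u ((extChartAt (𝓡∂ m) x₀).symm y) < 1) (w : E) :
    hatMetric 𝓜 ι x₀ (hatGraph x₀ u y) (hatDiff x₀ u y (hatFlux 𝓜 ι x₀ u y), hatFlux 𝓜 ι x₀ u y)
        (hatDiff x₀ u y w, w) =
      hatMetric 𝓜 ι x₀ (hatGraph x₀ u y) (1, 0) (hatDiff x₀ u y w, w) := by
  have h : hatσ 𝓜 ι x₀ (hatGraph x₀ u y) (hatGrad 𝓜 ι x₀ u y) w = hatDiff x₀ u y w := by
    rw [hatGrad, (isInner_hatσ hι hy).apply_sharp]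
  rw [hatMetric_apply, hatMetric_apply, hatFlux, map_smul, map_smul, smul_apply, h,
    hatDiff_hatGrad_self hι hu hy]
  generalize slopeSq 𝓜 ι u ((extChartAt (𝓡∂ m) x₀).symm y) = q at hq
  have : 1 - q ≠ 0 := by linarith
  simp only [smul_eq_mul, map_zero, zero_apply]
  field_simp
  ring

/-- The normal part of `∂_τ` is `-g(∂_τ, N) N`, and `∂_τ = αT` gives the coefficient `αW`. -/
lemma time_sub_hatFlux (hι : 𝓜.IsSmoothSpacelikeHypersurface ι)
    (hu : ContMDiff (𝓡∂ m) 𝓘(ℝ, ℝ) ∞ u) {y : E} (hy : y ∈ (extChartAt (𝓡∂ m) x₀).target)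
    (hq : slopeSq 𝓜 ι u ((extChartAt (𝓡∂ m) x₀).symm y) < 1) :
    ((1, 0) : ℝ × E) - (hatDiff x₀ u y (hatFlux 𝓜 ι x₀ u y), hatFlux 𝓜 ι x₀ u y) =
      (hatLapse 𝓜 ι x₀ (hatGraph x₀ u y) *
        gammaFactor 𝓜 ι u ((extChartAt (𝓡∂ m) x₀).symm y)) • hatNormal 𝓜 ι x₀ u y := by
  have h1 := gammaFactor_sq hq
  set W := gammaFactor 𝓜 ι u ((extChartAt (𝓡∂ m) x₀).symm y)
  set q := slopeSq 𝓜 ι u ((extChartAt (𝓡∂ m) x₀).symm y)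
  have hα := (hatLapse_pos 𝓜 ι x₀ (hatGraph x₀ u y)).ne'
  have h2 : hatLapse 𝓜 ι x₀ (hatGraph x₀ u y) * W * (W / hatLapse 𝓜 ι x₀ (hatGraph x₀ u y)) =
      W ^ 2 := by field_simp
  have h4 : 1 - q ≠ 0 := by linarith
  have h3 : W ^ 2 = (1 - q)⁻¹ := by field_simp; exact h1
  rw [hatNormal, smul_smul, h2, hatFlux, map_smul, hatDiff_hatGrad_self hι hu hy, h3]
  ext1
  · change 1 - -(1 - q)⁻¹ * q = (1 - q)⁻¹ * 1
    field_simp; ring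
  · change 0 - -(1 - q)⁻¹ • hatGrad 𝓜 ι x₀ u y = (1 - q)⁻¹ • hatGrad 𝓜 ι x₀ u y
    rw [neg_smul, zero_sub, neg_neg]

/-- Apply `divergence_tangential` to the coordinate field `∂_τ = (1, 0)`. The Christoffel sum is the
drift, and the normal part `αW N` turns the other sum into `-αWH`. This is how the mean curvature
enters the estimate. -/
lemma divergence_hatFlux (hι : 𝓜.IsSmoothSpacelikeHypersurface ι)
    (hu : ContMDiff (𝓡∂ m) 𝓘(ℝ, ℝ) ∞ u) (hq : ∀ x, slopeSq 𝓜 ι u x < 1) {y : E}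
    (hy : y ∈ (extChartAt (𝓡∂ m) x₀).target) (hi : y ∈ interior (range (𝓡∂ m))) :
    ∃ L : Fin m → E →L[ℝ] ℝ,
      (∀ i, HasFDerivAt (fun z => √(gram (hatInduced 𝓜 ι x₀ u z)).det * hatFlux 𝓜 ι x₀ u z i)
        (L i) y) ∧
      ∑ i, L i (EuclideanSpace.single i 1) = √(gram (hatInduced 𝓜 ι x₀ u y)).det *
        (hatDrift 𝓜 ι x₀ u y - hatLapse 𝓜 ι x₀ (hatGraph x₀ u y) *
          gammaFactor 𝓜 ι u ((extChartAt (𝓡∂ m) x₀).symm y) *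
          𝓜.meanCurvature ι u ((extChartAt (𝓡∂ m) x₀).symm y)) := by
  have hT := target_mem_nhds hy hi
  have hev : ∀ᶠ z in 𝓝 y, z ∈ (extChartAt (𝓡∂ m) x₀).target ∧ z ∈ interior (range (𝓡∂ m)) :=
    (eventually_mem_set.2 hT).and (isOpen_interior.mem_nhds hi)
  have hB : DifferentiableAt ℝ (hatMetric 𝓜 ι x₀) (hatGraph x₀ u y) :=
    ((contDiffOn_hatMetric hι).contDiffAt (prod_target_mem_nhds hy hi)).differentiableAt (by simp)
  have hF : ContDiffAt ℝ 2 (hatGraph x₀ u) y :=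
    ((contDiffOn_hatGraph hu).contDiffAt hT).of_le (by norm_cast)
  have hV : DifferentiableAt ℝ (hatFlux 𝓜 ι x₀ u) y :=
    ((contDiffOn_hatFlux hι hu hq).contDiffAt hT).differentiableAt (by simp)
  obtain ⟨L, hL, hLsum⟩ := divergence_tangential (B := hatMetric 𝓜 ι x₀) (F := hatGraph x₀ u)
    hB (hatMetric_symm 𝓜 ι x₀) hF
    (by rw [pullForm_fderiv_hatGraph hu hy hi]; exact isInner_hatInduced hι hu hy (hq _))
    ((1, 0) : ℝ × E) (V := hatFlux 𝓜 ι x₀ u) hV (by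
      filter_upwards [hev] with z hz w
      rw [fderiv_hatGraph hu hz.1 hz.2]
      exact hatMetric_hatFlux hι hu hz.1 (hq _) w)
  refine ⟨L, fun i => (hL i).congr_of_eventuallyEq ?_, ?_⟩
  · filter_upwards [hev] with z hz
    rw [pullForm_fderiv_hatGraph hu hz.1 hz.2]
  · have hlin : ∀ (c : ℝ) i j, hessForm (hatMetric 𝓜 ι x₀) (hatGraph x₀ u) y
        (EuclideanSpace.single i 1) (EuclideanSpace.single j 1) (c • hatNormal 𝓜 ι x₀ u y) =
        c * hessForm (hatMetric 𝓜 ι x₀) (hatGraph x₀ u) y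
        (EuclideanSpace.single i 1) (EuclideanSpace.single j 1) (hatNormal 𝓜 ι x₀ u y) :=
      fun c i j => by
        simp only [hessForm, gammaFirst, map_smul, smul_apply, smul_eq_mul]; ring
    have hYV : ((1, 0) : ℝ × E) - fderiv ℝ (hatGraph x₀ u) y (hatFlux 𝓜 ι x₀ u y) =
        (hatLapse 𝓜 ι x₀ (hatGraph x₀ u y) *
        gammaFactor 𝓜 ι u ((extChartAt (𝓡∂ m) x₀).symm y)) • hatNormal 𝓜 ι x₀ u y := by
      rw [fderiv_hatGraph hu hy hi]
      exact time_sub_hatFlux hι hu hy (hq _)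
    rw [hLsum, meanCurvature_eq hι hu hy hi (hq _), pullForm_fderiv_hatGraph hu hy hi, hYV]
    simp_rw [hlin, mul_add, Finset.sum_add_distrib]
    rw [fderiv_hatGraph hu hy hi, mul_neg, sub_neg_eq_add, Finset.mul_sum]
    simp_rw [Finset.mul_sum]
    congr 2
    refine Finset.sum_congr rfl fun i _ => Finset.sum_congr rfl fun j _ => ?_
    ring

end ChartFlux

/-! ## The integral inequality in a chart -/

section ChartInequality

variable {m : ℕ} [NeZero m] {S : Type*} [TopologicalSpace S]
  [ChartedSpace (EuclideanSpace ℝ (Fin m)) S] [IsManifold (𝓡 m) ∞ S] {𝓜 : SplitSpacetime m S}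
  {Sig : Type*} [TopologicalSpace Sig] [ChartedSpace (EuclideanHalfSpace m) Sig]
  [IsManifold (𝓡∂ m) ∞ Sig] {ι : Sig → ℝ × S} {x₀ : Sig} {u : Sig → ℝ}

local notation "E" => EuclideanSpace ℝ (Fin m)

lemma fderiv_hatMetric_symm (hι : 𝓜.IsSmoothSpacelikeHypersurface ι) {z : ℝ × E}
    (hy : z.2 ∈ (extChartAt (𝓡∂ m) x₀).target) (hi : z.2 ∈ interior (range (𝓡∂ m)))
    (v a b : ℝ × E) : fderiv ℝ (hatMetric 𝓜 ι x₀) z v a b =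
      fderiv ℝ (hatMetric 𝓜 ι x₀) z v b a := by
  have hB : DifferentiableAt ℝ (hatMetric 𝓜 ι x₀) z :=
    ((contDiffOn_hatMetric hι).contDiffAt (prod_target_mem_nhds hy hi)).differentiableAt (by simp)
  have h1 : ∀ a b, HasFDerivAt (fun z => hatMetric 𝓜 ι x₀ z a b) _ z := fun a b =>
    (hB.hasFDerivAt.clm_apply (hasFDerivAt_const a _)).clm_apply (hasFDerivAt_const b _)
  have h2 := h1 a b
  simp_rw [hatMetric_symm 𝓜 ι x₀ _ a b] at h2
  simpa using DFunLike.congr_fun (h2.unique (h1 b a)) v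

/-- The bound on `∂_τ g` at the vector `(du(v), v)` equals `c (g_u(v, v) + 2α² du(v)²)`. Tracing
with `g_u` gives `c (m + 2(W² - 1))`, whence the growth like `W²`. -/
lemma abs_hatDrift_le (hι : 𝓜.IsSmoothSpacelikeHypersurface ι)
    (hu : ContMDiff (𝓡∂ m) 𝓘(ℝ, ℝ) ∞ u) {y : E}
    (hy : y ∈ (extChartAt (𝓡∂ m) x₀).target) (hi : y ∈ interior (range (𝓡∂ m)))
    (hq : slopeSq 𝓜 ι u ((extChartAt (𝓡∂ m) x₀).symm y) < 1) {c : ℝ} (hc : 0 ≤ c)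
    (hB : ∀ a : ℝ × E, |fderiv ℝ (hatMetric 𝓜 ι x₀) (hatGraph x₀ u y) (1, 0) a a| ≤
      c * (hatLapse 𝓜 ι x₀ (hatGraph x₀ u y) ^ 2 *
        (a.1 ^ 2 + hatσ 𝓜 ι x₀ (hatGraph x₀ u y) a.2 a.2))) :
    |hatDrift 𝓜 ι x₀ u y| ≤
      c * (m + 2) * gammaFactor 𝓜 ι u ((extChartAt (𝓡∂ m) x₀).symm y) ^ 2 := by
  set dB := fderiv ℝ (hatMetric 𝓜 ι x₀) (hatGraph x₀ u y) with hdB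
  have hs : ∀ v a b, dB v a b = dB v b a := fderiv_hatMetric_symm hι hy hi
  set α := hatLapse 𝓜 ι x₀ (hatGraph x₀ u y) with hα
  have hαpos : 0 < α := hatLapse_pos 𝓜 ι x₀ _
  set ℓ := hatDiff x₀ u y with hℓ
  set G := hatInduced 𝓜 ι x₀ u y with hG
  have hGi : IsInner G := isInner_hatInduced hι hu hy hq
  set W := gammaFactor 𝓜 ι u ((extChartAt (𝓡∂ m) x₀).symm y) with hW
  have hW1 : 1 ≤ W := one_le_gammaFactor hι hq
  have hW2 := gammaFactor_sq hq
  rw [← hW] at hW2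
  set q := slopeSq 𝓜 ι u ((extChartAt (𝓡∂ m) x₀).symm y) with hqdef
  set D := ℓ.prod (ContinuousLinearMap.id ℝ E) with hD
  set A := pullForm (dB (1, 0)) D with hA
  have hAs : ∀ v w, A v w = A w v := fun v w => hs _ _ _
  have hGsymm : ∀ i j, (gram G)⁻¹ i j = (gram G)⁻¹ j i := fun i j => by
    have : (gram G).transpose = gram G := by ext i j; exact hGi.symm _ _
    have h2 : (gram G)⁻¹.transpose = (gram G)⁻¹ := by rw [Matrix.transpose_nonsing_inv, this]
    conv_lhs => rw [← h2]
    rfl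
  have hdrift : hatDrift 𝓜 ι x₀ u y = Matrix.trace ((gram G)⁻¹ * gram A) / 2 := by
    let e : Fin m → ℝ × E := fun i => (ℓ (EuclideanSpace.single i 1), EuclideanSpace.single i 1)
    -- The part of the Christoffel symbol antisymmetric in `i`, `j` vanishes against the symmetric
    -- inverse metric, leaving half the trace of `∂_τ g`.
    have h1 : ∑ i, ∑ j, (gram G)⁻¹ i j * (dB (e i) (1, 0) (e j) - dB (e j) (1, 0) (e i)) = 0 := by
      have h2 : ∑ i, ∑ j, (gram G)⁻¹ i j * dB (e i) (1, 0) (e j) =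
          ∑ i, ∑ j, (gram G)⁻¹ i j * dB (e j) (1, 0) (e i) := by
        rw [Finset.sum_comm]
        refine Finset.sum_congr rfl fun i _ => Finset.sum_congr rfl fun j _ => ?_
        rw [hGsymm]
      simp_rw [mul_sub, Finset.sum_sub_distrib]
      rw [h2, sub_self]
    have h3 : hatDrift 𝓜 ι x₀ u y = ∑ i, ∑ j, ((gram G)⁻¹ i j * A (EuclideanSpace.single j 1)
        (EuclideanSpace.single i 1)) / 2 + (∑ i, ∑ j, (gram G)⁻¹ i j *
          (dB (e i) (1, 0) (e j) - dB (e j) (1, 0) (e i))) / 2 := by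
      rw [hatDrift, Finset.sum_div, ← Finset.sum_add_distrib]
      refine Finset.sum_congr rfl fun i _ => ?_
      rw [Finset.sum_div, ← Finset.sum_add_distrib]
      refine Finset.sum_congr rfl fun j _ => ?_
      have h4 : A (EuclideanSpace.single j 1) (EuclideanSpace.single i 1) =
          dB (1, 0) (e i) (e j) := hs _ _ _
      rw [h4, hs (e j) (1, 0)]
      change _ * ((dB (e i) (1, 0) (e j) + dB (1, 0) (e i) (e j) - dB (e j) (e i) (1, 0)) / 2) = _
      ring
    rw [h3, h1, Matrix.trace, Finset.sum_div]
    simp only [zero_div, add_zero]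
    refine Finset.sum_congr rfl fun i _ => ?_
    rw [Matrix.diag_apply, Matrix.mul_apply, Finset.sum_div]
    rfl
  have hAb : ∀ v, |A v v| ≤ c * (G v v + 2 * α ^ 2 * ℓ v ^ 2) := fun v => by
    refine (hB (ℓ v, v)).trans (le_of_eq ?_)
    rw [hG, hatInduced_apply]
    ring
  -- The gradient of `u` for `g_u` is `W²/α²` times its gradient for `σ_u`.
  have hsharp : ℓ (sharp G ℓ) * α ^ 2 = W ^ 2 - 1 := by
    have h1 : (W ^ 2 / α ^ 2) • hatGrad 𝓜 ι x₀ u y = sharp G ℓ := by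
      refine hGi.eq_sharp ?_
      ext v
      have h : hatσ 𝓜 ι x₀ (hatGraph x₀ u y) (hatGrad 𝓜 ι x₀ u y) v = ℓ v := by
        rw [hatGrad, (isInner_hatσ hι hy).apply_sharp]
      rw [map_smul, smul_apply, hG, hatInduced_apply, h, hatDiff_hatGrad_self hι hu hy]
      change W ^ 2 / α ^ 2 * (α ^ 2 * (ℓ v - q * ℓ v)) = ℓ v
      field_simp
      linear_combination (ℓ v) * hW2
    rw [← h1, map_smul, hatDiff_hatGrad_self hι hu hy, smul_eq_mul]
    change W ^ 2 / α ^ 2 * q * α ^ 2 = _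
    field_simp
    linear_combination -hW2
  have h1 := hGi.abs_trace_inv_mul_le hAs hAb
  rw [hdrift, abs_div, abs_two]
  have h2 : c * (m + 2 * α ^ 2 * ℓ (sharp G ℓ)) = c * (m + 2 * (W ^ 2 - 1)) := by
    rw [← hsharp]; ring
  rw [h2] at h1
  have hW3 : 1 ≤ W ^ 2 := one_le_pow₀ hW1
  have h5 : c * (m + 2 * (W ^ 2 - 1)) ≤ c * (m + 2) * W ^ 2 := by
    rw [mul_assoc]
    refine mul_le_mul_of_nonneg_left ?_ hc
    have : (m : ℝ) ≤ m * W ^ 2 := le_mul_of_one_le_right (Nat.cast_nonneg _) hW3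
    linarith
  have := abs_nonneg (Matrix.trace ((gram G)⁻¹ * gram A))
  linarith

/-- The rank one determinant formula gives `dV_{g_u} = α^m W⁻¹ dV_{σ_u}`. The factor `W⁻¹` lowers
the powers of `W` in the divergence identity by one. -/
lemma sqrt_det_hatInduced (hι : 𝓜.IsSmoothSpacelikeHypersurface ι)
    (hu : ContMDiff (𝓡∂ m) 𝓘(ℝ, ℝ) ∞ u) {y : E} (hy : y ∈ (extChartAt (𝓡∂ m) x₀).target) :
    √(gram (hatInduced 𝓜 ι x₀ u y)).det = hatLapse 𝓜 ι x₀ (hatGraph x₀ u y) ^ m *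
      √(gram (hatσ 𝓜 ι x₀ (hatGraph x₀ u y))).det *
        (gammaFactor 𝓜 ι u ((extChartAt (𝓡∂ m) x₀).symm y))⁻¹ := by
  have hα := hatLapse_pos 𝓜 ι x₀ (hatGraph x₀ u y)
  have hσ := isInner_hatσ (𝓜 := 𝓜) hι (z := hatGraph x₀ u y) hy
  have h := hatDiff_hatGrad_self hι hu hy
  rw [hatGrad] at h
  rw [hatInduced, hσ.det_gram_smul_sub_tensor, h, gammaFactor, inv_inv, ← pow_mul, mul_comm 2,
    pow_mul, Real.sqrt_mul (sq_nonneg _), Real.sqrt_sq (by positivity),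
    Real.sqrt_mul hσ.det_gram_pos.le, mul_assoc]

omit [NeZero m] in
lemma integrableOn_of_zero_off_compact {f : E → ℝ} {T K : Set E} (hK : IsCompact K) (hKT : K ⊆ T)
    (hT : MeasurableSet T) (hf : ContinuousOn f T) (h0 : ∀ y ∈ T, y ∉ K → f y = 0) :
    IntegrableOn f T :=
  ((hf.mono hKT).integrableOn_compact hK).of_forall_diff_eq_zero hT fun y hy => h0 y hy.1 hy.2

/-- The chart image of the support of a function. -/
def chartSupport (x₀ : Sig) (η : Sig → ℝ) : Set E := extChartAt (𝓡∂ m) x₀ '' tsupport η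

omit [IsManifold (𝓡∂ m) ∞ Sig] in
lemma isCompact_chartSupport [CompactSpace Sig] {η : Sig → ℝ}
    (hs : tsupport η ⊆ (extChartAt (𝓡∂ m) x₀).source) : IsCompact (chartSupport (m := m) x₀ η) :=
  (isClosed_tsupport η).isCompact.image_of_continuousOn ((continuousOn_extChartAt x₀).mono hs)

omit [IsManifold (𝓡∂ m) ∞ Sig] in
lemma chartSupport_subset {η : Sig → ℝ} (hs : tsupport η ⊆ (extChartAt (𝓡∂ m) x₀).source) :
    chartSupport (m := m) x₀ η ⊆ (extChartAt (𝓡∂ m) x₀).target := by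
  rintro _ ⟨x, hx, rfl⟩
  exact (extChartAt (𝓡∂ m) x₀).map_source (hs hx)

omit [IsManifold (𝓡∂ m) ∞ Sig] in
lemma symm_notMem_tsupport {η : Sig → ℝ} {y : E} (hy : y ∈ (extChartAt (𝓡∂ m) x₀).target)
    (h : y ∉ chartSupport (m := m) x₀ η) : (extChartAt (𝓡∂ m) x₀).symm y ∉ tsupport η := fun hx =>
  h ⟨_, hx, (extChartAt (𝓡∂ m) x₀).right_inv hy⟩

omit [IsManifold (𝓡∂ m) ∞ Sig] in
lemma symm_mem_tsupport {η : Sig → ℝ} (hs : tsupport η ⊆ (extChartAt (𝓡∂ m) x₀).source) {y : E}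
    (h : y ∈ chartSupport (m := m) x₀ η) : (extChartAt (𝓡∂ m) x₀).symm y ∈ tsupport η := by
  obtain ⟨x, hx, rfl⟩ := h
  rwa [(extChartAt (𝓡∂ m) x₀).left_inv (hs hx)]

open Classical in
/-- The flux `√det g_u V η`, extended by zero. -/
def cutFlux (𝓜 : SplitSpacetime m S) (ι : Sig → ℝ × S) (x₀ : Sig) (u η : Sig → ℝ) (i : Fin m)
    (y : E) : ℝ :=
  (extChartAt (𝓡∂ m) x₀).target.indicator
    (fun y => √(gram (hatInduced 𝓜 ι x₀ u y)).det * hatFlux 𝓜 ι x₀ u y i * hatFun x₀ η y) y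

variable {η : Sig → ℝ}

lemma cutFlux_eq_zero {i : Fin m} {y : E} (h : y ∉ chartSupport (m := m) x₀ η) :
    cutFlux 𝓜 ι x₀ u η i y = 0 := by
  by_cases hy : y ∈ (extChartAt (𝓡∂ m) x₀).target
  · rw [cutFlux, indicator_of_mem hy, hatFun, image_eq_zero_of_notMem_tsupport
      (symm_notMem_tsupport hy h), mul_zero]
  · rw [cutFlux, indicator_of_notMem hy]

/-- Extension by zero loses no regularity: points of the compact chart support have the chart target
as a relative neighbourhood, and near all other points the function is zero. -/
lemma contDiffOn_cutFlux [CompactSpace Sig] (hι : 𝓜.IsSmoothSpacelikeHypersurface ι)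
    (hu : ContMDiff (𝓡∂ m) 𝓘(ℝ, ℝ) ∞ u) (hq : ∀ x, slopeSq 𝓜 ι u x < 1)
    (hη : ContMDiff (𝓡∂ m) 𝓘(ℝ, ℝ) 1 η) (hs : tsupport η ⊆ (extChartAt (𝓡∂ m) x₀).source)
    (i : Fin m) : ContDiffOn ℝ 1 (cutFlux 𝓜 ι x₀ u η i) (range (𝓡∂ m)) := by
  intro y hy
  by_cases h : y ∈ chartSupport (m := m) x₀ η
  · have hyT := chartSupport_subset hs h
    have h1 : ContDiffOn ℝ 1 (fun y => √(gram (hatInduced 𝓜 ι x₀ u y)).det *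
        hatFlux 𝓜 ι x₀ u y i * hatFun x₀ η y) (extChartAt (𝓡∂ m) x₀).target := by
      refine (((contDiffOn_sqrt_det_hatInduced hι hu hq).of_le (by simp)).mul ?_).mul
        (contDiffOn_hatFun (by simp) hη)
      exact contDiffOn_euclidean.1 ((contDiffOn_hatFlux hι hu hq).of_le (by simp)) i
    refine ContDiffWithinAt.mono_of_mem_nhdsWithin ?_
      (extChartAt_target_mem_nhdsWithin_of_mem (I := 𝓡∂ m) hyT)
    exact (h1 y hyT).congr (fun z hz => indicator_of_mem hz _) (indicator_of_mem hyT _)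
  · have h2 : (chartSupport (m := m) x₀ η)ᶜ ∈ 𝓝[range (𝓡∂ m)] y :=
      mem_nhdsWithin_of_mem_nhds ((isCompact_chartSupport hs).isClosed.isOpen_compl.mem_nhds h)
    refine (contDiffWithinAt_const (c := (0 : ℝ))).congr_of_eventuallyEq ?_ (cutFlux_eq_zero h)
    filter_upwards [h2] with z hz using cutFlux_eq_zero hz

/-- The divergence of `cutFlux`. -/
def cutDiv (𝓜 : SplitSpacetime m S) (ι : Sig → ℝ × S) (x₀ : Sig) (u η : Sig → ℝ) (y : E) : ℝ :=
  ∑ i, fderivWithin ℝ (cutFlux 𝓜 ι x₀ u η i) (range (𝓡∂ m)) y (EuclideanSpace.single i 1)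

lemma cutDiv_eq_zero [CompactSpace Sig] (hs : tsupport η ⊆ (extChartAt (𝓡∂ m) x₀).source) {y : E}
    (h : y ∉ chartSupport (m := m) x₀ η) : cutDiv 𝓜 ι x₀ u η y = 0 := by
  refine Finset.sum_eq_zero fun i _ => ?_
  have h2 : (chartSupport (m := m) x₀ η)ᶜ ∈ 𝓝[range (𝓡∂ m)] y :=
    mem_nhdsWithin_of_mem_nhds ((isCompact_chartSupport hs).isClosed.isOpen_compl.mem_nhds h)
  have h3 : cutFlux 𝓜 ι x₀ u η i =ᶠ[𝓝[range (𝓡∂ m)] y] fun _ => 0 := by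
    filter_upwards [h2] with z hz using cutFlux_eq_zero hz
  rw [h3.fderivWithin_eq (cutFlux_eq_zero h)]
  simp

lemma integrableOn_cutDiv [CompactSpace Sig] (hι : 𝓜.IsSmoothSpacelikeHypersurface ι)
    (hu : ContMDiff (𝓡∂ m) 𝓘(ℝ, ℝ) ∞ u) (hq : ∀ x, slopeSq 𝓜 ι u x < 1)
    (hη : ContMDiff (𝓡∂ m) 𝓘(ℝ, ℝ) 1 η) (hs : tsupport η ⊆ (extChartAt (𝓡∂ m) x₀).source) :
    IntegrableOn (cutDiv 𝓜 ι x₀ u η) {y : E | 0 < y 0} := by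
  have h1 : IntegrableOn (cutDiv 𝓜 ι x₀ u η) (range (𝓡∂ m)) := by
    refine integrableOn_of_zero_off_compact (isCompact_chartSupport hs)
      ((chartSupport_subset hs).trans target_subset_range) (𝓡∂ m).isClosed_range.measurableSet ?_
      fun y _ h => cutDiv_eq_zero hs h
    refine continuousOn_finset_sum _ fun i _ => ?_
    exact ((contDiffOn_cutFlux hι hu hq hη hs i).continuousOn_fderivWithin (𝓡∂ m).uniqueDiffOn
      le_rfl).clm_apply continuousOn_const
  refine h1.mono_set fun y hy => ?_
  rw [range_modelWithCornersEuclideanHalfSpace]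
  exact le_of_lt (show 0 < y 0 from hy)

/-- Points of the chart target on the hyperplane `y 0 = 0` correspond to boundary points of `Σ`,
where `η` vanishes, so no boundary term appears. -/
lemma integral_cutDiv_eq_zero [CompactSpace Sig] (hι : 𝓜.IsSmoothSpacelikeHypersurface ι)
    (hu : ContMDiff (𝓡∂ m) 𝓘(ℝ, ℝ) ∞ u) (hq : ∀ x, slopeSq 𝓜 ι u x < 1)
    (hη : ContMDiff (𝓡∂ m) 𝓘(ℝ, ℝ) 1 η) (hs : tsupport η ⊆ (extChartAt (𝓡∂ m) x₀).source)
    (hb : ∀ x ∈ (𝓡∂ m).boundary Sig, η x = 0) :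
    ∫ y in {y : E | 0 < y 0}, cutDiv 𝓜 ι x₀ u η y = 0 := by
  obtain ⟨R, hR⟩ := (isCompact_chartSupport (m := m) hs).isBounded.subset_ball (0 : E)
  have hC := fun i => contDiffOn_cutFlux hι hu hq hη hs i
  have hrange := range_modelWithCornersEuclideanHalfSpace m
  refine setIntegral_halfSpace_divergence_eq_zero (cutFlux 𝓜 ι x₀ u η)
    (fun i y => fderivWithin ℝ (cutFlux 𝓜 ι x₀ u η i) (range (𝓡∂ m)) y) (R := max R 0)
    (le_max_right _ _) (fun i => ?_) (fun i y hy => ?_) (fun i y hy => ?_) (fun i y _ hRy => ?_)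
    (integrableOn_cutDiv hι hu hq hη hs)
  · rw [← hrange]; exact (hC i).continuousOn
  · have hi : y ∈ interior (range (𝓡∂ m)) := by
      rw [interior_range_modelWithCornersEuclideanHalfSpace]; exact hy
    exact (((hC i).differentiableOn (by simp)) y (interior_subset hi)).hasFDerivWithinAt.hasFDerivAt
      (mem_interior_iff_mem_nhds.1 hi)
  · by_cases hyT : y ∈ (extChartAt (𝓡∂ m) x₀).target
    · have hni : y ∉ interior (range (𝓡∂ m)) := by
        rw [interior_range_modelWithCornersEuclideanHalfSpace]
        exact fun h : 0 < y 0 => h.ne' hy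
      rw [mem_interior_range_iff hyT] at hni
      have : (extChartAt (𝓡∂ m) x₀).symm y ∈ (𝓡∂ m).boundary Sig := by
        rw [← ModelWithCorners.compl_interior]; exact hni
      rw [cutFlux, indicator_of_mem hyT, hatFun, hb _ this, mul_zero]
    · exact indicator_of_notMem hyT _
  · refine cutFlux_eq_zero fun h => ?_
    have := hR h
    rw [mem_ball_zero_iff] at this
    exact absurd this (not_lt.2 ((le_max_left _ _).trans hRy))

/-- The product rule for `η V`; since `V = -W²∇u`, the derivative of `η` enters as `-W² dη(∇u)`. -/
lemma cutDiv_eq [CompactSpace Sig] (hι : 𝓜.IsSmoothSpacelikeHypersurface ι)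
    (hu : ContMDiff (𝓡∂ m) 𝓘(ℝ, ℝ) ∞ u) (hq : ∀ x, slopeSq 𝓜 ι u x < 1)
    (hη : ContMDiff (𝓡∂ m) 𝓘(ℝ, ℝ) 1 η) {y : E}
    (hy : y ∈ (extChartAt (𝓡∂ m) x₀).target) (hi : y ∈ interior (range (𝓡∂ m))) :
    cutDiv 𝓜 ι x₀ u η y = √(gram (hatInduced 𝓜 ι x₀ u y)).det *
      (η ((extChartAt (𝓡∂ m) x₀).symm y) * (hatDrift 𝓜 ι x₀ u y -
        hatLapse 𝓜 ι x₀ (hatGraph x₀ u y) *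
          gammaFactor 𝓜 ι u ((extChartAt (𝓡∂ m) x₀).symm y) *
          𝓜.meanCurvature ι u ((extChartAt (𝓡∂ m) x₀).symm y)) -
        gammaFactor 𝓜 ι u ((extChartAt (𝓡∂ m) x₀).symm y) ^ 2 *
          differential η ((extChartAt (𝓡∂ m) x₀).symm y)
            (spatialGrad 𝓜 ι u ((extChartAt (𝓡∂ m) x₀).symm y))) := by
  obtain ⟨L, hL, hLs⟩ := divergence_hatFlux hι hu hq hy hi
  have hT := target_mem_nhds hy hi
  have hr := mem_interior_iff_mem_nhds.1 hi
  have hη' : HasFDerivAt (hatFun x₀ η) (hatDiff x₀ η y) y := by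
    have h1 := ((contDiffOn_hatFun (x₀ := x₀) (by simp) hη).contDiffAt hT).differentiableAt
      one_ne_zero
    rw [hatDiff, fderivWithin_of_mem_nhds hr]
    exact h1.hasFDerivAt
  have hd : ∀ i, fderivWithin ℝ (cutFlux 𝓜 ι x₀ u η i) (range (𝓡∂ m)) y =
      (√(gram (hatInduced 𝓜 ι x₀ u y)).det * hatFlux 𝓜 ι x₀ u y i) • hatDiff x₀ η y +
        hatFun x₀ η y • L i := fun i => by
    rw [fderivWithin_of_mem_nhds hr]
    refine (((hL i).mul hη').congr_of_eventuallyEq ?_).fderiv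
    filter_upwards [hT] with z hz
    exact indicator_of_mem hz _
  have hflux : hatDiff x₀ η y (hatFlux 𝓜 ι x₀ u y) =
      -(gammaFactor 𝓜 ι u ((extChartAt (𝓡∂ m) x₀).symm y) ^ 2 *
          differential η ((extChartAt (𝓡∂ m) x₀).symm y)
            (spatialGrad 𝓜 ι u ((extChartAt (𝓡∂ m) x₀).symm y))) := by
    have h1 := gammaFactor_sq (hq ((extChartAt (𝓡∂ m) x₀).symm y))
    have h2 := hq ((extChartAt (𝓡∂ m) x₀).symm y)
    rw [hatFlux, map_smul, hatDiff_hatGrad hι (hu.of_le (by simp)) hη hy,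
      hatDiff_hatGrad_self hι hu hy, smul_eq_mul, neg_mul, eq_inv_of_mul_eq_one_left h1]
  have hsum := clm_apply_eq_sum (hatDiff x₀ η y) (hatFlux 𝓜 ι x₀ u y)
  rw [hflux] at hsum
  rw [cutDiv]
  simp_rw [hd, add_apply, smul_apply, smul_eq_mul, Finset.sum_add_distrib, ← Finset.mul_sum, hLs,
    mul_assoc, ← Finset.mul_sum, ← hsum, hatFun]
  ring

end ChartInequality

/-! ## The integral inequality on the hypersurface -/

section GlobalInequality

variable {m : ℕ} [NeZero m] {S : Type*} [TopologicalSpace S]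
  [ChartedSpace (EuclideanSpace ℝ (Fin m)) S] [IsManifold (𝓡 m) ∞ S] {𝓜 : SplitSpacetime m S}
  {Sig : Type*} [TopologicalSpace Sig] [ChartedSpace (EuclideanHalfSpace m) Sig]
  [IsManifold (𝓡∂ m) ∞ Sig] {ι : Sig → ℝ × S} {x₀ : Sig} {u : Sig → ℝ}

local notation "E" => EuclideanSpace ℝ (Fin m)

omit [IsManifold (𝓡∂ m) ∞ Sig] in
lemma continuous_of_chart {f : Sig → ℝ}
    (h : ∀ x₀ : Sig, ContinuousOn (fun y => f ((extChartAt (𝓡∂ m) x₀).symm y))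
      (extChartAt (𝓡∂ m) x₀).target) : Continuous f := by
  refine continuous_iff_continuousAt.2 fun x => ?_
  have h1 : ContinuousOn (fun x' => f ((extChartAt (𝓡∂ m) x).symm (extChartAt (𝓡∂ m) x x')))
      (extChartAt (𝓡∂ m) x).source :=
    (h x).comp (continuousOn_extChartAt x) fun x' hx' => (extChartAt (𝓡∂ m) x).map_source hx'
  have h2 := h1.continuousAt (extChartAt_source_mem_nhds (I := 𝓡∂ m) x)
  refine h2.congr ?_
  filter_upwards [extChartAt_source_mem_nhds (I := 𝓡∂ m) x] with x' hx'
  rw [(extChartAt (𝓡∂ m) x).left_inv hx']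

lemma continuous_gradPairing (hι : 𝓜.IsSmoothSpacelikeHypersurface ι)
    (hu : ContMDiff (𝓡∂ m) 𝓘(ℝ, ℝ) ∞ u) {η : Sig → ℝ} (hη : ContMDiff (𝓡∂ m) 𝓘(ℝ, ℝ) 1 η) :
    Continuous fun x => differential η x (spatialGrad 𝓜 ι u x) := by
  refine continuous_of_chart (m := m) fun x₀ => ?_
  have h1 : ContinuousOn (hatDiff x₀ η) (extChartAt (𝓡∂ m) x₀).target :=
    (contDiffOn_hatDiff (n := 0) (k := 1) (by simp) (by simp) hη).continuousOn
  refine (h1.clm_apply (contDiffOn_hatGrad hι hu).continuousOn).congr fun y hy => ?_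
  exact (hatDiff_hatGrad hι (hu.of_le (by simp)) hη hy).symm

lemma continuous_gammaFactor (hι : 𝓜.IsSmoothSpacelikeHypersurface ι)
    (hu : ContMDiff (𝓡∂ m) 𝓘(ℝ, ℝ) ∞ u) (hq : ∀ x, slopeSq 𝓜 ι u x < 1) :
    Continuous (gammaFactor 𝓜 ι u) := by
  have h1 : Continuous (slopeSq 𝓜 ι u) := continuous_gradPairing hι hu (hu.of_le (by simp))
  refine ((continuous_const.sub h1).sqrt).inv₀ fun x => ?_
  have := hq x
  exact (Real.sqrt_pos.2 (by simp; linarith)).ne'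

/-- The lapse along the graph of `u`. -/
def lapseAt (𝓜 : SplitSpacetime m S) (ι : Sig → ℝ × S) (u : Sig → ℝ) (x : Sig) : ℝ :=
  𝓜.lapse (u x, (ι x).2)

omit [NeZero m] [ChartedSpace (EuclideanHalfSpace m) Sig] [IsManifold (𝓡∂ m) ∞ Sig]
  [TopologicalSpace Sig] in
lemma lapseAt_pos (x : Sig) : 0 < lapseAt 𝓜 ι u x := 𝓜.lapse_pos _

lemma continuous_lapseAt (hι : 𝓜.IsSmoothSpacelikeHypersurface ι) (hu : Continuous u) :
    Continuous (lapseAt 𝓜 ι u) :=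
  𝓜.contMDiff_lapse.continuous.comp (hu.prodMk (contMDiff_snd_comp hι).continuous)

variable [MeasurableSpace Sig] [BorelSpace Sig] [CompactSpace Sig]

lemma continuousOn_coordForm_σPull (hι : 𝓜.IsSmoothSpacelikeHypersurface ι)
    (hu : ContMDiff (𝓡∂ m) 𝓘(ℝ, ℝ) ∞ u) :
    ContinuousOn (fun y => coordForm (𝓡∂ m) (𝓜.σPull ι u) x₀ y) (extChartAt (𝓡∂ m) x₀).target :=
  (contDiffOn_hatσ_graph hι hu).continuousOn.congr fun _ hy => coordForm_σPull hι u hy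

lemma integral_σPull_eq (hι : 𝓜.IsSmoothSpacelikeHypersurface ι)
    (hu : ContMDiff (𝓡∂ m) 𝓘(ℝ, ℝ) ∞ u) {f : Sig → ℝ} (hf : Continuous f)
    (hs : ∀ x ∉ (extChartAt (𝓡∂ m) x₀).source, f x = 0) :
    ∫ x, f x ∂(riemannianVolume (𝓡∂ m) (𝓜.σPull ι u)) =
      ∫ y in (extChartAt (𝓡∂ m) x₀).target,
        √(gram (hatσ 𝓜 ι x₀ (hatGraph x₀ u y))).det * f ((extChartAt (𝓡∂ m) x₀).symm y) := by
  rw [integral_riemannianVolume_eq _ x₀ (continuousOn_coordForm_σPull hι hu) hf hs]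
  refine setIntegral_congr_fun (measurableSet_extChartAt_target x₀) fun y hy => ?_
  rw [coordForm_σPull hι u hy]
  rfl

omit [MeasurableSpace Sig] [BorelSpace Sig] in
lemma continuousOn_sqrt_det_hatσ (hι : 𝓜.IsSmoothSpacelikeHypersurface ι)
    (hu : ContMDiff (𝓡∂ m) 𝓘(ℝ, ℝ) ∞ u) :
    ContinuousOn (fun y => √(gram (hatσ 𝓜 ι x₀ (hatGraph x₀ u y))).det)
      (extChartAt (𝓡∂ m) x₀).target :=
  (contDiffOn_det_gram (contDiffOn_hatσ_graph hι hu)).continuousOn.sqrt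

omit [MeasurableSpace Sig] [BorelSpace Sig] in
lemma integrableOn_chart (hι : 𝓜.IsSmoothSpacelikeHypersurface ι)
    (hu : ContMDiff (𝓡∂ m) 𝓘(ℝ, ℝ) ∞ u) {f η : Sig → ℝ} (hf : Continuous f)
    (hs : tsupport η ⊆ (extChartAt (𝓡∂ m) x₀).source) (hfη : ∀ x ∉ tsupport η, f x = 0) :
    IntegrableOn (fun y => √(gram (hatσ 𝓜 ι x₀ (hatGraph x₀ u y))).det *
      f ((extChartAt (𝓡∂ m) x₀).symm y)) (extChartAt (𝓡∂ m) x₀).target := by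
  refine integrableOn_of_zero_off_compact (isCompact_chartSupport hs) (chartSupport_subset hs)
    (measurableSet_extChartAt_target x₀) ((continuousOn_sqrt_det_hatσ hι hu).mul
      (hf.comp_continuousOn (continuousOn_extChartAt_symm x₀))) fun y hy h => ?_
  rw [hfη _ (symm_notMem_tsupport hy h), mul_zero]

omit [MeasurableSpace Sig] [BorelSpace Sig] [CompactSpace Sig] [IsManifold (𝓡∂ m) ∞ Sig] in
lemma differential_eq_zero {η : Sig → ℝ} {x : Sig} (h : x ∉ tsupport η) :
    differential (m := m) η x = 0 := by
  have h1 : η =ᶠ[𝓝 x] fun _ => 0 := notMem_tsupport_iff_eventuallyEq.1 h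
  have h2 := h1.mfderiv_eq (I := 𝓡∂ m) (I' := 𝓘(ℝ, ℝ))
  exact h2.trans (mfderiv_const (I := 𝓡∂ m) (I' := 𝓘(ℝ, ℝ)))

omit [NeZero m] in
-- The divergence identity holds at interior points only; the boundary hyperplane has measure zero.
lemma ae_mem_pos [NeZero m] {T : Set E} (hT : T ⊆ {y | 0 ≤ y 0}) (hTm : MeasurableSet T) (f : E → ℝ) :
    ∫ y in T, f y = ∫ y in T ∩ {y | 0 < y 0}, f y := by
  refine setIntegral_congr_set ?_
  have h0 : volume {y : E | y 0 = 0} = 0 := by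
    have h1 := Measure.addHaar_submodule (volume : Measure E)
      (LinearMap.ker (EuclideanSpace.proj (0 : Fin m) : E →L[ℝ] ℝ).toLinearMap) (by
        intro h
        have h2 : EuclideanSpace.single (0 : Fin m) (1 : ℝ) ∈
            LinearMap.ker (EuclideanSpace.proj (0 : Fin m) : E →L[ℝ] ℝ).toLinearMap := by
          rw [h]; trivial
        simp at h2)
    exact h1
  have h3 : ∀ᵐ y : E, y 0 ≠ 0 := measure_eq_zero_iff_ae_notMem.1 h0
  filter_upwards [h3] with y hy
  refine propext ⟨fun h => ⟨h, lt_of_le_of_ne (hT h) hy.symm⟩, fun h => h.1⟩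

/-- The integral inequality for a test function supported in a chart. -/
lemma chart_inequality (hι : 𝓜.IsSmoothSpacelikeHypersurface ι)
    (hu : ContMDiff (𝓡∂ m) 𝓘(ℝ, ℝ) ∞ u) (hq : ∀ x, slopeSq 𝓜 ι u x < 1) {η h : Sig → ℝ}
    (hη : ContMDiff (𝓡∂ m) 𝓘(ℝ, ℝ) 1 η) (hs : tsupport η ⊆ (extChartAt (𝓡∂ m) x₀).source)
    (hb : ∀ x ∈ (𝓡∂ m).boundary Sig, η x = 0) {c : ℝ} (hc : 0 ≤ c)
    (hB : ∀ y ∈ chartSupport (m := m) x₀ η, y ∈ interior (range (𝓡∂ m)) → ∀ a : ℝ × E,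
      |fderiv ℝ (hatMetric 𝓜 ι x₀) (hatGraph x₀ u y) (1, 0) a a| ≤
      c * (hatLapse 𝓜 ι x₀ (hatGraph x₀ u y) ^ 2 *
        (a.1 ^ 2 + hatσ 𝓜 ι x₀ (hatGraph x₀ u y) a.2 a.2)))
    (hh : Continuous h) (hH : ∀ x ∈ (𝓡∂ m).interior Sig, |𝓜.meanCurvature ι u x| ≤ h x) :
    ∫ x, lapseAt 𝓜 ι u x ^ m * gammaFactor 𝓜 ι u x * differential η x (spatialGrad 𝓜 ι u x)
        ∂(riemannianVolume (𝓡∂ m) (𝓜.σPull ι u)) ≤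
      ∫ x, lapseAt 𝓜 ι u x ^ m * |η x| * (c * (m + 2) * gammaFactor 𝓜 ι u x +
        lapseAt 𝓜 ι u x * h x) ∂(riemannianVolume (𝓡∂ m) (𝓜.σPull ι u)) := by
  have hα := continuous_lapseAt hι hu.continuous
  have hW := continuous_gammaFactor hι hu hq
  have hf₁ : Continuous fun x => lapseAt 𝓜 ι u x ^ m * gammaFactor 𝓜 ι u x *
      differential η x (spatialGrad 𝓜 ι u x) :=
    ((hα.pow m).mul hW).mul (continuous_gradPairing hι hu hη)
  have hf₂ : Continuous fun x => lapseAt 𝓜 ι u x ^ m * |η x| *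
      (c * (m + 2) * gammaFactor 𝓜 ι u x + lapseAt 𝓜 ι u x * h x) :=
    ((hα.pow m).mul hη.continuous.abs).mul ((continuous_const.mul hW).add (hα.mul hh))
  have hz₁ : ∀ x ∉ tsupport η, lapseAt 𝓜 ι u x ^ m * gammaFactor 𝓜 ι u x *
      differential η x (spatialGrad 𝓜 ι u x) = 0 := fun x hx => by
    rw [differential_eq_zero hx]; simp
  have hz₂ : ∀ x ∉ tsupport η, lapseAt 𝓜 ι u x ^ m * |η x| *
      (c * (m + 2) * gammaFactor 𝓜 ι u x + lapseAt 𝓜 ι u x * h x) = 0 := fun x hx => by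
    rw [image_eq_zero_of_notMem_tsupport hx]; simp
  rw [integral_σPull_eq hι hu hf₁ (fun x hx => hz₁ x fun h => hx (hs h)),
    integral_σPull_eq hι hu hf₂ (fun x hx => hz₂ x fun h => hx (hs h))]
  have hi₁ := integrableOn_chart hι hu hf₁ hs hz₁
  have hi₂ := integrableOn_chart hι hu hf₂ hs hz₂
  set T := (extChartAt (𝓡∂ m) x₀).target with hTdef
  have hTm : MeasurableSet T := measurableSet_extChartAt_target x₀
  have hTr : T ⊆ {y | 0 ≤ y 0} := by
    rw [← range_modelWithCornersEuclideanHalfSpace]; exact target_subset_range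
  have hPm : MeasurableSet {y : E | 0 < y 0} := by
    rw [← interior_range_modelWithCornersEuclideanHalfSpace]; exact isOpen_interior.measurableSet
  rw [ae_mem_pos hTr hTm, ae_mem_pos hTr hTm]
  have hdiv : ∫ y in T ∩ {y : E | 0 < y 0}, cutDiv 𝓜 ι x₀ u η y = 0 := by
    refine Eq.trans (Eq.symm ?_) (integral_cutDiv_eq_zero hι hu hq hη hs hb)
    refine setIntegral_eq_of_subset_of_forall_sdiff_eq_zero hPm inter_subset_right fun y hy => ?_
    exact cutDiv_eq_zero hs fun h => hy.2 ⟨chartSupport_subset hs h, hy.1⟩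
  have hid : IntegrableOn (cutDiv 𝓜 ι x₀ u η) (T ∩ {y : E | 0 < y 0}) :=
    (integrableOn_cutDiv hι hu hq hη hs).mono_set inter_subset_right
  -- Adding the integral of the divergence, which is zero, makes the claim an inequality between
  -- integrands.
  refine (le_of_eq (show _ = _ + ∫ y in T ∩ {y : E | 0 < y 0}, cutDiv 𝓜 ι x₀ u η y by
    rw [hdiv, add_zero])).trans ?_
  rw [← integral_add (hi₁.mono_set inter_subset_left) hid]
  refine setIntegral_mono_on ((hi₁.mono_set inter_subset_left).add hid)
    (hi₂.mono_set inter_subset_left) (hTm.inter hPm) fun y hy => ?_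
  have hyT := hy.1
  have hyi : y ∈ interior (range (𝓡∂ m)) := by
    rw [interior_range_modelWithCornersEuclideanHalfSpace]; exact hy.2
  rw [cutDiv_eq hι hu hq hη hyT hyi, sqrt_det_hatInduced hι hu hyT]
  set x := (extChartAt (𝓡∂ m) x₀).symm y with hx
  have hlapse : hatLapse 𝓜 ι x₀ (hatGraph x₀ u y) = lapseAt 𝓜 ι u x := rfl
  have hαpos := lapseAt_pos (𝓜 := 𝓜) (ι := ι) (u := u) x
  have hW1 := one_le_gammaFactor hι (hq x)
  have hHx := hH x ((mem_interior_range_iff hyT).1 hyi)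
  have hdet : 0 ≤ √(gram (hatσ 𝓜 ι x₀ (hatGraph x₀ u y))).det := Real.sqrt_nonneg _
  by_cases hyK : y ∈ chartSupport (m := m) x₀ η
  · have hdrift := abs_hatDrift_le hι hu hyT hyi (hq _) hc (hB y hyK hyi)
    rw [← hx] at hdrift
    rw [hlapse]
    generalize √(gram (hatσ 𝓜 ι x₀ (hatGraph x₀ u y))).det = d at *
    generalize lapseAt 𝓜 ι u x = α at *
    generalize gammaFactor 𝓜 ι u x = W at *
    generalize hatDrift 𝓜 ι x₀ u y = Q at *
    generalize 𝓜.meanCurvature ι u x = H at *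
    generalize differential η x (spatialGrad 𝓜 ι u x) = p
    have hWpos : 0 < W := by linarith
    -- The terms with the derivative of `η` cancel, since the volume factor `W⁻¹` times `W²` is the
    -- `W` in front of `p`.
    have e1 : d * (α ^ m * W * p) + α ^ m * d * W⁻¹ * (η x * (Q - α * W * H) - W ^ 2 * p) =
        d * α ^ m * (η x * (Q * W⁻¹ - α * H)) := by
      field_simp
      ring
    have e2 : η x * (Q * W⁻¹ - α * H) ≤ |η x| * (c * (m + 2) * W + α * h x) := by
      refine (le_abs_self _).trans ?_
      rw [abs_mul]
      refine mul_le_mul_of_nonneg_left ?_ (abs_nonneg _)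
      refine (abs_sub _ _).trans (add_le_add ?_ ?_)
      · rw [abs_mul, abs_inv, abs_of_pos hWpos]
        refine (mul_le_mul_of_nonneg_right hdrift (inv_nonneg.2 hWpos.le)).trans (le_of_eq ?_)
        field_simp
      · rw [abs_mul, abs_of_pos hαpos]
        exact mul_le_mul_of_nonneg_left hHx hαpos.le
    rw [e1]
    refine (mul_le_mul_of_nonneg_left e2 (by positivity)).trans (le_of_eq ?_)
    ring
  · have hxn := symm_notMem_tsupport hyT hyK
    rw [← hx] at hxn
    rw [differential_eq_zero hxn, image_eq_zero_of_notMem_tsupport hxn]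
    simp

end GlobalInequality

/-! ### From charts to the hypersurface by a partition of unity. -/

section PartitionInequality

variable {m : ℕ} [NeZero m] {S : Type*} [TopologicalSpace S]
  [ChartedSpace (EuclideanSpace ℝ (Fin m)) S] [IsManifold (𝓡 m) ∞ S] {𝓜 : SplitSpacetime m S}
  {Sig : Type*} [TopologicalSpace Sig] [ChartedSpace (EuclideanHalfSpace m) Sig]
  [IsManifold (𝓡∂ m) ∞ Sig] {ι : Sig → ℝ × S} {x₀ : Sig} {u : Sig → ℝ}

local notation "E" => EuclideanSpace ℝ (Fin m)

variable (m Sig) in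
lemma exists_chart_partition [T2Space Sig] [CompactSpace Sig] :
    ∃ (t : Finset Sig) (χ : t → Sig → ℝ), (∀ k, ContMDiff (𝓡∂ m) 𝓘(ℝ, ℝ) ∞ (χ k)) ∧
      (∀ k x, 0 ≤ χ k x) ∧ (∀ k : t, tsupport (χ k) ⊆ (extChartAt (𝓡∂ m) (k : Sig)).source) ∧
      ∀ x, ∑ k, χ k x = 1 := by
  obtain ⟨t, ht⟩ := isCompact_univ.elim_finite_subcover
    (fun x : Sig => (extChartAt (𝓡∂ m) x).source) (fun x => isOpen_extChartAt_source x)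
    (fun x _ => mem_iUnion.2 ⟨x, mem_extChartAt_source x⟩)
  obtain ⟨f, hf⟩ := SmoothPartitionOfUnity.exists_isSubordinate (𝓡∂ m) (s := (univ : Set Sig))
    isClosed_univ (fun k : t => (extChartAt (𝓡∂ m) (k : Sig)).source)
    (fun k => isOpen_extChartAt_source _) fun x hx => by
      obtain ⟨i, hi, hx⟩ := mem_iUnion₂.1 (ht hx)
      exact mem_iUnion.2 ⟨⟨i, hi⟩, hx⟩
  refine ⟨t, fun k => f k, fun k => (f k).contMDiff, fun k x => f.nonneg k x, fun k => hf k,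
    fun x => ?_⟩
  rw [← finsum_eq_sum_of_fintype]
  exact f.sum_eq_one (mem_univ x)

omit [IsManifold (𝓡∂ m) ∞ Sig] in
lemma differential_add {f g : Sig → ℝ} (hf : MDifferentiable (𝓡∂ m) 𝓘(ℝ, ℝ) f)
    (hg : MDifferentiable (𝓡∂ m) 𝓘(ℝ, ℝ) g) (x : Sig) :
    differential (m := m) (fun x => f x + g x) x = differential f x + differential g x :=
  mfderiv_add (hf x) (hg x)

omit [IsManifold (𝓡∂ m) ∞ Sig] in
lemma differential_sum {κ : Type*} (s : Finset κ) {f : κ → Sig → ℝ}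
    (hf : ∀ k, ContMDiff (𝓡∂ m) 𝓘(ℝ, ℝ) 1 (f k)) (x : Sig) :
    differential (m := m) (fun x => ∑ k ∈ s, f k x) x = ∑ k ∈ s, differential (f k) x := by
  classical
  induction s using Finset.induction_on with
  | empty =>
    simp only [Finset.sum_empty]
    exact mfderiv_const (I := 𝓡∂ m) (I' := 𝓘(ℝ, ℝ))
  | insert k s hk ih =>
    simp only [Finset.sum_insert hk]
    rw [differential_add ((hf k).mdifferentiable one_ne_zero)
      ((ContMDiff.sum fun i _ => hf i).mdifferentiable one_ne_zero), ih]

variable [MeasurableSpace Sig] [BorelSpace Sig] [CompactSpace Sig] [T2Space Sig]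

lemma isFiniteMeasure_riemannianVolume (hι : 𝓜.IsSmoothSpacelikeHypersurface ι)
    (hu : ContMDiff (𝓡∂ m) 𝓘(ℝ, ℝ) ∞ u) :
    IsFiniteMeasure (riemannianVolume (𝓡∂ m) (𝓜.σPull ι u)) := by
  obtain ⟨t, χ, -, -, hχs, hχ1⟩ := exists_chart_partition m Sig
  have hcov : (univ : Set Sig) ⊆ ⋃ k, tsupport (χ k) := fun x _ => by
    by_contra hcon
    simp only [mem_iUnion, not_exists] at hcon
    have := hχ1 x
    rw [Finset.sum_eq_zero fun k _ => image_eq_zero_of_notMem_tsupport (hcon k)] at this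
    exact zero_ne_one this
  refine ⟨(measure_mono hcov).trans_lt ((measure_iUnion_le _).trans_lt ?_)⟩
  rw [tsum_fintype]
  refine ENNReal.sum_lt_top.2 fun k _ => ?_
  have hm : MeasurableSet (tsupport (χ k)) := (isClosed_tsupport _).measurableSet
  rw [riemannianVolume_apply_of_subset _ (k : Sig) hm (hχs k), chartVolume_apply _ _ hm]
  have hset : (extChartAt (𝓡∂ m) (k : Sig)).symm ⁻¹' tsupport (χ k) ∩
      (extChartAt (𝓡∂ m) (k : Sig)).target = chartSupport (m := m) (k : Sig) (χ k) := by
    ext y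
    refine ⟨fun h => ?_, fun h => ⟨symm_mem_tsupport (hχs k) h, chartSupport_subset (hχs k) h⟩⟩
    by_contra hy
    exact symm_notMem_tsupport h.2 hy h.1
  rw [hset]
  refine Integrable.lintegral_lt_top ?_
  refine ContinuousOn.integrableOn_compact (isCompact_chartSupport (hχs k)) ?_
  exact ((continuousOn_sqrt_det_hatσ hι hu).congr fun y hy => by
    rw [coordForm_σPull hι u hy]; rfl).mono (chartSupport_subset (hχs k))

lemma integrable_of_continuous (hι : 𝓜.IsSmoothSpacelikeHypersurface ι)
    (hu : ContMDiff (𝓡∂ m) 𝓘(ℝ, ℝ) ∞ u) {f : Sig → ℝ} (hf : Continuous f) :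
    Integrable f (riemannianVolume (𝓡∂ m) (𝓜.σPull ι u)) := by
  haveI := isFiniteMeasure_riemannianVolume hι hu
  exact hf.integrable_of_hasCompactSupport (HasCompactSupport.of_compactSpace f)

omit [MeasurableSpace Sig] [BorelSpace Sig] [CompactSpace Sig] [T2Space Sig] in
-- By homogeneity it is enough to bound the quotient on the product of `K` with the unit sphere,
-- which is compact.
lemma IsCompact.exists_quadratic_bound {Z V : Type*} [TopologicalSpace Z] [NormedAddCommGroup V]
    [NormedSpace ℝ V] [FiniteDimensional ℝ V] {K : Set Z} (hK : IsCompact K) {A N : Z → V → ℝ}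
    (hA : ContinuousOn (fun p : Z × V => A p.1 p.2) (K ×ˢ univ))
    (hN : ContinuousOn (fun p : Z × V => N p.1 p.2) (K ×ˢ univ))
    (hA2 : ∀ z (r : ℝ) v, A z (r • v) = r ^ 2 * A z v)
    (hN2 : ∀ z (r : ℝ) v, N z (r • v) = r ^ 2 * N z v)
    (hpos : ∀ z ∈ K, ∀ v, v ≠ 0 → 0 < N z v) :
    ∃ c, 0 ≤ c ∧ ∀ z ∈ K, ∀ v, |A z v| ≤ c * N z v := by
  have hS : IsCompact (K ×ˢ Metric.sphere (0 : V) 1) := hK.prod (isCompact_sphere 0 1)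
  have hsub : K ×ˢ Metric.sphere (0 : V) 1 ⊆ K ×ˢ univ := prod_mono_right (subset_univ _)
  have hne : ∀ v ∈ Metric.sphere (0 : V) 1, v ≠ 0 := fun v hv h => by
    rw [h] at hv; simp at hv
  obtain ⟨c, hc⟩ := (hS.bddAbove_image (f := fun p : Z × V => |A p.1 p.2| / N p.1 p.2)
    ((hA.mono hsub).abs.div (hN.mono hsub) fun p hp => (hpos _ hp.1 _ (hne _ hp.2)).ne'))
  refine ⟨max c 0, le_max_right _ _, fun z hz v => ?_⟩
  by_cases hv : v = 0
  · have h1 := hA2 z 0 0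
    have h2 := hN2 z 0 0
    simp only [smul_zero] at h1 h2
    rw [hv, h1, h2]; simp
  · have hn : ‖v‖ ≠ 0 := norm_ne_zero_iff.2 hv
    have hw : ‖v‖⁻¹ • v ∈ Metric.sphere (0 : V) 1 := by
      rw [mem_sphere_zero_iff_norm, norm_smul, norm_inv, norm_norm, inv_mul_cancel₀ hn]
    have h3 := hc ⟨(z, ‖v‖⁻¹ • v), ⟨hz, hw⟩, rfl⟩
    have h4 := hpos z hz _ (hne _ hw)
    simp only at h3
    rw [div_le_iff₀ h4] at h3
    have h5 : |A z (‖v‖⁻¹ • v)| ≤ max c 0 * N z (‖v‖⁻¹ • v) :=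
      h3.trans (mul_le_mul_of_nonneg_right (le_max_left _ _) h4.le)
    rw [hA2, hN2, abs_mul, abs_of_nonneg (sq_nonneg _)] at h5
    have h6 : 0 < ‖v‖⁻¹ ^ 2 := by positivity
    rw [mul_left_comm] at h5
    exact le_of_mul_le_mul_left h5 h6

omit [MeasurableSpace Sig] [BorelSpace Sig] [CompactSpace Sig] [T2Space Sig] in
/-- The derivative of the metric in the time direction is controlled on compact sets. -/
lemma exists_timeDeriv_bound (hι : 𝓜.IsSmoothSpacelikeHypersurface ι) {K : Set E}
    (hK : IsCompact K) (hKT : K ⊆ (extChartAt (𝓡∂ m) x₀).target) (a b : ℝ) :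
    ∃ c, 0 ≤ c ∧ ∀ t ∈ Icc a b, ∀ y ∈ K, y ∈ interior (range (𝓡∂ m)) → ∀ v : ℝ × E,
      |fderiv ℝ (hatMetric 𝓜 ι x₀) (t, y) (1, 0) v v| ≤
        c * (hatLapse 𝓜 ι x₀ (t, y) ^ 2 * (v.1 ^ 2 + hatσ 𝓜 ι x₀ (t, y) v.2 v.2)) := by
  set T : Set (ℝ × E) := univ ×ˢ (extChartAt (𝓡∂ m) x₀).target with hT
  have hKsub : Icc a b ×ˢ K ⊆ T := prod_mono (subset_univ _) hKT
  -- The derivative within the chart domain is continuous up to the boundary, so `K` may touch it;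
  -- at interior points it is the ordinary derivative.
  have hd :=
    (contDiffOn_hatMetric (x₀ := x₀) hι).continuousOn_fderivWithin
      (uniqueDiffOn_univ.prod uniqueDiffOn_target) (by simp)
  have hfst : ContinuousOn (fun p : (ℝ × E) × (ℝ × E) => p.1) ((Icc a b ×ˢ K) ×ˢ univ) :=
    continuousOn_fst
  have hmaps : MapsTo (fun p : (ℝ × E) × (ℝ × E) => p.1) ((Icc a b ×ˢ K) ×ˢ univ) T :=
    fun p hp => hKsub hp.1
  obtain ⟨c, hc, hb⟩ := IsCompact.exists_quadratic_bound (isCompact_Icc.prod hK)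
    (A := fun z v => fderivWithin ℝ (hatMetric 𝓜 ι x₀) T z (1, 0) v v)
    (N := fun z v => hatLapse 𝓜 ι x₀ z ^ 2 * (v.1 ^ 2 + hatσ 𝓜 ι x₀ z v.2 v.2))
    ((((hd.comp hfst hmaps).clm_apply continuousOn_const).clm_apply continuousOn_snd).clm_apply
      continuousOn_snd)
    ((((contDiffOn_hatLapse hι).continuousOn.comp hfst hmaps).pow 2).mul
      ((continuousOn_snd.fst.pow 2).add ((((contDiffOn_hatσ hι).continuousOn.comp hfst
        hmaps).clm_apply continuousOn_snd.snd).clm_apply continuousOn_snd.snd)))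
    (fun z r v => by simp only [map_smul, smul_apply, smul_eq_mul]; ring)
    (fun z r v => by
      simp only [Prod.smul_fst, Prod.smul_snd, map_smul, smul_apply, smul_eq_mul]; ring)
    (fun z hz v hv => by
      refine mul_pos (pow_pos (hatLapse_pos 𝓜 ι x₀ z) 2) ?_
      have hI := isInner_hatσ (𝓜 := 𝓜) hι (z := z) (hKT hz.2)
      by_cases h2 : v.2 = 0
      · have h1 : v.1 ≠ 0 := fun h1 => hv (Prod.ext h1 h2)
        have := hI.nonneg v.2
        positivity
      · have := hI.pos _ h2
        positivity)
  refine ⟨c, hc, fun t ht y hy hi v => ?_⟩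
  have := hb (t, y) ⟨ht, hy⟩ v
  rwa [fderivWithin_of_mem_nhds (prod_target_mem_nhds (z := (t, y)) (hKT hy) hi)] at this

omit [MeasurableSpace Sig] [BorelSpace Sig] [CompactSpace Sig] [T2Space Sig] in
lemma exists_det_bound (hι : 𝓜.IsSmoothSpacelikeHypersurface ι) {K : Set E}
    (hK : IsCompact K) (hKT : K ⊆ (extChartAt (𝓡∂ m) x₀).target) (a b : ℝ) :
    ∃ c, 0 ≤ c ∧ ∀ t ∈ Icc a b, ∀ y ∈ K, √(gram (hatσ 𝓜 ι x₀ (t, y))).det ≤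
      c * √(gram (hatσ 𝓜 ι x₀ (hatGraph x₀ (SplitSpacetime.height ι) y))).det := by
  have hKsub : Icc a b ×ˢ K ⊆ univ ×ˢ (extChartAt (𝓡∂ m) x₀).target :=
    prod_mono (subset_univ _) hKT
  have h1 : ContinuousOn (fun z => √(gram (hatσ 𝓜 ι x₀ z)).det) (Icc a b ×ˢ K) :=
    ((contDiffOn_det_gram (contDiffOn_hatσ hι)).continuousOn.sqrt).mono hKsub
  have h2 : ContinuousOn
      (fun y => √(gram (hatσ 𝓜 ι x₀ (hatGraph x₀ (SplitSpacetime.height ι) y))).det)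
      (extChartAt (𝓡∂ m) x₀).target :=
    (contDiffOn_det_gram (contDiffOn_hatσ_graph hι (contMDiff_height hι))).continuousOn.sqrt
  have h3 : ContinuousOn (fun z : ℝ × E =>
      √(gram (hatσ 𝓜 ι x₀ (hatGraph x₀ (SplitSpacetime.height ι) z.2))).det) (Icc a b ×ˢ K) :=
    h2.comp continuousOn_snd fun z hz => hKT hz.2
  have hpos : ∀ y ∈ K,
      0 < √(gram (hatσ 𝓜 ι x₀ (hatGraph x₀ (SplitSpacetime.height ι) y))).det := fun y hy =>
    Real.sqrt_pos.2 (isInner_hatσ hι (hKT hy)).det_gram_pos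
  obtain ⟨c, hc⟩ := (isCompact_Icc.prod hK).bddAbove_image (h1.div h3 fun z hz => (hpos _ hz.2).ne')
  refine ⟨max c 0, le_max_right _ _, fun t ht y hy => ?_⟩
  have := hc ⟨(t, y), ⟨ht, hy⟩, rfl⟩
  rw [← div_le_iff₀ (hpos y hy)]
  exact this.trans (le_max_left _ _)

lemma integral_eq_sum_partition (hι : 𝓜.IsSmoothSpacelikeHypersurface ι)
    (hu : ContMDiff (𝓡∂ m) 𝓘(ℝ, ℝ) ∞ u) {κ : Type*} [Fintype κ] {F : κ → Sig → ℝ} {f : Sig → ℝ}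
    (hF : ∀ k, Continuous (F k)) (hf : ∀ x, f x = ∑ k, F k x) :
    ∫ x, f x ∂(riemannianVolume (𝓡∂ m) (𝓜.σPull ι u)) =
      ∑ k, ∫ x, F k x ∂(riemannianVolume (𝓡∂ m) (𝓜.σPull ι u)) := by
  rw [← integral_finset_sum _ fun k _ => integrable_of_continuous hι hu (hF k)]
  exact integral_congr_ae (Eventually.of_forall hf)

/-- The volumes of the metrics `σ_u`, for bounded `u`, are controlled by that of `σ_φ`. -/
lemma exists_volume_comparison (hι : 𝓜.IsSmoothSpacelikeHypersurface ι) (a b : ℝ) :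
    ∃ c, 0 ≤ c ∧ ∀ u : Sig → ℝ, ContMDiff (𝓡∂ m) 𝓘(ℝ, ℝ) ∞ u → (∀ x, u x ∈ Icc a b) →
      ∀ f : Sig → ℝ, Continuous f → (∀ x, 0 ≤ f x) →
      ∫ x, f x ∂(riemannianVolume (𝓡∂ m) (𝓜.σPull ι u)) ≤
        c * ∫ x, f x ∂(riemannianVolume (𝓡∂ m) (𝓜.σPull ι (SplitSpacetime.height ι))) := by
  obtain ⟨t, χ, hχ, hχ0, hχs, hχ1⟩ := exists_chart_partition m Sig
  choose c hc hdet using fun k : t => exists_det_bound (x₀ := (k : Sig)) hι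
    (isCompact_chartSupport (hχs k)) (chartSupport_subset (hχs k)) a b
  refine ⟨∑ k, c k, Finset.sum_nonneg fun k _ => hc k, fun u hu hub f hf hf0 => ?_⟩
  have hφ := contMDiff_height hι
  have hF : ∀ k, Continuous fun x => χ k x * f x := fun k => (hχ k).continuous.mul hf
  have hz : ∀ k, ∀ x ∉ tsupport (χ k), χ k x * f x = 0 := fun k x hx => by
    rw [image_eq_zero_of_notMem_tsupport hx, zero_mul]
  have hsum : ∀ x, f x = ∑ k, χ k x * f x := fun x => by
    rw [← Finset.sum_mul, hχ1, one_mul]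
  have hle : ∀ k, ∫ x, χ k x * f x ∂(riemannianVolume (𝓡∂ m) (𝓜.σPull ι u)) ≤
      c k * ∫ x, χ k x * f x ∂(riemannianVolume (𝓡∂ m)
        (𝓜.σPull ι (SplitSpacetime.height ι))) := fun k => by
    rw [integral_σPull_eq hι hu (hF k) (fun x hx => hz k x fun h => hx (hχs k h)),
      integral_σPull_eq hι hφ (hF k) (fun x hx => hz k x fun h => hx (hχs k h)),
      ← integral_const_mul]
    refine setIntegral_mono_on (integrableOn_chart hι hu (hF k) (hχs k) (hz k))
      ((integrableOn_chart hι hφ (hF k) (hχs k) (hz k)).const_mul _)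
      (measurableSet_extChartAt_target _) fun y hy => ?_
    by_cases hyK : y ∈ chartSupport (m := m) (k : Sig) (χ k)
    · rw [← mul_assoc (c k)]
      exact mul_le_mul_of_nonneg_right (hdet k _ (hub _) y hyK) (mul_nonneg (hχ0 k _) (hf0 _))
    · rw [hz k _ (symm_notMem_tsupport hy hyK)]; simp
  rw [integral_eq_sum_partition hι hu hF hsum, Finset.sum_mul]
  refine Finset.sum_le_sum fun k _ => (hle k).trans (mul_le_mul_of_nonneg_left ?_ (hc k))
  refine integral_mono (integrable_of_continuous hι hφ (hF k)) (integrable_of_continuous hι hφ hf)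
    fun x => ?_
  refine mul_le_of_le_one_left (hf0 x) ?_
  rw [← hχ1 x]
  exact Finset.single_le_sum (f := fun k => χ k x) (fun k _ => hχ0 k x) (Finset.mem_univ k)

/-- The integral inequality obtained by testing the prescribed mean curvature equation. -/
lemma exists_integral_inequality (hι : 𝓜.IsSmoothSpacelikeHypersurface ι) (a b : ℝ) :
    ∃ c, 0 ≤ c ∧ ∀ u : Sig → ℝ, ContMDiff (𝓡∂ m) 𝓘(ℝ, ℝ) ∞ u → (∀ x, slopeSq 𝓜 ι u x < 1) →
      (∀ x, u x ∈ Icc a b) → ∀ ψ h : Sig → ℝ, ContMDiff (𝓡∂ m) 𝓘(ℝ, ℝ) 1 ψ →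
      (∀ x ∈ (𝓡∂ m).boundary Sig, ψ x = 0) → Continuous h →
      (∀ x ∈ (𝓡∂ m).interior Sig, |𝓜.meanCurvature ι u x| ≤ h x) →
      ∫ x, lapseAt 𝓜 ι u x ^ m * gammaFactor 𝓜 ι u x * differential ψ x (spatialGrad 𝓜 ι u x)
          ∂(riemannianVolume (𝓡∂ m) (𝓜.σPull ι u)) ≤
        ∫ x, lapseAt 𝓜 ι u x ^ m * |ψ x| * (c * gammaFactor 𝓜 ι u x +
          lapseAt 𝓜 ι u x * h x) ∂(riemannianVolume (𝓡∂ m) (𝓜.σPull ι u)) := by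
  obtain ⟨t, χ, hχ, hχ0, hχs, hχ1⟩ := exists_chart_partition m Sig
  choose c hc hB using fun k : t => exists_timeDeriv_bound (x₀ := (k : Sig)) (𝓜 := 𝓜) hι
    (isCompact_chartSupport (hχs k)) (chartSupport_subset (hχs k)) a b
  have hcle : ∀ k, c k ≤ ∑ k, c k := fun k =>
    Finset.single_le_sum (fun k _ => hc k) (Finset.mem_univ k)
  have hc0 : 0 ≤ ∑ k, c k := Finset.sum_nonneg fun k _ => hc k
  refine ⟨(∑ k, c k) * (m + 2), by positivity, fun u hu hq hub ψ h hψ hψb hh hH => ?_⟩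
  -- Test each chart with `ψ χ_k`. The differentials of these products add up to that of `ψ` and
  -- their absolute values to `|ψ|`, so no derivative of the partition survives.
  have hη : ∀ k, ContMDiff (𝓡∂ m) 𝓘(ℝ, ℝ) 1 (fun x => ψ x * χ k x) := fun k =>
    hψ.mul ((hχ k).of_le (by simp))
  have hηs : ∀ k, tsupport (fun x => ψ x * χ k x) ⊆ tsupport (χ k) := fun k =>
    tsupport_mul_subset_right
  have hα := continuous_lapseAt hι hu.continuous
  have hW := continuous_gammaFactor hι hu hq
  have h1 := fun k : t => chart_inequality (x₀ := (k : Sig)) hι hu hq (hη k)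
    ((hηs k).trans (hχs k)) (fun x hx => by rw [hψb x hx, zero_mul]) hc0 (fun y hy hi v => by
      have hyK : y ∈ chartSupport (m := m) (k : Sig) (χ k) := image_mono (hηs k) hy
      have hT := chartSupport_subset (hχs k) hyK
      refine (hB k _ (hub _) y hyK hi v).trans (mul_le_mul_of_nonneg_right (hcle k) ?_)
      have h2 := (isInner_hatσ (𝓜 := 𝓜) hι (z := hatGraph (k : Sig) u y) hT).nonneg v.2
      exact mul_nonneg (sq_nonneg _) (add_nonneg (sq_nonneg _) h2)) hh hH
  have h2 := Finset.sum_le_sum fun (k : t) (_ : k ∈ Finset.univ) => h1 k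
  have hψsum : (fun x => ∑ k, ψ x * χ k x) = ψ := funext fun x => by
    rw [← Finset.mul_sum, hχ1, mul_one]
  rw [← integral_eq_sum_partition hι hu
      (F := fun k x => lapseAt 𝓜 ι u x ^ m * gammaFactor 𝓜 ι u x *
        differential (fun x => ψ x * χ k x) x (spatialGrad 𝓜 ι u x))
      (f := fun x => lapseAt 𝓜 ι u x ^ m * gammaFactor 𝓜 ι u x *
        differential ψ x (spatialGrad 𝓜 ι u x))
      (fun k => ((hα.pow m).mul hW).mul (continuous_gradPairing hι hu (hη k))) (fun x => by
        rw [← Finset.mul_sum, ← hψsum, differential_sum _ hη, sum_apply, hψsum]),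
    ← integral_eq_sum_partition hι hu
      (F := fun k x => lapseAt 𝓜 ι u x ^ m * |ψ x * χ k x| *
        ((∑ k, c k) * (m + 2) * gammaFactor 𝓜 ι u x + lapseAt 𝓜 ι u x * h x))
      (f := fun x => lapseAt 𝓜 ι u x ^ m * |ψ x| *
        ((∑ k, c k) * (m + 2) * gammaFactor 𝓜 ι u x + lapseAt 𝓜 ι u x * h x))
      (fun k => ((hα.pow m).mul (hη k).continuous.abs).mul
        ((continuous_const.mul hW).add (hα.mul hh))) (fun x => by
        rw [← Finset.sum_mul, ← Finset.mul_sum]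
        congr 2
        simp_rw [abs_mul, fun k => abs_of_nonneg (hχ0 k x)]
        rw [← Finset.mul_sum, hχ1, mul_one])] at h2
  exact h2

end PartitionInequality

/-! ## Causal curves -/

section CausalCurves

variable {m : ℕ} [NeZero m] {S : Type*} [TopologicalSpace S]
  [ChartedSpace (EuclideanSpace ℝ (Fin m)) S] [IsManifold (𝓡 m) ∞ S]

local notation "E" => EuclideanSpace ℝ (Fin m)

/-- A continuous curve on `[0, ∞)` with causal right velocities `v` such that `ε dτ(v) < 0`. -/
structure IsCausalRay (𝓜 : SplitSpacetime m S) (ε : ℝ) (γ : ℝ → ℝ × S) : Prop where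
  continuousOn : ∀ b, ContinuousOn γ (Icc 0 b)
  velocity : ∀ s, 0 ≤ s → ∃ L : ℝ →L[ℝ] ℝ × E,
    HasMFDerivWithinAt 𝓘(ℝ, ℝ) (ambientModel m) γ (Ici s) s L ∧
      metricAt 𝓜 (γ s) (L 1) (L 1) ≤ 0 ∧ ε * (L 1).1 < 0

variable {𝓜 : SplitSpacetime m S} {ε : ℝ} {γ : ℝ → ℝ × S}

/-- Each time lies in a half-open interval `[t i, t (i + 1))`, on which the curve has a right
velocity in the cone. Passing to right velocities removes the break points from all later arguments.
-/
lemma isCausalRay_of_isInextendibleFrom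
    {K : (p : ℝ × S) → TangentSpace (ambientModel m) p → Prop}
    (hK : ∀ (p : ℝ × S) (v : ℝ × E), K p v → metricAt 𝓜 p v v ≤ 0 ∧ ε * v.1 < 0) {p : ℝ × S}
    (h : SplitSpacetime.IsInextendibleFrom K p γ) : IsCausalRay 𝓜 ε γ := by
  obtain ⟨-, ⟨t, ht0, htm, htt, hp⟩, -⟩ := h
  have hcont : ∀ n, ContinuousOn γ (Icc 0 (t n)) := fun n => by
    induction n with
    | zero => rw [ht0, Icc_self]; exact continuousOn_singleton _ _
    | succ n ih =>
      have h0 : 0 ≤ t n := ht0 ▸ htm.monotone (Nat.zero_le n)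
      rw [← Icc_union_Icc_eq_Icc h0 (htm.monotone n.le_succ)]
      exact ih.union_of_isClosed (hp n).1.continuousOn isClosed_Icc isClosed_Icc
  refine ⟨fun b => ?_, fun s hs => ?_⟩
  · obtain ⟨n, hn⟩ := (htt.eventually_ge_atTop b).exists
    exact (hcont n).mono (Icc_subset_Icc_right hn)
  · obtain ⟨n, hn⟩ := (htt.eventually_gt_atTop s).exists
    obtain ⟨i, hi1, hi2⟩ : ∃ i, t i ≤ s ∧ s < t (i + 1) := by
      induction n with
      | zero => rw [ht0] at hn; exact absurd hn (not_lt.2 hs)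
      | succ n ih =>
        by_cases hsn : s < t n
        · exact ih hsn
        · exact ⟨n, not_lt.1 hsn, hn⟩
    have hm : s ∈ Icc (t i) (t (i + 1)) := ⟨hi1, hi2.le⟩
    have hd := (((hp i).1 s hm).mdifferentiableWithinAt (by simp)).hasMFDerivWithinAt
    refine ⟨mfderivWithin 𝓘(ℝ, ℝ) (ambientModel m) γ (Icc (t i) (t (i + 1))) s,
      hd.mono_of_mem_nhdsWithin ?_, hK _ _ ((hp i).2 s hm)⟩
    exact mem_of_superset (Ico_mem_nhdsGE hi2) fun r hr => ⟨hi1.trans hr.1, hr.2.le⟩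

lemma metricAt_lapse_inv (p : ℝ × S) (v : ℝ × E) :
    metricAt 𝓜 p ((𝓜.lapse p)⁻¹, 0) v = -(𝓜.lapse p * v.1) := by
  have h0 := (𝓜.lapse_pos p).ne'
  have h2 : spatialAt 𝓜 p 0 v.2 = 0 := by rw [map_zero]; rfl
  rw [metricAt_apply, h2]
  field_simp
  ring

lemma isCausalRay_of_past {p : ℝ × S}
    (h : SplitSpacetime.IsInextendibleFrom 𝓜.PastCausal p γ) : IsCausalRay 𝓜 1 γ := by
  refine isCausalRay_of_isInextendibleFrom (fun p v hv => ⟨hv.1, ?_⟩) h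
  have h1 : 0 < metricAt 𝓜 p ((𝓜.lapse p)⁻¹, 0) v := hv.2.2
  have h0 := 𝓜.lapse_pos p
  rw [metricAt_lapse_inv] at h1
  nlinarith

lemma isCausalRay_of_future {p : ℝ × S}
    (h : SplitSpacetime.IsInextendibleFrom 𝓜.FutureCausal p γ) : IsCausalRay 𝓜 (-1) γ := by
  refine isCausalRay_of_isInextendibleFrom (fun p v hv => ⟨hv.1, ?_⟩) h
  have h1 : metricAt 𝓜 p ((𝓜.lapse p)⁻¹, 0) v < 0 := hv.2.2
  have h0 := 𝓜.lapse_pos p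
  rw [metricAt_lapse_inv] at h1
  nlinarith

lemma hasDerivWithinAt_time {s : ℝ} {L : ℝ →L[ℝ] ℝ × E}
    (hL : HasMFDerivWithinAt 𝓘(ℝ, ℝ) (ambientModel m) γ (Ici s) s L) :
    HasDerivWithinAt (fun r => (γ r).1) (L 1).1 (Ici s) s := by
  have h := ((hasMFDerivAt_fst (I := 𝓘(ℝ, ℝ)) (I' := 𝓡 m) (γ s)).comp_hasMFDerivWithinAt s hL)
  have h1 : HasFDerivWithinAt (fun r => (γ r).1) ((ContinuousLinearMap.fst ℝ ℝ E).comp L)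
      (Ici s) s := hasMFDerivWithinAt_iff_hasFDerivWithinAt.1 h
  exact h1.hasDerivWithinAt

/-- A product chart of `ℝ × S` leaves the time coordinate alone, so coordinate velocities show the
time speed directly. -/
lemma ambientSymmDeriv_fst (q : ℝ × S) {z : ℝ × E}
    (hz : z ∈ (extChartAt (ambientModel m) q).target) (a : ℝ × E) :
    (ambientSymmDeriv q z a).1 = a.1 := by
  have ho : IsOpen (extChartAt (ambientModel m) q).target := isOpen_extChartAt_target q
  have h1 := ((contMDiffOn_extChartAt_symm (I := ambientModel m) (n := ∞) q).contMDiffAt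
    (ho.mem_nhds hz)).mdifferentiableAt (by simp)
  have h2 := (hasMFDerivAt_fst (I := 𝓘(ℝ, ℝ)) (I' := 𝓡 m)
    ((extChartAt (ambientModel m) q).symm z)).comp z h1.hasMFDerivAt
  have h3 : (Prod.fst ∘ (extChartAt (ambientModel m) q).symm : ℝ × E → ℝ) = Prod.fst := by
    funext w
    rw [extChartAt_prod]
    rfl
  rw [h3] at h2
  have h5 : HasFDerivAt (Prod.fst : ℝ × E → ℝ)
      ((ContinuousLinearMap.fst ℝ ℝ E).comp (ambientSymmDeriv q z)) z :=
    hasMFDerivAt_iff_hasFDerivAt.1 h2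
  have h4 := h5.unique hasFDerivAt_fst
  exact congrArg (fun T : (ℝ × E) →L[ℝ] ℝ => T a) h4

lemma ambientSymmDeriv_injective (q : ℝ × S) {z : ℝ × E}
    (hz : z ∈ (extChartAt (ambientModel m) q).target) :
    Function.Injective (ambientSymmDeriv q z) := by
  haveI : IsManifold (ambientModel m) 1 (ℝ × S) := .of_le (n := ∞) (by simp)
  have h : range (ambientModel m) = univ := ModelWithCorners.range_eq_univ _
  have h2 := isInvertible_mfderivWithin_extChartAt_symm (I := ambientModel m) hz
  rw [h, mfderivWithin_univ] at h2
  exact h2.injective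

lemma hasDerivWithinAt_chart {q : ℝ × S} {s : ℝ} {L : ℝ →L[ℝ] ℝ × E}
    (hL : HasMFDerivWithinAt 𝓘(ℝ, ℝ) (ambientModel m) γ (Ici s) s L)
    (hq : γ s ∈ (extChartAt (ambientModel m) q).source) :
    ∃ a : ℝ × E, HasDerivWithinAt (fun r => extChartAt (ambientModel m) q (γ r)) a (Ici s) s ∧
      ambientSymmDeriv q (extChartAt (ambientModel m) q (γ s)) a = L 1 := by
  haveI : IsManifold (ambientModel m) 1 (ℝ × S) := .of_le (n := ∞) (by simp)
  have h1 : MDifferentiableAt (ambientModel m) 𝓘(ℝ, ℝ × E) (extChartAt (ambientModel m) q) (γ s) :=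
    mdifferentiableAt_extChartAt (by rwa [extChartAt_source] at hq)
  have h2 := h1.hasMFDerivAt.comp_hasMFDerivWithinAt s hL
  let D : (ℝ × E) →L[ℝ] ℝ × E :=
    mfderiv (ambientModel m) 𝓘(ℝ, ℝ × E) (extChartAt (ambientModel m) q) (γ s)
  have h4 : HasFDerivWithinAt (fun r => extChartAt (ambientModel m) q (γ r)) (D.comp L)
    (Ici s) s := hasMFDerivWithinAt_iff_hasFDerivWithinAt.1 h2
  refine ⟨D (L 1), h4.hasDerivWithinAt, ?_⟩
  have h : range (ambientModel m) = univ := ModelWithCorners.range_eq_univ _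
  have h3 := mfderivWithin_extChartAt_symm_comp_mfderiv_extChartAt' (I := ambientModel m) hq
  rw [h, mfderivWithin_univ] at h3
  exact congrArg (fun T : (ℝ × E) →L[ℝ] (ℝ × E) => T (L 1)) h3

/-- Near each point the coordinate speed of causal curves is bounded by their time speed. -/
lemma exists_cone_bound (𝓜 : SplitSpacetime m S) (q : ℝ × S) : ∃ r₀ > 0, ∃ C, 0 ≤ C ∧
    Metric.closedBall (extChartAt (ambientModel m) q q) r₀ ⊆
      (extChartAt (ambientModel m) q).target ∧
    ∀ z ∈ Metric.closedBall (extChartAt (ambientModel m) q q) r₀, ∀ a : ℝ × E,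
      ambientForm 𝓜 q z a a ≤ 0 → ‖a‖ ≤ C * |a.1| := by
  have ho : IsOpen (extChartAt (ambientModel m) q).target := isOpen_extChartAt_target q
  obtain ⟨r₀, hr0, hr⟩ := Metric.nhds_basis_closedBall.mem_iff.1
    (ho.mem_nhds (mem_extChartAt_target (I := ambientModel m) q))
  set K := Metric.closedBall (extChartAt (ambientModel m) q q) r₀ with hKdef
  have hcF : ContinuousOn (ambientForm 𝓜 q) K := fun z hz =>
    (differentiableAt_ambientForm 𝓜 q (hr hz)).continuousAt.continuousWithinAt
  have hcl : ContinuousOn (fun z => 𝓜.lapse ((extChartAt (ambientModel m) q).symm z)) K :=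
    𝓜.contMDiff_lapse.continuous.comp_continuousOn ((continuousOn_extChartAt_symm q).mono hr)
  have hfst : ContinuousOn (Prod.fst : (ℝ × E) × (ℝ × E) → ℝ × E) (K ×ˢ univ) :=
    continuousOn_fst
  have hmaps : MapsTo (Prod.fst : (ℝ × E) × (ℝ × E) → ℝ × E) (K ×ˢ univ) K := fun z hz => hz.1
  -- Divided by `α² + 1`, the metric has time coefficient above `-1`, so adding the square of the
  -- time component makes it positive definite. On causal vectors only that square remains as an
  -- upper bound.
  obtain ⟨c, hc, hb⟩ := IsCompact.exists_quadratic_bound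
    (isCompact_closedBall (extChartAt (ambientModel m) q q) r₀)
    (A := fun z v => ‖v‖ ^ 2)
    (N := fun z v => ambientForm 𝓜 q z v v /
      (𝓜.lapse ((extChartAt (ambientModel m) q).symm z) ^ 2 + 1) + v.1 ^ 2)
    (continuousOn_snd.norm.pow 2)
    (((((hcF.comp hfst hmaps).clm_apply continuousOn_snd).clm_apply continuousOn_snd).div
      (((hcl.comp hfst hmaps).pow 2).add continuousOn_const)
      fun z _ => (add_pos_of_nonneg_of_pos (sq_nonneg _) one_pos).ne').add
      (continuousOn_snd.fst.pow 2))
    (fun z r v => by rw [norm_smul, mul_pow, Real.norm_eq_abs, sq_abs])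
    (fun z r v => by
      simp only [Prod.smul_fst, map_smul, smul_apply, smul_eq_mul]; ring)
    (fun z hz v hv => by
      set w := ambientSymmDeriv q z v with hw
      set α := 𝓜.lapse ((extChartAt (ambientModel m) q).symm z) with hα
      have h1 : w.1 = v.1 := ambientSymmDeriv_fst q (hr hz) v
      have hw0 : w ≠ 0 := fun h0 =>
        hv (ambientSymmDeriv_injective q (hr hz) (h0.trans (map_zero _).symm))
      have h2 : ambientForm 𝓜 q z v v = α ^ 2 * (-(w.1 * w.1) +
          spatialAt 𝓜 ((extChartAt (ambientModel m) q).symm z) w.2 w.2) := by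
        rw [ambientForm_eq]
        exact metricAt_apply 𝓜 _ w w
      have hI := isInner_σ 𝓜 ((extChartAt (ambientModel m) q).symm z)
      have h3 : 0 ≤ spatialAt 𝓜 ((extChartAt (ambientModel m) q).symm z) w.2 w.2 := hI.nonneg w.2
      have hα0 : 0 < α := 𝓜.lapse_pos _
      have h4 : ambientForm 𝓜 q z v v / (α ^ 2 + 1) + v.1 ^ 2 =
          (α ^ 2 * spatialAt 𝓜 ((extChartAt (ambientModel m) q).symm z) w.2 w.2 + w.1 ^ 2) /
            (α ^ 2 + 1) := by
        rw [h2, ← h1]; field_simp; ring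
      rw [h4]
      refine div_pos ?_ (by positivity)
      by_cases h5 : w.2 = 0
      · have : w.1 ≠ 0 := fun h6 => hw0 (Prod.ext h6 h5)
        positivity
      · have : 0 < spatialAt 𝓜 ((extChartAt (ambientModel m) q).symm z) w.2 w.2 := hI.pos _ h5
        positivity)
  refine ⟨r₀, hr0, Real.sqrt c, Real.sqrt_nonneg _, hr, fun z hz a ha => ?_⟩
  have h1 := hb z hz a
  rw [abs_of_nonneg (by positivity)] at h1
  have h2 : ambientForm 𝓜 q z a a /
      (𝓜.lapse ((extChartAt (ambientModel m) q).symm z) ^ 2 + 1) ≤ 0 :=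
    div_nonpos_of_nonpos_of_nonneg ha (by positivity)
  refine abs_le_of_sq_le_sq' ?_ (by positivity) |>.2
  rw [mul_pow, Real.sq_sqrt hc, sq_abs]
  exact h1.trans (mul_le_mul_of_nonneg_left (by linarith) hc)

lemma IsCausalRay.time_antitone (h : IsCausalRay 𝓜 ε γ) {s s' : ℝ} (hs : 0 ≤ s) (hss : s ≤ s') :
    ε * (γ s').1 ≤ ε * (γ s).1 := by
  choose! L hL using h.velocity
  have hc : ContinuousOn (fun r => ε * (γ r).1) (Icc s s') :=
    continuousOn_const.mul (continuous_fst.comp_continuousOn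
      ((h.continuousOn s').mono (Icc_subset_Icc_left hs)))
  exact image_le_of_deriv_right_le_deriv_boundary hc
    (fun r hr => (hasDerivWithinAt_time (hL r (hs.trans hr.1)).1).const_mul ε)
    (B := fun _ => ε * (γ s).1) (B' := fun _ => 0) le_rfl continuousOn_const
    (fun r _ => hasDerivWithinAt_const ..) (fun r hr => (hL r (hs.trans hr.1)).2.2.le)
    (right_mem_Icc.2 hss)

/-- A causal ray that stays in a compact set has an endpoint. -/
lemma IsCausalRay.exists_tendsto [T2Space S] (h : IsCausalRay 𝓜 ε γ) (hε : |ε| = 1)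
    {R : Set (ℝ × S)} (hR : IsCompact R) (hγ : ∀ s, 0 ≤ s → γ s ∈ R) :
    ∃ q, Tendsto γ atTop (𝓝 q) := by
  obtain ⟨q, -, hq⟩ := hR.exists_mapClusterPt (f := atTop) (u := γ)
    (le_principal_iff.2 (mem_map.2 (mem_of_superset (Ici_mem_atTop 0) hγ)))
  refine ⟨q, ?_⟩
  rw [mapClusterPt_iff_frequently] at hq
  -- `ε τ` decreases along the ray and clusters at its value at `q`, so it never drops below that
  -- value.
  have hT : ∀ s, 0 ≤ s → ε * q.1 ≤ ε * (γ s).1 := fun s hs => by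
    by_contra! hlt
    have ho : {p : ℝ × S | ε * (γ s).1 < ε * p.1} ∈ 𝓝 q :=
      (isOpen_lt continuous_const (continuous_const.mul continuous_fst)).mem_nhds hlt
    obtain ⟨s', h1, h2⟩ := ((hq _ ho).and_eventually (eventually_ge_atTop s)).exists
    exact absurd (h.time_antitone hs h2) (not_le.2 h1)
  obtain ⟨r₀, hr0, C, hC, hball, hcone⟩ := exists_cone_bound 𝓜 q
  set e := extChartAt (ambientModel m) q with he
  have hsrc : e.source ∈ 𝓝 q := extChartAt_source_mem_nhds q
  have hce : ContinuousOn e e.source := continuousOn_extChartAt q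
  have hces : ContinuousOn e.symm e.target := continuousOn_extChartAt_symm q
  have hbasis : ∀ U ∈ 𝓝 q, ∃ r, 0 < r ∧ r ≤ r₀ ∧ e.symm '' Metric.closedBall (e q) r ⊆ U := by
    intro U hU
    have h1 : Tendsto e.symm (𝓝 (e q)) (𝓝 q) := by
      have h2 := continuousAt_extChartAt_symm (I := ambientModel m) q
      rwa [ContinuousAt, extChartAt_to_inv] at h2
    obtain ⟨r, hr, hrU⟩ := Metric.nhds_basis_closedBall.mem_iff.1 (h1 hU)
    refine ⟨min r r₀, lt_min hr hr0, min_le_right _ _, ?_⟩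
    rintro _ ⟨z, hz, rfl⟩
    exact hrU (Metric.closedBall_subset_closedBall (min_le_left _ _) hz)
  intro U hU
  obtain ⟨r, hr, hrr, hrU⟩ := hbasis U hU
  have hrt : Metric.closedBall (e q) r ⊆ e.target :=
    (Metric.closedBall_subset_closedBall hrr).trans hball
  set W := e.symm '' Metric.closedBall (e q) r with hW
  have hWc : IsCompact W := (isCompact_closedBall (e q) r).image_of_continuousOn (hces.mono hrt)
  have hWs : W ⊆ e.source := by
    rintro _ ⟨z, hz, rfl⟩
    exact e.map_target (hrt hz)
  have hmemW : ∀ p ∈ e.source, ‖e p - e q‖ ≤ r → p ∈ W := fun p hp hpr =>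
    ⟨e p, mem_closedBall_iff_norm.2 hpr, e.left_inv hp⟩
  obtain ⟨s₀, ⟨hs1, hs2, hs3⟩, hs0⟩ : ∃ s₀, (γ s₀ ∈ e.source ∧ ‖e (γ s₀) - e q‖ < r / 2 ∧
      (C + 1) * (ε * (γ s₀).1 - ε * q.1) < r / 2) ∧ 0 ≤ s₀ := by
    have h1 : ∀ᶠ p in 𝓝 q, p ∈ e.source ∧ ‖e p - e q‖ < r / 2 ∧
        (C + 1) * (ε * p.1 - ε * q.1) < r / 2 := by
      have hc1 : ContinuousAt (fun p => ‖e p - e q‖) q :=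
        ((continuousAt_extChartAt q).sub continuousAt_const).norm
      have hc2 : ContinuousAt (fun p : ℝ × S => (C + 1) * (ε * p.1 - ε * q.1)) q :=
        (continuous_const.mul ((continuous_const.mul continuous_fst).sub
          continuous_const)).continuousAt
      refine Filter.Eventually.and hsrc (Filter.Eventually.and (hc1.eventually_lt_const ?_)
        (hc2.eventually_lt_const ?_))
      · simpa using half_pos hr
      · simpa using half_pos hr
    exact ((hq _ h1).and_eventually (eventually_ge_atTop 0)).exists
  -- Points of the neighbourhood whose displacement from `γ s₀` is bounded by elapsed time.
  -- Continuous induction keeps the ray in this closed set.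
  set B : Set (ℝ × S) := {p | p ∈ W ∧ ‖e p - e (γ s₀)‖ ≤ (C + 1) * (ε * (γ s₀).1 - ε * p.1)} with hB
  have hBc : IsClosed B := by
    have h1 : B = W ∩ (fun p => (C + 1) * (ε * (γ s₀).1 - ε * p.1) - ‖e p - e (γ s₀)‖) ⁻¹' Ici 0 := by
      ext p
      simp only [hB, mem_setOf_eq, mem_inter_iff, mem_preimage, mem_Ici, sub_nonneg]
    rw [h1]
    refine ContinuousOn.preimage_isClosed_of_isClosed ?_ hWc.isClosed isClosed_Ici
    exact (continuous_const.mul (continuous_const.sub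
      (continuous_const.mul continuous_fst))).continuousOn.sub
      ((hce.mono hWs).sub continuousOn_const).norm
  have hs2' : ‖e (γ s₀) - e q‖ ≤ r := hs2.le.trans (by linarith)
  have hmain : ∀ b, Icc s₀ b ⊆ γ ⁻¹' B := fun b => by
    refine IsClosed.Icc_subset_of_forall_mem_nhdsWithin ?_
      ⟨hmemW _ hs1 hs2', by simp⟩ fun s hs => ?_
    · rw [inter_comm]
      exact ((h.continuousOn b).mono (Icc_subset_Icc_left hs0)).preimage_isClosed_of_isClosed
        isClosed_Icc hBc
    · obtain ⟨⟨hsW, hsB⟩, hsI⟩ := hs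
      have hs00 : 0 ≤ s := hs0.trans hsI.1
      have hss := hWs hsW
      obtain ⟨L, hL, hL1, hL2⟩ := h.velocity s hs00
      obtain ⟨a, ha, haL⟩ := hasDerivWithinAt_chart (q := q) hL hss
      have hzt : e (γ s) ∈ Metric.closedBall (e q) r₀ := by
        obtain ⟨z, hz, hz2⟩ := hsW
        rw [← hz2, e.right_inv (hrt hz)]
        exact Metric.closedBall_subset_closedBall hrr hz
      have ha1 : a.1 = (L 1).1 := by rw [← haL, ambientSymmDeriv_fst q (hball hzt)]
      have hac : ‖a‖ ≤ C * |a.1| := by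
        refine hcone _ hzt a ?_
        have h1 : e.symm (e (γ s)) = γ s := e.left_inv hss
        rw [ambientForm_eq]
        change metricAt 𝓜 (e.symm (e (γ s))) (ambientSymmDeriv q (e (γ s)) a)
          (ambientSymmDeriv q (e (γ s)) a) ≤ 0
        rw [haL, h1]
        exact hL1
      have hab : |a.1| = -(ε * (L 1).1) := by
        rw [← abs_of_neg hL2, abs_mul, hε, one_mul, ha1]
      have hlt : ‖e (γ s) - e q‖ < r := by
        have h1 := norm_add_le (e (γ s) - e (γ s₀)) (e (γ s₀) - e q)
        rw [sub_add_sub_cancel] at h1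
        have h2 := mul_le_mul_of_nonneg_left (hT s hs00) (by linarith : 0 ≤ C + 1)
        nlinarith
      have hcγ : Tendsto γ (𝓝[>] s) (𝓝 (γ s)) :=
        (hL.continuousWithinAt).mono_left (nhdsWithin_mono _ Ioi_subset_Ici_self)
      have hW' : ∀ᶠ s' in 𝓝[>] s, γ s' ∈ W := by
        have h1 : ∀ᶠ p in 𝓝 (γ s), p ∈ e.source ∧ ‖e p - e q‖ < r := by
          have hc1 : ContinuousAt (fun p => ‖e p - e q‖) (γ s) :=
            ((continuousAt_extChartAt' hss).sub continuousAt_const).norm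
          exact Filter.Eventually.and ((isOpen_extChartAt_source q).mem_nhds hss)
            (hc1.eventually_lt_const hlt)
        filter_upwards [hcγ.eventually h1] with s' hs'
        exact hmemW _ hs'.1 hs'.2.le
      have hsl1 : Tendsto (slope (fun r => e (γ r)) s) (𝓝[>] s) (𝓝 a) :=
        (hasDerivWithinAt_iff_tendsto_slope' (by simp)).1 (ha.mono Ioi_subset_Ici_self)
      have hsl2 : Tendsto (slope (fun r => (γ r).1) s) (𝓝[>] s) (𝓝 (L 1).1) :=
        (hasDerivWithinAt_iff_tendsto_slope' (by simp)).1
          ((hasDerivWithinAt_time hL).mono Ioi_subset_Ici_self)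
      -- Taking `C + 1` instead of `C` makes the speed bound strict, since the time speed is
      -- nonzero; it then passes from the derivative to difference quotients just after `s`.
      have hltC : ‖a‖ < (C + 1) * -(ε * (L 1).1) := by
        rw [hab] at hac
        nlinarith
      have hev := hsl1.norm.eventually_lt (((hsl2.const_mul ε).neg).const_mul (C + 1)) hltC
      filter_upwards [hev, hW', self_mem_nhdsWithin] with s' h1 h2 h3
      refine ⟨h2, ?_⟩
      have hpos : 0 < s' - s := sub_pos.2 h3
      rw [slope_def_module, slope_def_module, norm_smul, norm_inv, Real.norm_of_nonneg hpos.le,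
        smul_eq_mul] at h1
      have h4 : ‖e (γ s') - e (γ s)‖ ≤ (C + 1) * (ε * (γ s).1 - ε * (γ s').1) := by
        have h5 := mul_lt_mul_of_pos_left h1 hpos
        field_simp at h5
        linarith
      have h6 := norm_add_le (e (γ s') - e (γ s)) (e (γ s) - e (γ s₀))
      rw [sub_add_sub_cancel] at h6
      calc ‖e (γ s') - e (γ s₀)‖ ≤ _ := h6
        _ ≤ _ := add_le_add h4 hsB
        _ = _ := by ring
  refine mem_map.2 (mem_of_superset (Ici_mem_atTop s₀) fun s hs => hrU ?_)
  exact (hmain s ⟨hs, le_rfl⟩).1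

end CausalCurves

/-! ## Height bounds for admissible functions -/

section HeightBound

variable {m : ℕ} [NeZero m] {S : Type*} [TopologicalSpace S]
  [ChartedSpace (EuclideanSpace ℝ (Fin m)) S] [IsManifold (𝓡 m) ∞ S] {𝓜 : SplitSpacetime m S}
  {Sig : Type*} [TopologicalSpace Sig] [ChartedSpace (EuclideanHalfSpace m) Sig]
  [IsManifold (𝓡∂ m) ∞ Sig] {ι : Sig → ℝ × S}

local notation "E" => EuclideanSpace ℝ (Fin m)

lemma hasStrictFDerivAt_projection (hι : 𝓜.IsSmoothSpacelikeHypersurface ι) {x : Sig}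
    (hx : x ∈ (𝓡∂ m).interior Sig) : HasStrictFDerivAt
      (writtenInExtChartAt (𝓡∂ m) (𝓡 m) x (fun z => (ι z).2)) (projDeriv ι x)
      (extChartAt (𝓡∂ m) x x) := by
  have h1 := (contMDiff_snd_comp hι).contMDiffAt (x := x)
  have h2 : range (𝓡∂ m) ∈ 𝓝 (extChartAt (𝓡∂ m) x x) :=
    mem_interior_iff_mem_nhds.1 (extChartAt_mem_interior_range (m := m) hx)
  have h3 := (contMDiffAt_iff.1 h1).2.contDiffAt h2
  have h4 := h3.hasStrictFDerivAt (by simp)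
  have h5 : projDeriv ι x = fderiv ℝ (writtenInExtChartAt (𝓡∂ m) (𝓡 m) x (fun z => (ι z).2))
      (extChartAt (𝓡∂ m) x x) := by
    have h6 := (h1.mdifferentiableAt (by simp)).mfderiv
    rw [fderivWithin_of_mem_nhds h2] at h6
    exact h6
  rw [h5]
  exact h4

lemma hasFDerivAt_comp_symm {u : Sig → ℝ} (hu : ContMDiff (𝓡∂ m) 𝓘(ℝ, ℝ) ∞ u) {x : Sig}
    (hx : x ∈ (𝓡∂ m).interior Sig) : HasFDerivAt (u ∘ (extChartAt (𝓡∂ m) x).symm)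
      (differential u x) (extChartAt (𝓡∂ m) x x) := by
  have h2 : range (𝓡∂ m) ∈ 𝓝 (extChartAt (𝓡∂ m) x x) :=
    mem_interior_iff_mem_nhds.1 (extChartAt_mem_interior_range (m := m) hx)
  have h1 := ((hu.contMDiffAt (x := x)).mdifferentiableAt (by simp)).hasMFDerivAt.2
  exact h1.hasFDerivAt h2

lemma exists_equiv_projDeriv (hι : 𝓜.IsSmoothSpacelikeHypersurface ι) (x : Sig) :
    ∃ e : E ≃L[ℝ] E, (e : E →L[ℝ] E) = projDeriv ι x :=
  ⟨(LinearEquiv.ofBijective ((projDeriv ι x : E →L[ℝ] E) : E →ₗ[ℝ] E)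
    ⟨projDeriv_injective hι x, projDeriv_surjective hι x⟩).toContinuousLinearEquiv, by ext; rfl⟩

/-- A curve in `ℝ × S` that passes over an interior point of `Σ` lifts to a curve in `Σ`. -/
lemma exists_lift (hι : 𝓜.IsSmoothSpacelikeHypersurface ι) {γ : ℝ → ℝ × S} {s : ℝ}
    {L : ℝ →L[ℝ] ℝ × E} (hL : HasMFDerivWithinAt 𝓘(ℝ, ℝ) (ambientModel m) γ (Ici s) s L)
    {x : Sig} (hx : x ∈ (𝓡∂ m).interior Sig) (hxs : (ι x).2 = (γ s).2) :
    ∃ (Z : ℝ → Sig) (b : E), Z s = x ∧ projDeriv ι x b = (L 1).2 ∧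
      (∀ᶠ r in 𝓝[≥] s, (ι (Z r)).2 = (γ r).2) ∧
      ∀ u : Sig → ℝ, ContMDiff (𝓡∂ m) 𝓘(ℝ, ℝ) ∞ u →
        HasDerivWithinAt (fun r => u (Z r)) (differential u x b) (Ici s) s := by
  obtain ⟨A, hA⟩ := exists_equiv_projDeriv hι x
  have hP := hasStrictFDerivAt_projection hι hx
  rw [← hA] at hP
  set P := writtenInExtChartAt (𝓡∂ m) (𝓡 m) x (fun z => (ι z).2) with hPdef
  set y := extChartAt (𝓡∂ m) x x with hy
  set e := extChartAt (𝓡 m) (ι x).2 with he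
  have hPy : P y = e (ι x).2 := by
    simp only [hPdef, hy, writtenInExtChartAt, Function.comp, extChartAt_to_inv, he]
  obtain ⟨a, ha, haL⟩ := hasDerivWithinAt_chart (q := γ s) hL (mem_extChartAt_source (γ s))
  rw [ambientSymmDeriv_self] at haL
  change a = L 1 at haL
  subst haL
  have hc : HasDerivWithinAt (fun r => e (γ r).2) (L 1).2 (Ici s) s := by
    have h1 := (hasFDerivAt_snd (𝕜 := ℝ) (p := extChartAt (ambientModel m) (γ s) (γ s)
      )).comp_hasDerivWithinAt s ha
    have h2 : (Prod.snd ∘ fun r => extChartAt (ambientModel m) (γ s) (γ r) : ℝ → E) =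
        fun r => e (γ r).2 := by
      funext r
      rw [he, hxs, extChartAt_prod]
      rfl
    rw [h2] at h1
    exact h1
  -- The inverse function theorem for `π ∘ ι` at an interior point; the lift is the local inverse
  -- applied to the spatial part of the curve.
  have hloc := hP.to_localInverse.hasFDerivAt
  set loc := hP.localInverse P A y with hlocdef
  have hlocy : loc (P y) = y := hP.localInverse_apply_image
  have hcs : e (γ s).2 = P y := by rw [hPy, hxs]
  have hw : HasDerivWithinAt (fun r => loc (e (γ r).2)) (A.symm (L 1).2) (Ici s) s := by
    rw [← hcs] at hloc
    exact hloc.comp_hasDerivWithinAt s hc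
  have hws : loc (e (γ s).2) = y := by rw [hcs, hlocy]
  refine ⟨fun r => (extChartAt (𝓡∂ m) x).symm (loc (e (γ r).2)), A.symm (L 1).2, ?_, ?_, ?_, ?_⟩
  · change (extChartAt (𝓡∂ m) x).symm (loc (e (γ s).2)) = x
    rw [hws, hy, extChartAt_to_inv]
  · rw [← hA]; exact A.apply_symm_apply _
  · have hr1 : ∀ᶠ r in 𝓝[≥] s, P (loc (e (γ r).2)) = e (γ r).2 := by
      have h1 := hP.eventually_right_inverse
      rw [← hcs] at h1
      exact hc.continuousWithinAt.tendsto.eventually h1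
    have hr2 : ∀ᶠ r in 𝓝[≥] s, (γ r).2 ∈ e.source := by
      have h1 : e.source ∈ 𝓝 (γ s).2 := by
        rw [← hxs]; exact extChartAt_source_mem_nhds _
      exact (continuous_snd.continuousAt.comp_continuousWithinAt
        hL.continuousWithinAt).tendsto.eventually h1
    have hr3 : ∀ᶠ r in 𝓝[≥] s,
        (ι ((extChartAt (𝓡∂ m) x).symm (loc (e (γ r).2)))).2 ∈ e.source := by
      have h1 : ContinuousAt (fun w => (ι ((extChartAt (𝓡∂ m) x).symm w)).2) y := by
        have h2 := (contMDiff_snd_comp hι).continuous.continuousAt.comp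
          (continuousAt_extChartAt_symm (I := 𝓡∂ m) x)
        exact h2
      have h2 : (fun w => (ι ((extChartAt (𝓡∂ m) x).symm w)).2) ⁻¹' e.source ∈ 𝓝 y := by
        refine h1.preimage_mem_nhds ?_
        simp only [hy, extChartAt_to_inv]
        exact extChartAt_source_mem_nhds _
      rw [← hws] at h2
      exact hw.continuousWithinAt.tendsto.eventually h2
    filter_upwards [hr1, hr2, hr3] with r h1 h2 h3
    refine e.injOn h3 h2 ?_
    exact h1
  · intro u hu
    have h1 := hasFDerivAt_comp_symm hu hx
    rw [← hy, ← hws] at h1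
    exact h1.comp_hasDerivWithinAt s hw

/-- The compact region between the graphs of `φ` and of `u`. -/
def heightRegion (ε : ℝ) (ι : Sig → ℝ × S) (u : Sig → ℝ) : Set (ℝ × S) :=
  {p | ∃ x, (ι x).2 = p.2 ∧ ε * (ι x).1 ≤ ε * p.1 ∧ ε * p.1 ≤ ε * u x}

/-- Interpolate linearly between `φ` and `u` over those `x` where the two have the right order; the
region is the continuous image of a compact subset of `[0, 1] × Σ`. Global injectivity of `π ∘ ι`
plays no role. -/
lemma isCompact_heightRegion [CompactSpace Sig] (hι : 𝓜.IsSmoothSpacelikeHypersurface ι)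
    {u : Sig → ℝ} (hu : Continuous u) {ε : ℝ} (hε : |ε| = 1) :
    IsCompact (heightRegion ε ι u) := by
  have hic : Continuous ι := hι.contMDiff.continuous
  set f : ℝ × Sig → ℝ × S := fun p =>
    ((1 - p.1) * (ι p.2).1 + p.1 * u p.2, (ι p.2).2) with hf
  have hfc : Continuous f := (((continuous_const.sub continuous_fst).mul
    (continuous_fst.comp (hic.comp continuous_snd))).add
    (continuous_fst.mul (hu.comp continuous_snd))).prodMk
    (continuous_snd.comp (hic.comp continuous_snd))
  set R : Set (ℝ × Sig) := {p | p.1 ∈ Icc (0 : ℝ) 1 ∧ ε * (ι p.2).1 ≤ ε * u p.2} with hR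
  have hRc : IsCompact R := by
    refine (isCompact_Icc (a := (0 : ℝ)) (b := 1)).prod (isCompact_univ (X := Sig))
      |>.of_isClosed_subset ?_ fun p hp => ⟨hp.1, mem_univ _⟩
    exact (isClosed_Icc.preimage continuous_fst).inter (isClosed_le
      (continuous_const.mul (continuous_fst.comp (hic.comp continuous_snd)))
      (continuous_const.mul (hu.comp continuous_snd)))
  have hεε : ε * ε = 1 := by rw [← abs_mul_abs_self, hε, one_mul]
  convert hRc.image hfc using 1
  ext p
  constructor
  · rintro ⟨x, hx, h1, h2⟩
    -- When `u` and `φ` agree at `x` the interpolation parameter is not determined, and `0` is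
    -- taken.
    rcases eq_or_ne (ι x).1 (u x) with h3 | h3
    · refine ⟨(0, x), ⟨⟨le_rfl, zero_le_one⟩, h1.trans h2⟩, Prod.ext ?_ hx⟩
      have h4 : ε * p.1 = ε * (ι x).1 := le_antisymm (h3 ▸ h2) h1
      have h5 : p.1 = (ι x).1 := by
        have := congrArg (ε * ·) h4
        simp only [← mul_assoc, hεε, one_mul] at this
        exact this
      simp [hf, h5]
    · have h4 : 0 < ε * u x - ε * (ι x).1 := by
        refine sub_pos.2 (lt_of_le_of_ne (h1.trans h2) fun h => h3 ?_)
        have := congrArg (ε * ·) h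
        simp only [← mul_assoc, hεε, one_mul] at this
        exact this
      refine ⟨((ε * p.1 - ε * (ι x).1) / (ε * u x - ε * (ι x).1), x),
        ⟨⟨div_nonneg (by linarith) h4.le, (div_le_one h4).2 (by linarith)⟩, h1.trans h2⟩,
        Prod.ext ?_ hx⟩
      have h6 : u x - (ι x).1 ≠ 0 := sub_ne_zero.2 (Ne.symm h3)
      have h7 : ε ≠ 0 := fun h => by rw [h] at hεε; norm_num at hεε
      simp only [hf, ← mul_sub]
      field_simp
      ring
  · rintro ⟨⟨r, x⟩, ⟨⟨hr0, hr1⟩, h⟩, rfl⟩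
    refine ⟨x, rfl, ?_, ?_⟩
    · simp only [hf]; simp only at h hr0 hr1; nlinarith [mul_le_mul_of_nonneg_left h hr0]
    · simp only [hf]; simp only at h hr0 hr1
      nlinarith [mul_le_mul_of_nonneg_left h (sub_nonneg.2 hr1)]

/-- A causal ray that starts between `Σ` and the graph of `u` stays there as long as it does not
meet `Σ`. -/
lemma IsCausalRay.mem_heightRegion [CompactSpace Sig] [T2Space S]
    (hι : 𝓜.IsSmoothSpacelikeHypersurface ι) {u : Sig → ℝ}
    (hu : ContMDiff (𝓡∂ m) 𝓘(ℝ, ℝ) ∞ u) (hq : ∀ x, slopeSq 𝓜 ι u x < 1)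
    (hb : ∀ x ∈ (𝓡∂ m).boundary Sig, u x = SplitSpacetime.height ι x) {ε : ℝ} (hε : |ε| = 1) {γ : ℝ → ℝ × S}
    (h : IsCausalRay 𝓜 ε γ) (h0 : γ 0 ∈ heightRegion ε ι u) (hne : ∀ s, 0 ≤ s → γ s ∉ range ι)
    {b : ℝ} (hb0 : 0 ≤ b) : γ b ∈ heightRegion ε ι u := by
  refine (IsClosed.Icc_subset_of_forall_mem_nhdsWithin (s := γ ⁻¹' heightRegion ε ι u)
    (a := 0) (b := b) ?_ h0 fun s hs => ?_) ⟨hb0, le_rfl⟩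
  · rw [inter_comm]
    exact (h.continuousOn b).preimage_isClosed_of_isClosed isClosed_Icc
      (isCompact_heightRegion hι hu.continuous hε).isClosed
  · obtain ⟨⟨x, hx, h1, h2⟩, hsI⟩ := hs
    obtain ⟨L, hL, hL1, hL2⟩ := h.velocity s hsI.1
    have hεε : ε * ε = 1 := by rw [← abs_mul_abs_self, hε, one_mul]
    have hinj : ∀ {c d : ℝ}, ε * c = ε * d → c = d := fun {c d} hcd => by
      have := congrArg (ε * ·) hcd
      simp only [← mul_assoc, hεε, one_mul] at this
      exact this
    -- Equality would put the ray on `Σ`. The strict inequality also excludes boundary points, where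
    -- the graph of `u` and `Σ` coincide, so the ray can be lifted.
    have h1' : ε * (ι x).1 < ε * (γ s).1 := lt_of_le_of_ne h1 fun heq =>
      hne s hsI.1 ⟨x, Prod.ext (hinj heq) hx⟩
    have hxi : x ∈ (𝓡∂ m).interior Sig := by
      by_contra hcon
      have hxb : x ∈ (𝓡∂ m).boundary Sig := by
        rw [← ModelWithCorners.compl_interior]; exact hcon
      have h3 : u x = (ι x).1 := hb x hxb
      rw [h3] at h2
      exact absurd h2 (not_le.2 h1')
    obtain ⟨Z, v, hZs, hv, hZ, hZu⟩ := exists_lift hι hL hxi hx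
    have hτ := hasDerivWithinAt_time hL
    have hlow : ∀ᶠ r in 𝓝[>] s, ε * (ι (Z r)).1 < ε * (γ r).1 := by
      have hc := (hZu _ (contMDiff_height hι)).continuousWithinAt.tendsto.const_mul ε
      have h3 := hc.eventually_lt (hτ.continuousWithinAt.tendsto.const_mul ε)
        (by rw [hZs]; exact h1')
      exact nhdsWithin_mono _ Ioi_subset_Ici_self h3
    have hupp : ∀ᶠ r in 𝓝[>] s, ε * (γ r).1 ≤ ε * u (Z r) := by
      rcases lt_or_eq_of_le h2 with h3 | h3
      · have hc := (hZu u hu).continuousWithinAt.tendsto.const_mul ε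
        have h4 := (hτ.continuousWithinAt.tendsto.const_mul ε).eventually_lt hc
          (by rw [hZs]; exact h3)
        filter_upwards [nhdsWithin_mono _ Ioi_subset_Ici_self h4] with r hr using hr.le
      · have hu1 : (γ s).1 = u x := hinj h3
        have hγs : γ s = (u x, (ι x).2) := Prod.ext hu1 hx.symm
        -- At a point of the graph, `du(v)² ≤ |du|² |v|² < dτ(L)²`, because the velocity is causal
        -- and the graph strictly spacelike. The ray's time thus moves away from the graph towards
        -- `Σ`, however `u` varies below it.
        have hlt : ε * (L 1).1 < ε * differential u x v := by
          have hI := isInner_spatialForm hι (u x) x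
          have h4 : spatialForm 𝓜 ι (u x) x v v = spatialAt 𝓜 (u x, (ι x).2) (L 1).2 (L 1).2 := by
            rw [← hv]; rfl
          have h5 := hI.sq_le (differential u x) v
          have h6 : spatialForm 𝓜 ι (u x) x v v ≤ (L 1).1 ^ 2 := by
            rw [hγs, metricAt_apply] at hL1
            have h7 := 𝓜.lapse_pos (u x, (ι x).2)
            have h8 := nonpos_of_mul_nonpos_right hL1 (by positivity)
            rw [h4]; linarith
          have h7 : (differential u x v) ^ 2 ≤ slopeSq 𝓜 ι u x * spatialForm 𝓜 ι (u x) x v v := h5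
          have h8 := slopeSq_nonneg hι u x
          have hL0 : 0 < (L 1).1 ^ 2 := by
            have : (L 1).1 ≠ 0 := fun h => by rw [h, mul_zero] at hL2; exact lt_irrefl _ hL2
            positivity
          have h9 : (differential u x v) ^ 2 < (L 1).1 ^ 2 := by
            have := hq x
            nlinarith [hI.nonneg v]
          have h10 := sq_lt_sq.1 h9
          have h11 : |ε * differential u x v| < -(ε * (L 1).1) := by
            rw [← abs_of_neg hL2, abs_mul, abs_mul, hε, one_mul, one_mul]; exact h10
          linarith [(abs_lt.1 h11).1]
        have hd := ((hτ.const_mul ε).sub ((hZu u hu).const_mul ε)).mono Ioi_subset_Ici_self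
        have hsl := (hasDerivWithinAt_iff_tendsto_slope' (by simp)).1 hd
        filter_upwards [hsl.eventually_lt_const (sub_neg.2 hlt), self_mem_nhdsWithin] with r hr hsr
        have hpos : 0 < r - s := sub_pos.2 hsr
        rw [slope_def_field, div_lt_iff₀ hpos, zero_mul] at hr
        simp only [Pi.sub_apply, hZs, h3] at hr
        linarith
    have hZ' := nhdsWithin_mono _ Ioi_subset_Ici_self hZ
    change ∀ᶠ r in 𝓝[>] s, γ r ∈ heightRegion ε ι u
    filter_upwards [hlow, hupp, hZ'] with r h3 h4 h5
    exact ⟨Z r, h5, h3.le, h4⟩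

/-- Each admissible graph lies in the Cauchy development of `Σ`. -/
lemma graphMap_mem_cauchyDevelopment [CompactSpace Sig] [T2Space S]
    (hι : 𝓜.IsSmoothSpacelikeHypersurface ι) {u : Sig → ℝ}
    (hu : ContMDiff (𝓡∂ m) 𝓘(ℝ, ℝ) ∞ u) (hq : ∀ x, slopeSq 𝓜 ι u x < 1)
    (hb : ∀ x ∈ (𝓡∂ m).boundary Sig, u x = SplitSpacetime.height ι x) (x : Sig) :
    SplitSpacetime.graphMap ι u x ∈ 𝓜.cauchyDevelopment (range ι) := by
  have key : ∀ (ε : ℝ), |ε| = 1 → ∀ γ, IsCausalRay 𝓜 ε γ → (¬ ∃ q, Tendsto γ atTop (𝓝 q)) →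
      γ 0 = SplitSpacetime.graphMap ι u x → ε * (ι x).1 ≤ ε * u x →
      ∃ s, 0 ≤ s ∧ γ s ∈ range ι := by
    intro ε hε γ h hγ h0 hle
    by_contra! hne
    -- A ray that misses `Σ` is trapped in a compact region and acquires an endpoint, contrary to
    -- inextendibility.
    refine hγ (h.exists_tendsto hε (isCompact_heightRegion hι hu.continuous hε) fun s hs =>
      h.mem_heightRegion hι hu hq hb hε ?_ hne hs)
    rw [h0]
    exact ⟨x, rfl, hle, le_rfl⟩
  rcases le_total (ι x).1 (u x) with hle | hle
  · left
    intro γ hγ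
    exact key 1 (by simp) γ (isCausalRay_of_past hγ) hγ.2.2 hγ.1 (by linarith)
  · right
    intro γ hγ
    exact key (-1) (by simp) γ (isCausalRay_of_future hγ) hγ.2.2 hγ.1 (by linarith)

/-- All admissible graphs lie in one relatively compact set, on which the time function is bounded.
This makes the later constants independent of `u`. -/
lemma exists_height_bound [CompactSpace Sig] [T2Space S]
    (hι : 𝓜.IsSmoothSpacelikeHypersurface ι)
    (hC : IsCompact (closure (𝓜.cauchyDevelopment (range ι)))) :
    ∃ a b : ℝ, ∀ u : Sig → ℝ, ContMDiff (𝓡∂ m) 𝓘(ℝ, ℝ) ∞ u → (∀ x, slopeSq 𝓜 ι u x < 1) →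
      (∀ x ∈ (𝓡∂ m).boundary Sig, u x = SplitSpacetime.height ι x) → ∀ x, u x ∈ Icc a b := by
  obtain ⟨a, ha⟩ := (hC.image continuous_fst).bddBelow
  obtain ⟨b, hb⟩ := (hC.image continuous_fst).bddAbove
  refine ⟨a, b, fun u hu hq hub x => ?_⟩
  have h := mem_image_of_mem Prod.fst
    (subset_closure (graphMap_mem_cauchyDevelopment hι hu hq hub x))
  exact ⟨ha h, hb h⟩

end HeightBound

/-! ## Uniform bounds on compact time intervals -/

section NormSq

variable {m : ℕ} {S : Type*} [TopologicalSpace S]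
  [ChartedSpace (EuclideanSpace ℝ (Fin m)) S] [IsManifold (𝓡 m) ∞ S] {𝓜 : SplitSpacetime m S}
  {X : (p : ℝ × S) → TangentSpace (ambientModel m) p}

lemma continuous_g_self (hX : ContMDiff (ambientModel m) (ambientModel m).tangent ∞
      (fun p => (⟨p, X p⟩ : TangentBundle (ambientModel m) (ℝ × S)))) :
    Continuous fun p => 𝓜.g p (X p) (X p) := by
  have h2 := ContMDiff.clm_bundle_apply₂ (F₁ := ℝ × EuclideanSpace ℝ (Fin m)) (F₂ := ℝ × EuclideanSpace ℝ (Fin m)) (F₃ := ℝ)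
    (E₁ := fun p : ℝ × S => TangentSpace (ambientModel m) p)
    (E₂ := fun p : ℝ × S => TangentSpace (ambientModel m) p)
    (E₃ := Bundle.Trivial (ℝ × S) ℝ) 𝓜.contMDiff_g hX hX
  have h3 : ContMDiff (ambientModel m) 𝓘(ℝ, ℝ) ∞ fun p => 𝓜.g p (X p) (X p) := fun p =>
    ((Bundle.contMDiffAt_totalSpace (F := ℝ) (E := Bundle.Trivial (ℝ × S) ℝ)).1 (h2 p)).2
  exact h3.continuous

end NormSq

section Bounds

variable {m : ℕ} [NeZero m] {S : Type*} [TopologicalSpace S]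
  [ChartedSpace (EuclideanSpace ℝ (Fin m)) S] [IsManifold (𝓡 m) ∞ S] {𝓜 : SplitSpacetime m S}
  {Sig : Type*} [TopologicalSpace Sig] [ChartedSpace (EuclideanHalfSpace m) Sig]
  [IsManifold (𝓡∂ m) ∞ Sig] {ι : Sig → ℝ × S}

local notation "E" => EuclideanSpace ℝ (Fin m)

/-- Testing the spacelike condition of `Σ` on the gradient of `φ` gives `q² < q`; if the gradient is
zero, so is the slope. -/
lemma slopeSq_height_lt_one (hι : 𝓜.IsSmoothSpacelikeHypersurface ι) (x : Sig) :
    slopeSq 𝓜 ι (SplitSpacetime.height ι) x < 1 := by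
  by_cases h : spatialGrad 𝓜 ι (SplitSpacetime.height ι) x = 0
  · rw [slopeSq, h, map_zero]; exact one_pos
  · have h1 := sq_differential_height_lt hι x h
    have h2 : spatialForm 𝓜 ι (SplitSpacetime.height ι x) x
        (spatialGrad 𝓜 ι (SplitSpacetime.height ι) x)
        (spatialGrad 𝓜 ι (SplitSpacetime.height ι) x) =
        slopeSq 𝓜 ι (SplitSpacetime.height ι) x :=
      congrArg (fun T : E →L[ℝ] ℝ => T (spatialGrad 𝓜 ι (SplitSpacetime.height ι) x))
        ((isInner_spatialForm hι _ x).apply_sharp (differential (SplitSpacetime.height ι) x))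
    rw [h2] at h1
    change slopeSq 𝓜 ι (SplitSpacetime.height ι) x ^ 2 < _ at h1
    have h3 := slopeSq_nonneg hι (SplitSpacetime.height ι) x
    nlinarith

variable (𝓜 ι) in
/-- The square of the norm of `dφ` for the metric `σ` at time `t`. -/
def heightSlope (t : ℝ) (x : Sig) : ℝ :=
  differential (SplitSpacetime.height ι) x
    (sharp (spatialForm 𝓜 ι t x) (differential (SplitSpacetime.height ι) x))

lemma continuous_heightSlope (hι : 𝓜.IsSmoothSpacelikeHypersurface ι) :
    Continuous fun z : ℝ × Sig => heightSlope 𝓜 ι z.1 z.2 := by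
  refine continuous_iff_continuousAt.2 fun z₀ => ?_
  set e := extChartAt (𝓡∂ m) z₀.2 with he
  have hφ := (contMDiff_height hι).of_le (n := ∞) (m := 1) (by simp)
  have h1 : ContinuousOn (fun w : ℝ × E => hatDiff z₀.2 (SplitSpacetime.height ι) w.2
      (sharp (hatσ 𝓜 ι z₀.2 w) (hatDiff z₀.2 (SplitSpacetime.height ι) w.2)))
      (univ ×ˢ e.target) := by
    have hd : ContDiffOn ℝ 0 (fun w : ℝ × E => hatDiff z₀.2 (SplitSpacetime.height ι) w.2)
        (univ ×ˢ e.target) :=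
      (contDiffOn_hatDiff (n := 0) (k := 1) (by simp) (by simp) hφ).comp
        contDiff_snd.contDiffOn fun w hw => hw.2
    exact hd.continuousOn.clm_apply (fun w hw => (ContDiffWithinAt.sharp
      (((contDiffOn_hatσ hι) w hw).of_le (by simp)) (hd w hw)
      (isInner_hatσ hι hw.2)).continuousWithinAt)
  have h2 : ContinuousOn (fun z : ℝ × Sig => (z.1, e z.2)) (univ ×ˢ e.source) :=
    continuousOn_fst.prodMk ((continuousOn_extChartAt z₀.2).comp continuousOn_snd fun z hz => hz.2)
  have h3 := h1.comp h2 fun z hz => ⟨mem_univ _, e.map_source hz.2⟩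
  have hn : (univ ×ˢ e.source : Set (ℝ × Sig)) ∈ 𝓝 z₀ :=
    prod_mem_nhds univ_mem (extChartAt_source_mem_nhds z₀.2)
  refine (h3.continuousAt hn).congr ?_
  filter_upwards [hn] with z hz
  have hy : e z.2 ∈ e.target := e.map_source hz.2
  have hx : e.symm (e z.2) = z.2 := e.left_inv hz.2
  have h4 := (isInner_spatialForm hι z.1 (e.symm (e z.2))).apply_sharp_pullForm
    (symmDeriv_isInvertible hy) (differential (SplitSpacetime.height ι) (e.symm (e z.2)))
  change hatDiff z₀.2 (SplitSpacetime.height ι) (e z.2)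
    (sharp (hatσ 𝓜 ι z₀.2 (z.1, e z.2)) (hatDiff z₀.2 (SplitSpacetime.height ι) (e z.2))) = _
  rw [hatσ_eq_pullForm hι _ hy, hatDiff_eq hφ hy]
  refine (congrArg (differential (SplitSpacetime.height ι) (e.symm (e z.2))) h4).trans ?_
  rw [hx]
  rfl

/-- The height function is uniformly spacelike at times close to that of `Σ`. -/
lemma exists_heightSlope_near [CompactSpace Sig] (hι : 𝓜.IsSmoothSpacelikeHypersurface ι) :
    ∃ κ η : ℝ, 0 ≤ κ ∧ κ < 1 ∧ 0 < η ∧ ∀ t x, |t - SplitSpacetime.height ι x| ≤ η →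
      heightSlope 𝓜 ι t x ≤ κ ^ 2 := by
  have hc := continuous_heightSlope hι
  have hφ := (contMDiff_height hι).continuous
  have hc0 : Continuous fun x => heightSlope 𝓜 ι (SplitSpacetime.height ι x) x :=
    hc.comp (hφ.prodMk continuous_id)
  obtain ⟨q, hq0, hq1, hq⟩ : ∃ q : ℝ, 0 ≤ q ∧ q < 1 ∧
      ∀ x, heightSlope 𝓜 ι (SplitSpacetime.height ι x) x ≤ q := by
    rcases isEmpty_or_nonempty Sig with hE | hE
    · exact ⟨0, le_rfl, one_pos, fun x => (hE.false x).elim⟩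
    · obtain ⟨x, -, hx⟩ := isCompact_univ.exists_isMaxOn univ_nonempty hc0.continuousOn
      exact ⟨_, slopeSq_nonneg hι (SplitSpacetime.height ι) x, slopeSq_height_lt_one hι x,
        fun y => hx (mem_univ y)⟩
  -- The condition with the midpoint `(q + 1)/2` is open and holds at time offset zero over all of
  -- the compact `Σ`; the tube lemma makes the admissible offset uniform.
  have ho : IsOpen {z : ℝ × Sig | heightSlope 𝓜 ι (SplitSpacetime.height ι z.2 + z.1) z.2 <
      (q + 1) / 2} := by
    refine isOpen_lt ?_ continuous_const
    exact hc.comp (((hφ.comp continuous_snd).add continuous_fst).prodMk continuous_snd)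
  obtain ⟨U, V, hU, -, h0U, hV, hUV⟩ := generalized_tube_lemma (isCompact_singleton (x := (0 : ℝ)))
    (isCompact_univ (X := Sig)) ho (by
      rintro ⟨r, x⟩ ⟨hr, -⟩
      have hr : r = 0 := hr
      change heightSlope 𝓜 ι (SplitSpacetime.height ι x + r) x < _
      rw [hr, add_zero]
      have := hq x
      linarith)
  obtain ⟨η, hη, hηU⟩ := Metric.nhds_basis_closedBall.mem_iff.1
    (hU.mem_nhds (h0U (mem_singleton 0)))
  refine ⟨√((q + 1) / 2), η, Real.sqrt_nonneg _, ?_, hη, fun t x ht => ?_⟩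
  · rw [Real.sqrt_lt' one_pos]; linarith
  · have h1 : (t - SplitSpacetime.height ι x, x) ∈ U ×ˢ V :=
      ⟨hηU (by rw [mem_closedBall_zero_iff]; exact ht), hV (mem_univ x)⟩
    have h2 := hUV h1
    simp only [mem_setOf_eq, add_sub_cancel] at h2
    rw [Real.sq_sqrt (by linarith)]
    exact h2.le

lemma exists_heightSlope_bound [CompactSpace Sig] (hι : 𝓜.IsSmoothSpacelikeHypersurface ι)
    (a b : ℝ) : ∃ Λ : ℝ, 0 ≤ Λ ∧ ∀ t ∈ Icc a b, ∀ x, heightSlope 𝓜 ι t x ≤ Λ ^ 2 := by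
  obtain ⟨c, hc⟩ := ((isCompact_Icc (a := a) (b := b)).prod
    (isCompact_univ (X := Sig))).bddAbove_image (continuous_heightSlope hι).continuousOn
  -- The `1` guarantees that the square of the constant is at least `c`.
  refine ⟨max c 1, by positivity, fun t ht x => ?_⟩
  have h1 : heightSlope 𝓜 ι t x ≤ c := hc ⟨(t, x), ⟨ht, mem_univ x⟩, rfl⟩
  have h2 := le_max_left c 1
  have h3 := le_max_right c 1
  nlinarith

/-- Continuous functions on `ℝ × S` are bounded over `Σ`, on compact time intervals. -/
lemma exists_bound_over [CompactSpace Sig] (hι : 𝓜.IsSmoothSpacelikeHypersurface ι) {f : ℝ × S → ℝ}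
    (hf : Continuous f) (a b : ℝ) :
    ∃ c, 0 ≤ c ∧ ∀ t ∈ Icc a b, ∀ x, f (t, (ι x).2) ≤ c := by
  have hc : Continuous fun z : ℝ × Sig => f (z.1, (ι z.2).2) :=
    hf.comp (continuous_fst.prodMk ((contMDiff_snd_comp hι).continuous.comp continuous_snd))
  obtain ⟨c, hc⟩ := ((isCompact_Icc (a := a) (b := b)).prod
    (isCompact_univ (X := Sig))).bddAbove_image hc.continuousOn
  exact ⟨max c 0, le_max_right _ _, fun t ht x =>
    (hc ⟨(t, x), ⟨ht, mem_univ x⟩, rfl⟩).trans (le_max_left _ _)⟩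

lemma exists_lapse_bounds [CompactSpace Sig] (hι : 𝓜.IsSmoothSpacelikeHypersurface ι) (a b : ℝ) :
    ∃ α₀ α₁ : ℝ, 0 < α₀ ∧ 0 < α₁ ∧ ∀ t ∈ Icc a b, ∀ x,
      α₀ ≤ 𝓜.lapse (t, (ι x).2) ∧ 𝓜.lapse (t, (ι x).2) ≤ α₁ := by
  have hc := 𝓜.contMDiff_lapse.continuous
  obtain ⟨c, hc0, h1⟩ := exists_bound_over hι hc a b
  obtain ⟨d, hd0, h2⟩ := exists_bound_over hι (hc.inv₀ fun p => (𝓜.lapse_pos p).ne') a b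
  refine ⟨(d + 1)⁻¹, c + 1, by positivity, by positivity, fun t ht x => ⟨?_, ?_⟩⟩
  · refine inv_le_of_inv_le₀ (𝓜.lapse_pos _) ?_
    exact (h2 t ht x).trans (by linarith)
  · exact (h1 t ht x).trans (by linarith)

section VectorField

variable {X : (p : ℝ × S) → TangentSpace (ambientModel m) p}

/-- The time component of a vector field. -/
def timePart (X : (p : ℝ × S) → TangentSpace (ambientModel m) p) (p : ℝ × S) : ℝ := dτ (X p)

omit [NeZero m] in
lemma continuous_timePart (hX : ContMDiff (ambientModel m) (ambientModel m).tangent ∞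
      (fun p => (⟨p, X p⟩ : TangentBundle (ambientModel m) (ℝ × S)))) :
    Continuous (timePart X) := by
  have h1 : ContMDiff (ambientModel m) 𝓘(ℝ, ℝ) ∞ (Prod.fst : ℝ × S → ℝ) := contMDiff_fst
  have h2 := (h1.contMDiff_tangentMap (m := 0) (by simp)).continuous.comp hX.continuous
  have h3 := (tangentBundleModelSpaceHomeomorph 𝓘(ℝ, ℝ)).continuous.comp h2
  have h4 : Continuous fun p => (tangentBundleModelSpaceHomeomorph 𝓘(ℝ, ℝ)
      (tangentMap (ambientModel m) 𝓘(ℝ, ℝ) Prod.fst ⟨p, X p⟩)).2 := continuous_snd.comp h3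
  refine h4.congr fun p => ?_
  have h5 := (hasMFDerivAt_fst (I := 𝓘(ℝ, ℝ)) (I' := 𝓡 m) p).mfderiv
  exact congrArg (fun T : (ℝ × E) →L[ℝ] ℝ => T (X p)) h5

/-- A vector field has normal component at most a constant multiple of the tilt. -/
lemma exists_normal_component_bound [CompactSpace Sig]
    (hι : 𝓜.IsSmoothSpacelikeHypersurface ι)
    (hX : ContMDiff (ambientModel m) (ambientModel m).tangent ∞
      (fun p => (⟨p, X p⟩ : TangentBundle (ambientModel m) (ℝ × S)))) (a b : ℝ) :
    ∃ c, 0 ≤ c ∧ ∀ u : Sig → ℝ, ContMDiff (𝓡∂ m) 𝓘(ℝ, ℝ) ∞ u → ∀ x, slopeSq 𝓜 ι u x < 1 →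
      u x ∈ Icc a b →
      |𝓜.g (SplitSpacetime.graphMap ι u x) (X _) (𝓜.normal ι u x)| ≤ c * gammaFactor 𝓜 ι u x := by
  have hα := 𝓜.contMDiff_lapse.continuous
  have h1 := continuous_timePart hX
  -- The expression under the root is `σ(X, X)`, written through the metric and the time component,
  -- whose continuity is at hand.
  have hf : Continuous fun p => 𝓜.lapse p * (|timePart X p| +
      √(𝓜.g p (X p) (X p) / 𝓜.lapse p ^ 2 + timePart X p ^ 2)) :=
    hα.mul (h1.abs.add (((continuous_g_self hX).div (hα.pow 2) fun p =>
      pow_ne_zero 2 (𝓜.lapse_pos p).ne').add (h1.pow 2)).sqrt)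
  obtain ⟨c, hc, hb⟩ := exists_bound_over hι hf a b
  refine ⟨c, hc, fun u hu x hq hx => ?_⟩
  rw [normal_eq hι hu hq]
  have hb := hb _ hx x
  change (fun p => 𝓜.lapse p * (|timePart X p| +
      √(𝓜.g p (X p) (X p) / 𝓜.lapse p ^ 2 + timePart X p ^ 2)))
    (SplitSpacetime.graphMap ι u x) ≤ c at hb
  beta_reduce at hb
  set p := SplitSpacetime.graphMap ι u x with hp
  let v : ℝ × E := X p
  have hv : timePart X p = v.1 := rfl
  have hg : 𝓜.g p (X p) (X p) = 𝓜.lapse p ^ 2 * (-(v.1 * v.1) + spatialAt 𝓜 p v.2 v.2) :=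
    𝓜.g_eq p v v
  have hgn : 𝓜.g p (X p) (unitNormal 𝓜 ι u x) = 𝓜.lapse p ^ 2 * (-(v.1 * (unitNormal 𝓜 ι u x).1) +
    spatialAt 𝓜 p v.2 (unitNormal 𝓜 ι u x).2) := 𝓜.g_eq p v (unitNormal 𝓜 ι u x)
  have hα0 := 𝓜.lapse_pos p
  have hW := one_le_gammaFactor hι hq
  have e1 : (unitNormal 𝓜 ι u x).1 = gammaFactor 𝓜 ι u x / 𝓜.lapse p := by
    simp [unitNormal]; rfl
  have e2 : (unitNormal 𝓜 ι u x).2 = (gammaFactor 𝓜 ι u x / 𝓜.lapse p) •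
    projDeriv ι x (spatialGrad 𝓜 ι u x) := rfl
  have hI := isInner_σ 𝓜 p
  have hcs : (spatialAt 𝓜 p v.2 (projDeriv ι x (spatialGrad 𝓜 ι u x))) ^ 2 ≤
      spatialAt 𝓜 p v.2 v.2 * slopeSq 𝓜 ι u x := by
    have h3 : spatialAt 𝓜 p (projDeriv ι x (spatialGrad 𝓜 ι u x))
        (projDeriv ι x (spatialGrad 𝓜 ι u x)) = slopeSq 𝓜 ι u x :=
      congrArg (fun T : E →L[ℝ] ℝ => T (spatialGrad 𝓜 ι u x))
        ((isInner_spatialForm hι (u x) x).apply_sharp (differential u x))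
    rw [← h3]
    exact hI.cauchySchwarz _ _
  have hnn : 0 ≤ spatialAt 𝓜 p v.2 v.2 := hI.nonneg v.2
  have hcs2 : |spatialAt 𝓜 p v.2 (projDeriv ι x (spatialGrad 𝓜 ι u x))| ≤
      √(spatialAt 𝓜 p v.2 v.2) := by
    refine Real.abs_le_sqrt (hcs.trans ?_)
    exact mul_le_of_le_one_right hnn hq.le
  have hs : 𝓜.g p (X p) (X p) / 𝓜.lapse p ^ 2 + timePart X p ^ 2 = spatialAt 𝓜 p v.2 v.2 := by
    rw [hg, hv]; field_simp; ring
  rw [hs, hv] at hb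
  rw [hgn, e1, e2, map_smul, smul_eq_mul]
  have e3 : 𝓜.lapse p ^ 2 * (-(v.1 * (gammaFactor 𝓜 ι u x / 𝓜.lapse p)) +
      gammaFactor 𝓜 ι u x / 𝓜.lapse p *
        spatialAt 𝓜 p v.2 (projDeriv ι x (spatialGrad 𝓜 ι u x))) =
      𝓜.lapse p * gammaFactor 𝓜 ι u x *
        (-v.1 + spatialAt 𝓜 p v.2 (projDeriv ι x (spatialGrad 𝓜 ι u x))) := by
    field_simp
  rw [e3, abs_mul, abs_of_pos (by positivity)]
  have h5 : |-v.1 + spatialAt 𝓜 p v.2 (projDeriv ι x (spatialGrad 𝓜 ι u x))| ≤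
      |v.1| + √(spatialAt 𝓜 p v.2 v.2) :=
    (abs_add_le _ _).trans (by rw [abs_neg]; linarith)
  calc _ ≤ 𝓜.lapse p * gammaFactor 𝓜 ι u x * (|v.1| + √(spatialAt 𝓜 p v.2 v.2)) :=
        mul_le_mul_of_nonneg_left h5 (by positivity)
    _ = 𝓜.lapse p * (|v.1| + √(spatialAt 𝓜 p v.2 v.2)) * gammaFactor 𝓜 ι u x := by ring
    _ ≤ _ := mul_le_mul_of_nonneg_right hb (by linarith)

end VectorField

end Bounds

/-! ## The test function -/

section RealEstimates

/-- The square of the positive part, a function of class `C¹`. -/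
def posSq (s : ℝ) : ℝ := max s 0 ^ 2

lemma hasDerivAt_posSq (s : ℝ) : HasDerivAt posSq (2 * max s 0) s := by
  rcases lt_trichotomy s 0 with hs | rfl | hs
  · rw [max_eq_right hs.le, mul_zero]
    refine (hasDerivAt_const s (0 : ℝ)).congr_of_eventuallyEq ?_
    filter_upwards [gt_mem_nhds hs] with r hr
    simp [posSq, max_eq_right (show r ≤ 0 from le_of_lt hr)]
  · rw [max_self, mul_zero, hasDerivAt_iff_isLittleO_nhds_zero]
    have h1 : (fun h : ℝ => posSq (0 + h) - posSq 0 - h • (0 : ℝ)) =O[𝓝 0] fun h => h ^ 2 := by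
      refine Asymptotics.isBigO_of_le _ fun h => ?_
      simp only [posSq, zero_add, max_self, smul_eq_mul, mul_zero, sub_zero, ne_eq,
        OfNat.ofNat_ne_zero, not_false_eq_true, zero_pow, norm_pow]
      refine pow_le_pow_left₀ (norm_nonneg _) ?_ 2
      rcases le_total h 0 with h0 | h0
      · simp [max_eq_right h0]
      · simp [max_eq_left h0]
    refine h1.trans_isLittleO ?_
    simpa using Asymptotics.isLittleO_pow_pow (𝕜 := ℝ) (m := 1) (n := 2) (by norm_num)
  · rw [max_eq_left hs.le]
    have h2 : HasDerivAt (fun r : ℝ => r ^ 2) (2 * s) s := by simpa using hasDerivAt_pow 2 s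
    refine h2.congr_of_eventuallyEq ?_
    filter_upwards [lt_mem_nhds hs] with r hr
    simp [posSq, max_eq_left (show 0 ≤ r from le_of_lt hr)]

lemma contDiff_posSq : ContDiff ℝ 1 posSq := by
  refine contDiff_one_iff_deriv.2 ⟨fun s => (hasDerivAt_posSq s).differentiableAt, ?_⟩
  rw [funext fun s => (hasDerivAt_posSq s).deriv]
  exact continuous_const.mul (continuous_id.max continuous_const)

/-- The test function, as a function of the values of `u` and `φ`. -/
def testFun (lam a b : ℝ) (p : ℝ × ℝ) : ℝ :=
  p.1 - p.2 + posSq (p.1 - p.2) * Real.exp (lam * (p.1 - a)) -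
    posSq (p.2 - p.1) * Real.exp (lam * (b - p.1))

lemma contDiff_testFun (lam a b : ℝ) : ContDiff ℝ 1 (testFun lam a b) := by
  have h1 : ContDiff ℝ 1 (Prod.fst : ℝ × ℝ → ℝ) := contDiff_fst
  have h2 : ContDiff ℝ 1 (Prod.snd : ℝ × ℝ → ℝ) := contDiff_snd
  exact ((h1.sub h2).add ((contDiff_posSq.comp (h1.sub h2)).mul
    (contDiff_const.mul (h1.sub contDiff_const)).exp)).sub
    ((contDiff_posSq.comp (h2.sub h1)).mul (contDiff_const.mul (contDiff_const.sub h1)).exp)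

lemma testFun_self (lam a b t : ℝ) : testFun lam a b (t, t) = 0 := by
  simp [testFun, posSq]

/-- The exponential weight of the test function. -/
def testWeight (lam a b : ℝ) (p : ℝ × ℝ) : ℝ :=
  if p.2 ≤ p.1 then Real.exp (lam * (p.1 - a)) else Real.exp (lam * (b - p.1))

/-- The exponent grows with `u` above `φ` and decays below, where the square enters with a minus
sign; so on both sides the weight contributes `+λ s² e` in the direction of `u`. -/
lemma fderiv_testFun (lam a b : ℝ) (p v : ℝ × ℝ) : fderiv ℝ (testFun lam a b) p v =
    (1 + 2 * |p.1 - p.2| * testWeight lam a b p) * (v.1 - v.2) +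
      lam * ((p.1 - p.2) ^ 2 * testWeight lam a b p) * v.1 := by
  have hline : HasDerivAt (fun r : ℝ => p + r • v) v 0 := by
    simpa using ((hasDerivAt_id (0 : ℝ)).smul_const v).const_add p
  have h1 : HasDerivAt (fun r : ℝ => testFun lam a b (p + r • v))
      (fderiv ℝ (testFun lam a b) p v) 0 := by
    have h := ((contDiff_testFun lam a b).differentiable one_ne_zero p).hasFDerivAt
    have h' : HasFDerivAt (testFun lam a b) (fderiv ℝ (testFun lam a b) p) (p + (0 : ℝ) • v) := by
      simpa using h
    exact h'.comp_hasDerivAt 0 hline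
  have hu : HasDerivAt (fun r : ℝ => p.1 + r * v.1) v.1 0 := by
    simpa using ((hasDerivAt_id (0 : ℝ)).mul_const v.1).const_add p.1
  have hφ : HasDerivAt (fun r : ℝ => p.2 + r * v.2) v.2 0 := by
    simpa using ((hasDerivAt_id (0 : ℝ)).mul_const v.2).const_add p.2
  have hp1 : HasDerivAt posSq (2 * max (p.1 - p.2) 0) (p.1 + 0 * v.1 - (p.2 + 0 * v.2)) := by
    simpa using hasDerivAt_posSq (p.1 - p.2)
  have hp2 : HasDerivAt posSq (2 * max (p.2 - p.1) 0) (p.2 + 0 * v.2 - (p.1 + 0 * v.1)) := by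
    simpa using hasDerivAt_posSq (p.2 - p.1)
  have h2 := ((hu.sub hφ).add ((hp1.comp 0 (hu.sub hφ)).mul
    ((hu.sub_const a).const_mul lam).exp)).sub
    ((hp2.comp 0 (hφ.sub hu)).mul ((hu.const_sub b).const_mul lam).exp)
  refine (h1.unique h2).trans ?_
  simp only [Pi.sub_apply, Function.comp, zero_mul, add_zero, testWeight, posSq]
  split_ifs with h
  · rw [max_eq_left (sub_nonneg.2 h), max_eq_right (sub_nonpos.2 h), abs_of_nonneg (sub_nonneg.2 h)]
    ring
  · rw [not_le] at h
    rw [max_eq_right (sub_nonpos.2 h.le), max_eq_left (sub_nonneg.2 h.le),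
      abs_of_neg (sub_neg.2 h)]
    ring

lemma abs_testFun_le (lam a b : ℝ) (p : ℝ × ℝ) :
    |testFun lam a b p| ≤ |p.1 - p.2| + (p.1 - p.2) ^ 2 * testWeight lam a b p := by
  simp only [testFun, testWeight, posSq]
  split_ifs with h
  · rw [max_eq_left (sub_nonneg.2 h), max_eq_right (sub_nonpos.2 h)]
    refine le_of_eq ?_
    rw [abs_of_nonneg (sub_nonneg.2 h), abs_of_nonneg]
    · ring
    · have := sub_nonneg.2 h
      simp only [ne_eq, OfNat.ofNat_ne_zero, not_false_eq_true, zero_pow, zero_mul, sub_zero]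
      positivity
  · rw [not_le] at h
    rw [max_eq_right (sub_nonpos.2 h.le), max_eq_left (sub_nonneg.2 h.le), abs_of_neg (sub_neg.2 h),
      abs_of_nonpos]
    · refine le_of_eq ?_; ring
    · have h1 : p.1 - p.2 ≤ 0 := (sub_neg.2 h).le
      have h2 : 0 ≤ (p.2 - p.1) ^ 2 * Real.exp (lam * (b - p.1)) := by positivity
      simp only [ne_eq, OfNat.ofNat_ne_zero, not_false_eq_true, zero_pow, zero_mul, add_zero]
      linarith

lemma testWeight_mem {lam a b : ℝ} (hlam : 0 ≤ lam) {p : ℝ × ℝ} (hp : p.1 ∈ Icc a b) :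
    1 ≤ testWeight lam a b p ∧ testWeight lam a b p ≤ Real.exp (lam * (b - a)) := by
  obtain ⟨h1, h2⟩ := hp
  unfold testWeight
  split_ifs
  · exact ⟨Real.one_le_exp (mul_nonneg hlam (by linarith)), Real.exp_le_exp.2 (by gcongr)⟩
  · exact ⟨Real.one_le_exp (mul_nonneg hlam (by linarith)), Real.exp_le_exp.2 (by gcongr)⟩

/-- The pointwise inequality satisfied by the test function: `s = u - φ`, `e` is its weight, `q` is
the square of the slope of `u`, and `d` is the pairing of `dφ` with the gradient of `u`. -/
lemma testFun_lower_bound {κ η Λ C δ lam ℓ e₁ q d R s e : ℝ} (hη : 0 < η) (hΛ : 0 ≤ Λ) (hC : 0 ≤ C)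
    (hδ : 0 < δ) (hκ : 0 ≤ κ) (hκδ : κ = 1 - 2 * δ)
    (hlam : C + Λ / η ^ 2 + 2 * Λ / η + C / η + δ / η ^ 2 + C ^ 2 / (4 * δ) ≤ lam)
    (hq0 : 0 ≤ q) (hq1 : q < 1) (hd : d ^ 2 ≤ R * q) (hR : R ≤ Λ ^ 2)
    (hRη : |s| ≤ η → R ≤ κ ^ 2) (he : 1 ≤ e) (hee : e ≤ e₁) (hs : |s| ≤ ℓ) :
    δ - (1 + 2 * ℓ * e₁ + lam * (ℓ ^ 2 * e₁)) * (1 - q) ≤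
      (1 + 2 * |s| * e) * (q - d) + lam * (s ^ 2 * e) * q - C * (|s| + s ^ 2 * e) := by
  have hr : 0 ≤ |s| := abs_nonneg s
  rw [← sq_abs s]
  set r := |s| with hrdef
  have hlam0 : 0 ≤ lam := le_trans (by positivity) hlam
  have hdle : ∀ K, 0 ≤ K → R ≤ K ^ 2 → d ≤ K := fun K hK hRK => by
    refine abs_le_of_sq_le_sq' ?_ hK |>.2
    have h1 : R * q ≤ K ^ 2 * q := mul_le_mul_of_nonneg_right hRK hq0
    have h2 : K ^ 2 * q ≤ K ^ 2 := mul_le_of_le_one_right (sq_nonneg _) hq1.le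
    linarith
  have hA : 1 + 2 * r * e ≤ 1 + 2 * ℓ * e₁ := by
    have : r * e ≤ ℓ * e₁ := mul_le_mul hs hee (by linarith) (hr.trans hs)
    linarith
  have hB : r ^ 2 * e ≤ ℓ ^ 2 * e₁ :=
    mul_le_mul (pow_le_pow_left₀ hr hs 2) hee (by linarith) (sq_nonneg _)
  have hA1 : 1 ≤ 1 + 2 * r * e := by
    have : 0 ≤ r * e := by positivity
    linarith
  have hB0 : r ^ 2 ≤ r ^ 2 * e := le_mul_of_one_le_right (sq_nonneg r) he
  have hAB : (1 + 2 * r * e + lam * (r ^ 2 * e)) * (1 - q) ≤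
      (1 + 2 * ℓ * e₁ + lam * (ℓ ^ 2 * e₁)) * (1 - q) := by
    refine mul_le_mul_of_nonneg_right ?_ (by linarith)
    have := mul_le_mul_of_nonneg_left hB hlam0
    linarith
  -- Near `Σ` the uniform bound `κ < 1` gives a gain of `2δ`. One `δ` absorbs the linear error,
  -- through `C r ≤ δ + C² r²/(4δ)`, and `λ` absorbs the quadratic errors.
  rcases le_or_gt r η with hn | hf
  · have hd1 := hdle κ hκ (hRη hn)
    have h1 : (1 + 2 * r * e) * (2 * δ - (1 - q)) ≤ (1 + 2 * r * e) * (q - d) :=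
      mul_le_mul_of_nonneg_left (by linarith) (by linarith)
    have h2 : C + C ^ 2 / (4 * δ) ≤ lam := le_trans (by
      have : 0 ≤ Λ / η ^ 2 + 2 * Λ / η + C / η + δ / η ^ 2 := by positivity
      linarith) hlam
    have h3 : C ^ 2 / (4 * δ) * r ^ 2 - C * r + δ = δ * (C * r / (2 * δ) - 1) ^ 2 := by
      field_simp; ring
    have h4 : C ^ 2 / (4 * δ) * r ^ 2 ≤ (lam - C) * (r ^ 2 * e) :=
      mul_le_mul (by linarith) hB0 (sq_nonneg _) (le_trans (by positivity)
        (show C ^ 2 / (4 * δ) ≤ lam - C by linarith))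
    have h5 : 0 ≤ δ * (C * r / (2 * δ) - 1) ^ 2 := by positivity
    have h6 : 2 * δ ≤ (1 + 2 * r * e) * (2 * δ) := le_mul_of_one_le_left (by linarith) hA1
    linarith
  -- Far from `Σ` the slope of `φ` is bounded by `Λ` only. Since `r > η`, the quantities `1`, `r`
  -- and `r e` are at most multiples of `B = r² e`, so each summand of `λ` pays for one error term.
  · have hd1 := hdle Λ hΛ hR
    have h1 : (1 + 2 * r * e) * (-Λ - (1 - q)) ≤ (1 + 2 * r * e) * (q - d) :=
      mul_le_mul_of_nonneg_left (by linarith) (by linarith)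
    set B := r ^ 2 * e with hBdef
    have hBη : η ^ 2 ≤ B := (pow_le_pow_left₀ hη.le hf.le 2).trans hB0
    have hreB : r * e ≤ B / η := by
      rw [le_div_iff₀ hη, hBdef]
      have : r * η ≤ r * r := mul_le_mul_of_nonneg_left hf.le hr
      nlinarith
    have hrB : r ≤ B / η := (le_mul_of_one_le_right hr he).trans hreB
    have h1B : 1 ≤ B / η ^ 2 := by rwa [le_div_iff₀ (by positivity), one_mul]
    have hBpos : 0 ≤ B := by positivity
    have h7 := mul_le_mul_of_nonneg_right hlam hBpos
    have h8 : (C + Λ / η ^ 2 + 2 * Λ / η + C / η + δ / η ^ 2 + C ^ 2 / (4 * δ)) * B =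
      C * B + Λ * (B / η ^ 2) + 2 * Λ * (B / η) + C * (B / η) + δ * (B / η ^ 2) +
        C ^ 2 / (4 * δ) * B := by ring
    have h9 := mul_le_mul_of_nonneg_left h1B hΛ
    have h10 := mul_le_mul_of_nonneg_left hreB hΛ
    have h11 := mul_le_mul_of_nonneg_left hrB hC
    have h12 := mul_le_mul_of_nonneg_left h1B hδ.le
    have h13 : 0 ≤ C ^ 2 / (4 * δ) * B := by positivity
    linarith

end RealEstimates

/-! ## The tilt estimate -/

section TiltEstimate

variable {m : ℕ} [NeZero m] {S : Type*} [TopologicalSpace S]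
  [ChartedSpace (EuclideanSpace ℝ (Fin m)) S] [IsManifold (𝓡 m) ∞ S] {𝓜 : SplitSpacetime m S}
  {Sig : Type*} [TopologicalSpace Sig] [ChartedSpace (EuclideanHalfSpace m) Sig]
  [IsManifold (𝓡∂ m) ∞ Sig] {ι : Sig → ℝ × S}

local notation "E" => EuclideanSpace ℝ (Fin m)

omit [IsManifold (𝓡∂ m) ∞ Sig] in
lemma differential_comp_pair {u φ : Sig → ℝ} {x : Sig} (hu : MDifferentiableAt (𝓡∂ m) 𝓘(ℝ, ℝ) u x)
    (hφ : MDifferentiableAt (𝓡∂ m) 𝓘(ℝ, ℝ) φ x) {Ψ : ℝ × ℝ → ℝ}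
    (hΨ : DifferentiableAt ℝ Ψ (u x, φ x)) (v : E) :
    differential (fun x => Ψ (u x, φ x)) x v =
      fderiv ℝ Ψ (u x, φ x) (differential u x v, differential φ x v) := by
  have h1 : HasMFDerivAt (𝓡∂ m) 𝓘(ℝ, ℝ × ℝ) (fun x => (u x, φ x)) x
      ((differential u x).prod (differential φ x)) :=
    ⟨hu.hasMFDerivAt.1.prodMk hφ.hasMFDerivAt.1, hu.hasMFDerivAt.2.prodMk hφ.hasMFDerivAt.2⟩
  have h2 := hΨ.hasFDerivAt.hasMFDerivAt.comp x h1
  exact congrArg (fun T : E →L[ℝ] ℝ => T v) h2.mfderiv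

/-- The test function evaluated along the graph of `u`. -/
def graphTest (lam a b : ℝ) (ι : Sig → ℝ × S) (u : Sig → ℝ) (x : Sig) : ℝ :=
  testFun lam a b (u x, SplitSpacetime.height ι x)

lemma contMDiff_graphTest (hι : 𝓜.IsSmoothSpacelikeHypersurface ι) {u : Sig → ℝ}
    (hu : ContMDiff (𝓡∂ m) 𝓘(ℝ, ℝ) ∞ u) (lam a b : ℝ) :
    ContMDiff (𝓡∂ m) 𝓘(ℝ, ℝ) 1 (graphTest lam a b ι u) :=
  (contDiff_testFun lam a b).contMDiff.comp
    ((hu.prodMk_space (contMDiff_height hι)).of_le (by simp))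

/-- The test function controls the tilt from above, up to constants. -/
lemma exists_graphTest_bound [CompactSpace Sig] (hι : 𝓜.IsSmoothSpacelikeHypersurface ι) {a b : ℝ}
    (hφ : ∀ x, SplitSpacetime.height ι x ∈ Icc a b) {C : ℝ} (hC : 0 ≤ C) :
    ∃ lam δ C₂ M : ℝ, 0 < δ ∧ 0 ≤ C₂ ∧ 0 ≤ M ∧ ∀ u : Sig → ℝ, ContMDiff (𝓡∂ m) 𝓘(ℝ, ℝ) ∞ u →
      (∀ x, slopeSq 𝓜 ι u x < 1) → (∀ x, u x ∈ Icc a b) → ∀ x,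
      |graphTest lam a b ι u x| ≤ M ∧ δ * gammaFactor 𝓜 ι u x - C₂ ≤
        gammaFactor 𝓜 ι u x * differential (graphTest lam a b ι u) x (spatialGrad 𝓜 ι u x) -
          C * (|graphTest lam a b ι u x| * gammaFactor 𝓜 ι u x) := by
  obtain ⟨κ, η, hκ0, hκ1, hη, hnear⟩ := exists_heightSlope_near hι
  obtain ⟨Λ, hΛ, hfar⟩ := exists_heightSlope_bound hι a b
  set δ := (1 - κ) / 2 with hδdef
  have hδ : 0 < δ := by rw [hδdef]; linarith
  set lam := C + Λ / η ^ 2 + 2 * Λ / η + C / η + δ / η ^ 2 + C ^ 2 / (4 * δ) with hlamdef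
  have hlam : 0 ≤ lam := by positivity
  set e₁ := Real.exp (lam * (b - a)) with he₁
  set ℓ := |b - a| with hℓ
  refine ⟨lam, δ, 1 + 2 * ℓ * e₁ + lam * (ℓ ^ 2 * e₁), ℓ + ℓ ^ 2 * e₁, hδ, by positivity,
    by positivity, fun u hu hq hub x => ?_⟩
  set p : ℝ × ℝ := (u x, SplitSpacetime.height ι x) with hp
  set e := testWeight lam a b p with he
  obtain ⟨hw1, hw2⟩ : 1 ≤ e ∧ e ≤ e₁ := testWeight_mem hlam (p := p) (hub x)
  have hs : |p.1 - p.2| ≤ ℓ := by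
    have h1 := hub x
    have h2 := hφ x
    have h3 := le_abs_self (b - a)
    exact abs_le.2 ⟨by linarith [h1.1, h2.2], by linarith [h1.2, h2.1]⟩
  have hψ : |graphTest lam a b ι u x| ≤ |p.1 - p.2| + (p.1 - p.2) ^ 2 * e := abs_testFun_le lam a b p
  have hsq : (p.1 - p.2) ^ 2 ≤ ℓ ^ 2 := by
    rw [← sq_abs (p.1 - p.2)]; exact pow_le_pow_left₀ (abs_nonneg _) hs 2
  refine ⟨hψ.trans (add_le_add hs (mul_le_mul hsq hw2 (by linarith) (sq_nonneg _))), ?_⟩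
  set W := gammaFactor 𝓜 ι u x with hW
  have hW1 : 1 ≤ W := one_le_gammaFactor hι (hq x)
  have hWsq : W ^ 2 * (1 - slopeSq 𝓜 ι u x) = 1 := gammaFactor_sq (hq x)
  set q := slopeSq 𝓜 ι u x with hqdef
  set d := differential (SplitSpacetime.height ι) x (spatialGrad 𝓜 ι u x) with hd
  have hself : spatialForm 𝓜 ι (u x) x (spatialGrad 𝓜 ι u x) (spatialGrad 𝓜 ι u x) = q :=
    congrArg (fun T : E →L[ℝ] ℝ => T (spatialGrad 𝓜 ι u x))
      ((isInner_spatialForm hι (u x) x).apply_sharp (differential u x))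
  have hdR : d ^ 2 ≤ heightSlope 𝓜 ι (u x) x * q := by
    rw [← hself]
    exact (isInner_spatialForm hι (u x) x).sq_le _ _
  have hdψ : differential (graphTest lam a b ι u) x (spatialGrad 𝓜 ι u x) =
      (1 + 2 * |p.1 - p.2| * e) * (q - d) + lam * ((p.1 - p.2) ^ 2 * e) * q := by
    have h1 := differential_comp_pair (hu.mdifferentiable (by simp) x)
      ((contMDiff_height hι).mdifferentiable (by simp) x)
      ((contDiff_testFun lam a b).differentiable one_ne_zero p) (spatialGrad 𝓜 ι u x)
    exact h1.trans (fderiv_testFun lam a b p _)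
  have hmain := testFun_lower_bound hη hΛ hC hδ hκ0 (by rw [hδdef]; ring) hlamdef.ge
    (slopeSq_nonneg hι u x) (hq x) hdR (hfar _ (hub x) x) (hnear (u x) x) hw1 hw2 hs
  rw [hdψ]
  set C₂ := 1 + 2 * ℓ * e₁ + lam * (ℓ ^ 2 * e₁) with hC₂
  have hC₂0 : 0 ≤ C₂ := by positivity
  have h2 := mul_le_mul_of_nonneg_left hmain (by linarith : 0 ≤ W)
  -- The defect `1 - q` is `W⁻²`, so after multiplication by `W` it costs at most the constant `C₂`.
  have h3 : W * (1 - q) ≤ 1 := by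
    have : W * (1 - q) ≤ W * (W * (1 - q)) :=
      le_mul_of_one_le_left (mul_nonneg (by linarith) (by linarith [hq x])) hW1
    linarith
  have h4 := mul_le_mul_of_nonneg_left h3 hC₂0
  have h5 := mul_le_mul_of_nonneg_left (mul_le_mul_of_nonneg_right hψ (by linarith : 0 ≤ W)) hC
  linarith

/-- The final arithmetic: `I` is the integral of the tilt, `J` the volume and `Q` the norm of `ρ`
for `σ_u`, while `V` and `P` are the last two for `σ_φ`. -/
lemma le_of_combined_bounds {A B D c V P I J Q : ℝ} (hA : 0 < A) (hB : 0 ≤ B) (hD : 0 ≤ D)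
    (hc : 0 ≤ c) (hV : 0 ≤ V) (hP : 0 ≤ P) (h : A * I - B * J - D * Q ≤ 0) (hJ : J ≤ c * V)
    (hQ : Q ≤ c * P) : I ≤ (B * (c * V) + D * c) / A * (1 + P) := by
  rw [div_mul_eq_mul_div, le_div_iff₀ hA]
  have h1 := mul_le_mul_of_nonneg_left hJ hB
  have h2 := mul_le_mul_of_nonneg_left hQ hD
  have h3 : 0 ≤ B * (c * V) * P := by positivity
  have h4 : 0 ≤ D * c := by positivity
  linarith

variable [MeasurableSpace Sig] [BorelSpace Sig] [CompactSpace Sig] [T2Space Sig]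

/-- The tilt estimate for graphs with bounded height and a bound `|H| ≤ |ρ| + c w` on their mean
curvature. -/
lemma exists_tilt_estimate (hι : 𝓜.IsSmoothSpacelikeHypersurface ι) {a b : ℝ}
    (hφ : ∀ x, SplitSpacetime.height ι x ∈ Icc a b) {c : ℝ} (hc : 0 ≤ c) :
    ∃ K : ℝ, ∀ ρ u : Sig → ℝ, Continuous ρ → ContMDiff (𝓡∂ m) 𝓘(ℝ, ℝ) ∞ u →
      (∀ x, slopeSq 𝓜 ι u x < 1) → (∀ x, u x ∈ Icc a b) →
      (∀ x ∈ (𝓡∂ m).boundary Sig, u x = SplitSpacetime.height ι x) →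
      (∀ x ∈ (𝓡∂ m).interior Sig, |𝓜.meanCurvature ι u x| ≤ |ρ x| + c * gammaFactor 𝓜 ι u x) →
      ∫ x, gammaFactor 𝓜 ι u x ∂(riemannianVolume (𝓡∂ m) (𝓜.σPull ι u)) ≤
        K * (1 + ∫ x, |ρ x| ∂(riemannianVolume (𝓡∂ m)
          (𝓜.σPull ι (SplitSpacetime.height ι)))) := by
  obtain ⟨c₁, hc₁, hint⟩ := exists_integral_inequality (𝓜 := 𝓜) hι a b
  obtain ⟨cv, hcv, hvol⟩ := exists_volume_comparison (𝓜 := 𝓜) hι a b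
  obtain ⟨α₀, α₁, hα₀, hα₁, hα⟩ := exists_lapse_bounds hι a b
  -- This constant collects all terms of the form `|ψ| W` on the right: `c₁` from the drift, and `α₁
  -- c` from the part of the curvature bound proportional to the tilt.
  obtain ⟨lam, δ, C₂, M, hδ, hC₂, hM, htest⟩ :=
    exists_graphTest_bound hι hφ (C := c₁ + α₁ * c) (by positivity)
  set V := ∫ _x, (1 : ℝ) ∂(riemannianVolume (𝓡∂ m) (𝓜.σPull ι (SplitSpacetime.height ι))) with hV
  have hV0 : 0 ≤ V := integral_nonneg fun _ => zero_le_one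
  refine ⟨(α₁ ^ m * C₂ * (cv * V) + α₁ ^ (m + 1) * M * cv) / (δ * α₀ ^ m),
    fun ρ u hρ hu hq hub hbd hH => ?_⟩
  set μ := riemannianVolume (𝓡∂ m) (𝓜.σPull ι u) with hμ
  set P := ∫ x, |ρ x| ∂(riemannianVolume (𝓡∂ m) (𝓜.σPull ι (SplitSpacetime.height ι))) with hP
  have hP0 : 0 ≤ P := integral_nonneg fun _ => abs_nonneg _
  set ψ := graphTest lam a b ι u with hψdef
  have hψ : ContMDiff (𝓡∂ m) 𝓘(ℝ, ℝ) 1 ψ := contMDiff_graphTest hι hu lam a b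
  have hW := continuous_gammaFactor hι hu hq
  have hαc := continuous_lapseAt (𝓜 := 𝓜) hι hu.continuous
  have hψb : ∀ x ∈ (𝓡∂ m).boundary Sig, ψ x = 0 := fun x hx => by
    rw [hψdef, graphTest, hbd x hx, testFun_self]
  have hmain := hint u hu hq hub ψ (fun x => |ρ x| + c * gammaFactor 𝓜 ι u x) hψ hψb
    (hρ.abs.add (continuous_const.mul hW)) hH
  have hg := continuous_gradPairing (𝓜 := 𝓜) hι hu hψ
  have hint' : ∀ {f : Sig → ℝ}, Continuous f → Integrable f μ := fun hf =>
    integrable_of_continuous hι hu hf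
  have hi1 : Integrable (fun x => lapseAt 𝓜 ι u x ^ m * gammaFactor 𝓜 ι u x *
      differential ψ x (spatialGrad 𝓜 ι u x)) μ := hint' (((hαc.pow m).mul hW).mul hg)
  have hi2 : Integrable (fun x => lapseAt 𝓜 ι u x ^ m * |ψ x| * (c₁ * gammaFactor 𝓜 ι u x +
      lapseAt 𝓜 ι u x * (|ρ x| + c * gammaFactor 𝓜 ι u x))) μ :=
    hint' (((hαc.pow m).mul hψ.continuous.abs).mul ((continuous_const.mul hW).add
      (hαc.mul (hρ.abs.add (continuous_const.mul hW)))))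
  have hi3 : Integrable (fun x => δ * α₀ ^ m * gammaFactor 𝓜 ι u x) μ :=
    hint' (continuous_const.mul hW)
  have hi4 : Integrable (fun _ => α₁ ^ m * C₂ * 1) μ := hint' continuous_const
  have hi5 : Integrable (fun x => α₁ ^ (m + 1) * M * |ρ x|) μ :=
    hint' (continuous_const.mul hρ.abs)
  -- The lower bound for the test function multiplied by `α^m`, with the lapse replaced by `α₀` in
  -- the good term and by `α₁` in the errors. Only the part of the curvature bound with `ρ` is left
  -- unabsorbed.
  have hpt : ∀ x, δ * α₀ ^ m * gammaFactor 𝓜 ι u x - α₁ ^ m * C₂ * 1 -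
      α₁ ^ (m + 1) * M * |ρ x| ≤
      lapseAt 𝓜 ι u x ^ m * gammaFactor 𝓜 ι u x * differential ψ x (spatialGrad 𝓜 ι u x) -
        lapseAt 𝓜 ι u x ^ m * |ψ x| * (c₁ * gammaFactor 𝓜 ι u x +
          lapseAt 𝓜 ι u x * (|ρ x| + c * gammaFactor 𝓜 ι u x)) := fun x => by
    obtain ⟨hψM, hlow⟩ := htest u hu hq hub x
    obtain ⟨hl0, hl1⟩ : α₀ ≤ lapseAt 𝓜 ι u x ∧ lapseAt 𝓜 ι u x ≤ α₁ := hα _ (hub x) x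
    have hW1 := one_le_gammaFactor hι (hq x)
    change |ψ x| ≤ M at hψM
    change _ ≤ _ * differential ψ x _ - _ * (|ψ x| * _) at hlow
    have hψ0 := abs_nonneg (ψ x)
    have hρ0 := abs_nonneg (ρ x)
    generalize differential ψ x (spatialGrad 𝓜 ι u x) = D at *
    generalize |ψ x| = y at *
    generalize |ρ x| = r at *
    generalize gammaFactor 𝓜 ι u x = W at *
    generalize lapseAt 𝓜 ι u x = α at *
    have hα0 : 0 < α := hα₀.trans_le hl0
    have hm0 : 0 < α ^ m := pow_pos hα0 m
    have hm1 : α ^ m ≤ α₁ ^ m := pow_le_pow_left₀ hα0.le hl1 m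
    have hm2 : α₀ ^ m ≤ α ^ m := pow_le_pow_left₀ hα₀.le hl0 m
    have h1 := mul_le_mul_of_nonneg_left hlow hm0.le
    have h2 : α ^ m * (α * y * (c * W)) ≤ α ^ m * (α₁ * y * (c * W)) := by gcongr
    have h3 : α ^ m * (y * (α * r)) ≤ α₁ ^ m * (M * (α₁ * r)) := by gcongr
    have h4 : δ * α₀ ^ m * W ≤ δ * α ^ m * W := by gcongr
    have h5 : α ^ m * C₂ ≤ α₁ ^ m * C₂ := by gcongr
    have h6 : α₁ ^ (m + 1) * M * r = α₁ ^ m * (M * (α₁ * r)) := by ring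
    rw [h6, mul_one]
    linarith
  have hlow := integral_mono ((hi3.sub hi4).sub hi5) (hi1.sub hi2) hpt
  have e1 : ∫ x, (δ * α₀ ^ m * gammaFactor 𝓜 ι u x - α₁ ^ m * C₂ * 1 -
      α₁ ^ (m + 1) * M * |ρ x|) ∂μ = δ * α₀ ^ m * ∫ x, gammaFactor 𝓜 ι u x ∂μ -
      α₁ ^ m * C₂ * ∫ _x, (1 : ℝ) ∂μ - α₁ ^ (m + 1) * M * ∫ x, |ρ x| ∂μ := by
    refine (integral_sub (hi3.sub hi4) hi5).trans ?_
    rw [integral_const_mul]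
    refine congrArg (· - _) ((integral_sub hi3 hi4).trans ?_)
    rw [integral_const_mul, integral_const_mul]
  have hlow' : δ * α₀ ^ m * ∫ x, gammaFactor 𝓜 ι u x ∂μ - α₁ ^ m * C₂ * ∫ _x, (1 : ℝ) ∂μ -
      α₁ ^ (m + 1) * M * ∫ x, |ρ x| ∂μ ≤ 0 := by
    rw [← e1]
    exact hlow.trans ((integral_sub hi1 hi2).trans_le (sub_nonpos.2 hmain))
  have hv1 : ∫ _x, (1 : ℝ) ∂μ ≤ cv * V :=
    hvol u hu hub (fun _ => 1) continuous_const fun _ => zero_le_one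
  have hv2 : ∫ x, |ρ x| ∂μ ≤ cv * P := hvol u hu hub _ hρ.abs fun _ => abs_nonneg _
  exact le_of_combined_bounds (by positivity) (by positivity) (by positivity) hcv hV0 hP0 hlow' hv1
    hv2

end TiltEstimate

end SpacelikePMC

end

/-! ### The theorem. -/

open SpacelikePMC SplitSpacetime in
theorem mainTheorem4 {m : ℕ} [NeZero m]
    {S : Type*} [TopologicalSpace S] [T2Space S] [SecondCountableTopology S]
    [ChartedSpace (EuclideanSpace ℝ (Fin m)) S] [IsManifold (𝓡 m) ∞ S]
    (𝓜 : SplitSpacetime m S) (hGH : 𝓜.IsGloballyHyperbolicSplitting)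
    {Sig : Type*} [TopologicalSpace Sig] [T2Space Sig] [CompactSpace Sig] [ConnectedSpace Sig]
    [ChartedSpace (EuclideanHalfSpace m) Sig] [IsManifold (𝓡∂ m) ∞ Sig]
    [MeasurableSpace Sig] [BorelSpace Sig]
    (ι : Sig → ℝ × S) (hι : 𝓜.IsSmoothSpacelikeHypersurface ι)
    (hC : IsCompact (closure (𝓜.cauchyDevelopment (range ι))))
    (X : (p : ℝ × S) → TangentSpace (ambientModel m) p)
    (hX : ContMDiff (ambientModel m) (ambientModel m).tangent ∞
      (fun p => (⟨p, X p⟩ : TangentBundle (ambientModel m) (ℝ × S)))) :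
    ∃ C : ℝ, ∀ (ρ : Sig → ℝ) (u : Sig → ℝ),
      ContMDiff (𝓡∂ m) 𝓘(ℝ, ℝ) ∞ ρ →
      u ∈ 𝓜.Yτ ι →
      ContMDiff (𝓡∂ m) 𝓘(ℝ, ℝ) ∞ u →
      (∀ x, 𝓜.gradNorm ι u x < 1) →
      (∀ x ∈ (𝓡∂ m).interior Sig,
        𝓜.meanCurvature ι u x = ρ x + 𝓜.g (graphMap ι u x) (X _) (𝓜.normal ι u x)) →
      Integrable (𝓜.tilt ι u) (riemannianVolume (𝓡∂ m) (𝓜.σPull ι u)) ∧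
        ∫ x, 𝓜.tilt ι u x ∂(riemannianVolume (𝓡∂ m) (𝓜.σPull ι u)) ≤
          C * (1 + ∫ x, |ρ x| ∂(riemannianVolume (𝓡∂ m) (𝓜.σPull ι (height ι)))) := by
  obtain ⟨a, b, hab⟩ := exists_height_bound hι hC
  -- The height function is itself admissible, so it obeys the same bounds as `u`.
  have hφ : ∀ x, height ι x ∈ Icc a b :=
    hab _ (contMDiff_height hι) (slopeSq_height_lt_one hι) fun _ _ => rfl
  obtain ⟨c, hc, hXc⟩ := exists_normal_component_bound (𝓜 := 𝓜) hι hX a b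
  obtain ⟨K, hK⟩ := exists_tilt_estimate hι hφ hc
  refine ⟨K, fun ρ u hρ hu hus hgrad hH => ?_⟩
  have hq : ∀ x, slopeSq 𝓜 ι u x < 1 := fun x => slopeSq_lt_one hι (hgrad x)
  have hub := hab u hus hq hu.2.2
  have htilt : 𝓜.tilt ι u = gammaFactor 𝓜 ι u := funext fun x => tilt_eq hι hus (hq x)
  rw [htilt]
  refine ⟨integrable_of_continuous hι hus (continuous_gammaFactor hι hus hq),
    hK ρ u hρ.continuous hus hq hub hu.2.2 fun x hx => ?_⟩
  rw [hH x hx]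
  -- The equation enters only through `|H| ≤ |ρ| + cW`.
  exact (abs_add_le _ _).trans (add_le_add le_rfl (hXc u hus x (hq x) (hub x)))
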